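/- **Theorem 2.2 (local uniqueness).** Let $n\in\{2,3\}$, let $\Omega\subset\mathbb R^n$ be a bounded Lipschitz domain (open, connected, non-empty) and let $\lambda\in\mathbb C$. *Admissible inclusions.* We write $(D;f)\in\mathscr A$ if $D$ is a bounded Lipschitz domain with $\overline D\subset\Omega$ and $\Omega\setminus\overline D$ connected, $f:D\times\mathbb C\to\mathbb C$, and with $a(\mathbf x,z)=(f(\mathbf x,z)-\lambda z)\chi_D(\mathbf x)+\lambda z$ the following hold: (i) for each $\mathbf x\in\Omega$ the function $a(\mathbf x,\cdot)$ is $C^1$ (in the real sense), and $\partial_z a(\cdot,z)\in L^\infty(\Omega)$ for each $z\in\mathbb C$; (ii) $f(\cdot,v(\cdot))\in L^2(D)$ for every $v\in H^1(\Omega)$; (iii) there is $\gamma\in(0,1)$ such that $f$ is $\gamma$-Hölder continuous in $(\mathbf x,z)$ on $D\times\{|z|\le R\}$ for every $R>0$ (so $f$ extends uniquely to a continuous function on $\overline D\times\mathbb C$, again denoted by $f$); (iv) for some $\psi\in H^{1/2}(\partial\Omega)$ the problem $$\Delta u+a(\mathbf x,u)=0\ \text{ in }\Omega,\qquad u|_{\partial\Omega}=\psi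 \tag{1}$$ has a weak solution $u\in H^1(\Omega)$. Solutions of (1) are not assumed to be unique. *Corners.* For $\mathbf x_0\in\mathbb R^n$, let $K$ be either a circular cone $\{\mathbf y:\angle(\mathbf y-\mathbf x_0,\mathbf v)\le\theta_0\}$ (including $\mathbf x_0$) with $\mathbf v\neq 0$, $\theta_0\in(0,\pi/2)$, or, if $n=3$, a solid (not planar) polyhedral cone with apex $\mathbf x_0$ generated by $\ell\ge 3$ pairwise linearly independent edge vectors and contained in such a circular cone with apex $\mathbf x_0$. A set $A\subset\mathbb R^n$ is said to have a corner with apex $\mathbf x_0$ if, for some such $K$ and some $h>0$, $A\cap B_h(\mathbf x_0)=\operatorname{int}(K)\cap B_h(\mathbf x_0)$. *Statement.* Let $(D_j;f_j)\in\mathscr A$, $j=1,2$ (with the same $\lambda$), let $\psi\in H^{1/2}(\partial\Omega)$, and let $u_j\in H^1(\Omega)$ be a weak solution of (1) for $(D_j;f_j)$ with boundary value $\psi$. Suppose that the two boundary measurements coincide, i.e. $\partial_\nu u_1=\partial_\nu u_2$ on $\partial\Omega$ (normal derivatives in the weak sense of $H^{-1/2}(\partial\Omega)$), and that, for $j=1,2$,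 $$\lambda u_j(\mathbf x_c)-f_j(\mathbf x_c,u_j(\mathbf x_c))\neq0\quad\text{at the apex }\mathbf x_c\text{ of every corner of }D_j,$$ where point values of $u_j$ are those of its continuous representative in $\Omega$. Let $\mathbf G$ be a connected component of $\Omega\setminus\overline{D_1\cup D_2}$ with $\partial\mathbf G\cap\partial\Omega\ne\emptyset$. Then $D_1\Delta D_2$ has no corner with apex on $\partial\mathbf G$. -/

import Mathlib

open MeasureTheory Set Metric
open scoped ContDiff

noncomputable section

/-- Euclidean space `ℝⁿ`. -/
abbrev E (n : ℕ) : Type := EuclideanSpace ℝ (Fin n)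

/-! ### Lipschitz domains, cones and corners -/

/-- A bounded Lipschitz domain: a nonempty bounded connected open set which, near each of its
boundary points, is the open region above the graph of a Lipschitz function over the hyperplane
orthogonal to some unit vector `e` (`x - ⟪e, x⟫ e` is the projection to that hyperplane). -/
structure IsBoundedLipschitzDomain {n : ℕ} (Ω : Set (E n)) : Prop where
  isOpen : IsOpen Ω
  isConnected : IsConnected Ω
  isBounded : Bornology.IsBounded Ω
  locally_graph : ∀ p ∈ frontier Ω, ∃ r > 0, ∃ e : E n, ‖e‖ = 1 ∧
    ∃ (L : NNReal) (g : E n → ℝ), LipschitzWith L g ∧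
      ∀ x ∈ ball p r, (x ∈ Ω ↔ g (x - inner ℝ e x • e) < inner ℝ e x)

/-- The closed circular cone with apex `x₀`, axis `v` and opening angle `2 θ`. (The apex is listed
separately because the angle with the zero vector is `π / 2` by convention.) -/
def conicCone {n : ℕ} (x₀ v : E n) (θ : ℝ) : Set (E n) :=
  {y | y = x₀ ∨ InnerProductGeometry.angle (y - x₀) v ≤ θ}

/-- The closed polyhedral cone with apex `x₀` generated by the vectors `e 0, …, e (ℓ - 1)`. -/
def polyhedralCone {n ℓ : ℕ} (x₀ : E n) (e : Fin ℓ → E n) : Set (E n) :=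
  {y | ∃ c : Fin ℓ → ℝ, (∀ i, 0 ≤ c i) ∧ y = x₀ + ∑ i, c i • e i}

/-- `K` is a strictly convex circular cone with apex `x₀` (a sector if `n = 2`). -/
def IsConicCorner {n : ℕ} (x₀ : E n) (K : Set (E n)) : Prop :=
  ∃ v : E n, v ≠ 0 ∧ ∃ θ ∈ Ioo (0 : ℝ) (Real.pi / 2), K = conicCone x₀ v θ

/-- `K` is a strictly convex solid polyhedral cone in `ℝ³` with apex `x₀`, generated by `ℓ ≥ 3`
pairwise linearly independent vectors. Strict convexity means that it fits into a circular cone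
of opening angle less than `π`. The vectors have to span the space: a planar cone
is not a polyhedral one. (A generator that is not an edge may be removed without changing `K`.) -/
def IsPolyhedralCorner {n : ℕ} (x₀ : E n) (K : Set (E n)) : Prop :=
  n = 3 ∧ ∃ (ℓ : ℕ) (e : Fin ℓ → E n), 3 ≤ ℓ ∧
    (∀ i j, i ≠ j → LinearIndependent ℝ ![e i, e j]) ∧
    Submodule.span ℝ (range e) = ⊤ ∧
    K = polyhedralCone x₀ e ∧
    ∃ v : E n, v ≠ 0 ∧ ∃ θ ∈ Ioo (0 : ℝ) (Real.pi / 2), K ⊆ conicCone x₀ v θ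

/-- The set `A` has a (sectorial, conic or polyhedral) corner with apex `x₀`: in some ball around
`x₀` it coincides with the open cone, that is, with the interior of the closed cone `K`. -/
def HasCornerAt {n : ℕ} (A : Set (E n)) (x₀ : E n) : Prop :=
  ∃ K : Set (E n), (IsConicCorner x₀ K ∨ IsPolyhedralCorner x₀ K) ∧
    ∃ h > 0, A ∩ ball x₀ h = interior K ∩ ball x₀ h

/-! ### Sobolev spaces -/

/-- The partial derivative in the `i`-th coordinate direction. -/
def pderiv {n : ℕ} (i : Fin n) (φ : E n → ℂ) (x : E n) : ℂ :=
  fderiv ℝ φ x (EuclideanSpace.single i 1)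

/-- Test functions `φ ∈ C_c^∞(Ω; ℂ)`. -/
structure IsTestFun {n : ℕ} (Ω : Set (E n)) (φ : E n → ℂ) : Prop where
  smooth : ContDiff ℝ ∞ φ
  compact : HasCompactSupport φ
  support : tsupport φ ⊆ Ω

theorem IsTestFun.zero {n : ℕ} (Ω : Set (E n)) : IsTestFun Ω (0 : E n → ℂ) where
  smooth := contDiff_const
  compact := HasCompactSupport.zero
  support := by
    simp

theorem IsTestFun.add {n : ℕ} {Ω : Set (E n)} {φ χ : E n → ℂ} (hφ : IsTestFun Ω φ)
    (hχ : IsTestFun Ω χ) : IsTestFun Ω (φ + χ) where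
  smooth := hφ.smooth.add hχ.smooth
  compact := hφ.compact.add hχ.compact
  support := (tsupport_add φ χ).trans (union_subset hφ.support hχ.support)

theorem IsTestFun.smul {n : ℕ} {Ω : Set (E n)} {φ : E n → ℂ} (c : ℂ) (hφ : IsTestFun Ω φ) :
    IsTestFun Ω (c • φ) where
  smooth := contDiff_const.smul hφ.smooth
  compact := hφ.compact.smul_left (f := fun _ => c)
  support := (tsupport_smul_subset_right (fun _ => c) φ).trans hφ.support

theorem IsTestFun.memLp {n : ℕ} {Ω : Set (E n)} {φ : E n → ℂ} (hφ : IsTestFun Ω φ) :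
    MemLp φ 2 (volume.restrict Ω) :=
  (hφ.smooth.continuous.memLp_of_hasCompactSupport hφ.compact).restrict Ω

theorem IsTestFun.memLp_pderiv {n : ℕ} {Ω : Set (E n)} {φ : E n → ℂ} (hφ : IsTestFun Ω φ)
    (i : Fin n) : MemLp (pderiv i φ) 2 (volume.restrict Ω) := by
  have hc : Continuous (pderiv i φ) :=
    (hφ.smooth.continuous_fderiv (by simp)).clm_apply continuous_const
  have hs : HasCompactSupport (pderiv i φ) := hφ.compact.fderiv_apply ℝ _
  exact (hc.memLp_of_hasCompactSupport hs).restrict Ω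

/-- The Sobolev space `H¹(Ω; ℂ)`. An element is a pair `(u, (g₁, …, gₙ))` where `u ∈ L²(Ω)` and
`gᵢ ∈ L²(Ω)` is the weak partial derivative `∂ᵢu`. Only the values on `Ω` up to null sets matter. -/
def H1 {n : ℕ} (Ω : Set (E n)) : Submodule ℂ ((E n → ℂ) × (Fin n → E n → ℂ)) where
  carrier := {U | MemLp U.1 2 (volume.restrict Ω) ∧
    (∀ i, MemLp (U.2 i) 2 (volume.restrict Ω)) ∧
    ∀ i φ, IsTestFun Ω φ → ∫ x in Ω, U.1 x * pderiv i φ x = -∫ x in Ω, U.2 i x * φ x}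
  zero_mem' := by
    refine ⟨MemLp.zero, fun i => MemLp.zero, fun i φ _ => by simp⟩
  add_mem' := by
    rintro U V ⟨hU, hU', hUw⟩ ⟨hV, hV', hVw⟩
    refine ⟨hU.add hV, fun i => (hU' i).add (hV' i), fun i φ hφ => ?_⟩
    have h1 := hU.integrable_mul (hφ.memLp_pderiv i)
    have h2 := hV.integrable_mul (hφ.memLp_pderiv i)
    have h3 := (hU' i).integrable_mul hφ.memLp
    have h4 := (hV' i).integrable_mul hφ.memLp
    have e1 := integral_add h1 h2
    have e2 := integral_add h3 h4
    simp only [Pi.mul_apply] at e1 e2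
    simp only [Prod.fst_add, Prod.snd_add, Pi.add_apply, add_mul]
    rw [e1, e2, hUw i φ hφ, hVw i φ hφ, neg_add]
  smul_mem' := by
    rintro c U ⟨hU, hU', hUw⟩
    refine ⟨hU.const_smul c, fun i => (hU' i).const_smul c, fun i φ hφ => ?_⟩
    simp only [Prod.smul_fst, Prod.smul_snd, Pi.smul_apply, smul_eq_mul, mul_assoc]
    rw [integral_const_mul, integral_const_mul, hUw i φ hφ, mul_neg]

/-- The function underlying an element of `H¹(Ω)`. -/
def sobFn {n : ℕ} {Ω : Set (E n)} (U : H1 Ω) : E n → ℂ := U.1.1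

/-- The weak partial derivatives of an element of `H¹(Ω)`. -/
def sobGrad {n : ℕ} {Ω : Set (E n)} (U : H1 Ω) : Fin n → E n → ℂ := U.1.2

/-- `H¹₀(Ω)`: the closure of `C_c^∞(Ω)` in `H¹(Ω)`. -/
def H10 {n : ℕ} (Ω : Set (E n)) : Submodule ℂ (H1 Ω) where
  carrier := {U | ∀ ε : ENNReal, 0 < ε → ∃ φ, IsTestFun Ω φ ∧
    eLpNorm (sobFn U - φ) 2 (volume.restrict Ω) ≤ ε ∧
    ∀ i, eLpNorm (sobGrad U i - pderiv i φ) 2 (volume.restrict Ω) ≤ ε}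
  zero_mem' := by
    intro ε _
    refine ⟨0, IsTestFun.zero Ω, ?_, fun i => ?_⟩
    · simp [sobFn]
    · have : pderiv i (0 : E n → ℂ) = 0 := by
        funext x
        simp [pderiv]
      simp [sobGrad, this]
  add_mem' := by
    intro U V hU hV ε hε
    obtain ⟨φ, hφ, h1, h2⟩ := hU (ε / 2) (ENNReal.half_pos hε.ne')
    obtain ⟨χ, hχ, h3, h4⟩ := hV (ε / 2) (ENNReal.half_pos hε.ne')
    refine ⟨φ + χ, hφ.add hχ, ?_, fun i => ?_⟩
    · have e : sobFn (U + V) - (φ + χ) = (sobFn U - φ) + (sobFn V - χ) := by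
        simp only [sobFn, Submodule.coe_add, Prod.fst_add]
        abel
      rw [e]
      calc _ ≤ _ := eLpNorm_add_le (U.2.1.sub hφ.memLp).1 (V.2.1.sub hχ.memLp).1 (by norm_num)
        _ ≤ ε / 2 + ε / 2 := add_le_add h1 h3
        _ = ε := ENNReal.add_halves ε
    · have ep : pderiv i (φ + χ) = pderiv i φ + pderiv i χ := by
        funext x
        simp only [pderiv, Pi.add_apply]
        rw [fderiv_add (hφ.smooth.differentiable (by simp) x)
          (hχ.smooth.differentiable (by simp) x)]
        rfl
      have e : sobGrad (U + V) i - pderiv i (φ + χ) =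
          (sobGrad U i - pderiv i φ) + (sobGrad V i - pderiv i χ) := by
        rw [ep]
        simp only [sobGrad, Submodule.coe_add, Prod.snd_add, Pi.add_apply]
        abel
      rw [e]
      calc _ ≤ _ := eLpNorm_add_le ((U.2.2.1 i).sub (hφ.memLp_pderiv i)).1
            ((V.2.2.1 i).sub (hχ.memLp_pderiv i)).1 (by norm_num)
        _ ≤ ε / 2 + ε / 2 := add_le_add (h2 i) (h4 i)
        _ = ε := ENNReal.add_halves ε
  smul_mem' := by
    intro c U hU ε hε
    have hδ : 0 < ε / (‖c‖ₑ + 1) := ENNReal.div_pos hε.ne' (by simp)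
    have hle : ∀ t : ENNReal, t ≤ ε / (‖c‖ₑ + 1) → ‖c‖ₑ * t ≤ ε := by
      intro t ht
      calc ‖c‖ₑ * t ≤ (‖c‖ₑ + 1) * (ε / (‖c‖ₑ + 1)) := by
            gcongr
            exact le_self_add
        _ ≤ ε := ENNReal.mul_div_le
    obtain ⟨φ, hφ, h1, h2⟩ := hU _ hδ
    refine ⟨c • φ, hφ.smul c, ?_, fun i => ?_⟩
    · have e : sobFn (c • U) - c • φ = c • (sobFn U - φ) := by
        simp only [sobFn, Submodule.coe_smul, Prod.smul_fst, smul_sub]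
      rw [e, eLpNorm_const_smul]
      exact hle _ h1
    · have ep : pderiv i (c • φ) = c • pderiv i φ := by
        funext x
        simp only [pderiv, Pi.smul_apply]
        rw [fderiv_const_smul (hφ.smooth.differentiable (by simp) x)]
        rfl
      have e : sobGrad (c • U) i - pderiv i (c • φ) = c • (sobGrad U i - pderiv i φ) := by
        rw [ep]
        simp only [sobGrad, Submodule.coe_smul, Prod.smul_snd, Pi.smul_apply, smul_sub]
      rw [e, eLpNorm_const_smul]
      exact hle _ (h2 i)

/-- The trace space `H^{1/2}(∂Ω) = H¹(Ω) / H¹₀(Ω)` (on a bounded Lipschitz domain the trace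
operator of `H¹(Ω)` is onto `H^{1/2}(∂Ω)` and has the kernel `H¹₀(Ω)`). -/
abbrev HHalf {n : ℕ} (Ω : Set (E n)) : Type := H1 Ω ⧸ H10 Ω

/-- The Dirichlet trace `u ↦ u|_{∂Ω}`. -/
def sobTrace {n : ℕ} (Ω : Set (E n)) : H1 Ω →ₗ[ℂ] HHalf Ω := (H10 Ω).mkQ

/-- Linear functionals on `H^{1/2}(∂Ω)`; normal derivatives live here. (Those that arise from
Green's formula below are automatically bounded, so they are elements of `H^{-1/2}(∂Ω)`.) -/
abbrev HHalfDual {n : ℕ} (Ω : Set (E n)) : Type := HHalf Ω →ₗ[ℂ] ℂ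

/-- `Δu = w` in `Ω` in the weak sense, with `w ∈ L²(Ω)`. -/
def HasWeakLaplacian {n : ℕ} {Ω : Set (E n)} (U : H1 Ω) (w : E n → ℂ) : Prop :=
  MemLp w 2 (volume.restrict Ω) ∧ ∀ φ, IsTestFun Ω φ →
    ∫ x in Ω, ∑ i, sobGrad U i x * pderiv i φ x = -∫ x in Ω, w x * φ x

/-- `η` is the (weak) exterior normal derivative `∂_ν u` on `∂Ω`: with `Δu = w ∈ L²(Ω)`,
`⟨∂_ν u, v|_{∂Ω}⟩ = ∫_Ω ∇u · ∇v + ∫_Ω (Δu) v` for every `v ∈ H¹(Ω)` (Green's formula). -/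
def HasNormalDeriv {n : ℕ} {Ω : Set (E n)} (U : H1 Ω) (η : HHalfDual Ω) : Prop :=
  ∃ w, HasWeakLaplacian U w ∧ ∀ V : H1 Ω,
    η (sobTrace Ω V) = (∫ x in Ω, ∑ i, sobGrad U i x * sobGrad V i x) + ∫ x in Ω, w x * sobFn V x

/-! ### The semilinear problem and admissible inclusions -/

open Classical in
/-- `a(x, z) = (f(x, z) - λ z) χ_D(x) + λ z`. -/
def nonlinearity {n : ℕ} (D : Set (E n)) (lam : ℂ) (f : E n → ℂ → ℂ) (x : E n) (z : ℂ) : ℂ :=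
  if x ∈ D then f x z else lam * z

/-- `u ∈ H¹(Ω)` solves `Δu + a(x, u) = 0` in `Ω`, `u = ψ` on `∂Ω`, with `a` built from
`D`, `λ` and `f`. -/
def IsSolution {n : ℕ} {Ω : Set (E n)} (D : Set (E n)) (lam : ℂ) (f : E n → ℂ → ℂ)
    (ψ : HHalf Ω) (U : H1 Ω) : Prop :=
  HasWeakLaplacian U (fun x => -nonlinearity D lam f x (sobFn U x)) ∧ sobTrace Ω U = ψ

/-- `(D; f)` is an admissible inclusion in `Ω` with background coefficient `λ`.
The function `f` is given on `D × ℂ`; being Hölder continuous on `D × {|z| ≤ R}` for all `R`, it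
extends uniquely to `closure D × ℂ`, and `f x` for `x ∈ ∂D` denotes this extension. Values
`f x` with `x ∉ closure D` are never used. -/
structure IsAdmissibleInclusion {n : ℕ} (Ω D : Set (E n)) (lam : ℂ) (f : E n → ℂ → ℂ) :
    Prop where
  lipschitz : IsBoundedLipschitzDomain D
  closure_subset : closure D ⊆ Ω
  isConnected_compl : IsConnected (Ω \ closure D)
  /-- `a(x, ·)` is continuously differentiable, in the real sense, for each fixed `x ∈ Ω`. -/
  contDiff : ∀ x ∈ Ω, ContDiff ℝ 1 (nonlinearity D lam f x)
  /-- `∂_z a(·, z) ∈ L^∞(Ω)` for each `z`. -/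
  deriv_bounded : ∀ z : ℂ, ∃ C : ℝ, ∀ᵐ x ∂(volume.restrict Ω),
    ‖fderiv ℝ (nonlinearity D lam f x) z‖ ≤ C
  /-- `f(·, v(·)) ∈ L²` for all `v ∈ H¹(Ω)`. -/
  memLp_comp : ∀ V : H1 Ω, MemLp (fun x => f x (sobFn V x)) 2 (volume.restrict D)
  /-- Hölder continuity jointly in `(x, z)`, with constants that are local in `z`. -/
  holder : ∃ γ ∈ Ioo (0 : ℝ) 1, ∀ R : ℝ, ∃ C : ℝ, ∀ x ∈ closure D, ∀ y ∈ closure D,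
    ∀ z w : ℂ, ‖z‖ ≤ R → ‖w‖ ≤ R → ‖f x z - f y w‖ ≤ C * (‖x - y‖ + ‖z - w‖) ^ γ
  /-- The boundary value problem is solvable for some boundary value. -/
  solvable : ∃ (ψ : HHalf Ω) (U : H1 Ω), IsSolution D lam f ψ U

/-- `(ψ, η)` is the boundary measurement (Cauchy data) `(u|_{∂Ω}, ∂_ν u|_{∂Ω})` of a solution `u`
of the boundary value problem for `(D; f)` with boundary value `ψ`. -/
def IsBoundaryMeasurement {n : ℕ} {Ω : Set (E n)} (D : Set (E n)) (lam : ℂ) (f : E n → ℂ → ℂ)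
    (U : H1 Ω) (ψ : HHalf Ω) (η : HHalfDual Ω) : Prop :=
  IsSolution D lam f ψ U ∧ HasNormalDeriv U η

/-- The condition `λ u(x_c) - f(x_c, u(x_c)) ≠ 0` at every apex `x_c ∈ ∂D` of a corner of `D`.
Point values are those of the continuous representative of `u` in `Ω`, which is unique. -/
def CornerNondegenerate {n : ℕ} {Ω : Set (E n)} (D : Set (E n)) (lam : ℂ) (f : E n → ℂ → ℂ)
    (U : H1 Ω) : Prop :=
  ∀ u : E n → ℂ, ContinuousOn u Ω → u =ᵐ[volume.restrict Ω] sobFn U →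
    ∀ xc, HasCornerAt D xc → lam * u xc - f xc (u xc) ≠ 0

end

open MeasureTheory Set Metric
open scoped ContDiff

/-! Let `W` be `u₁ - u₂` on `Ω`, extended by zero. Equality of both Cauchy data means that the
extension creates no boundary layer: `ΔW = F` as distributions on all of `ℝⁿ`, where `F` is the
difference of the right-hand sides, also extended by zero (`hasDistribLaplacian_indicator_sub`). Off
`closure (D₁ ∪ D₂)` this is the Helmholtz equation, and `W` vanishes outside `Ω`, so unique
continuation across a point of `∂G ∩ ∂Ω` gives `W = 0` on `G` (`eq_zero_on_component`).

Suppose that `D₁ Δ D₂` coincides near a point of `∂G` with an open cone. The truncated cone is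
connected, hence lies in just one inclusion, say `D₁`, and the Lipschitz graph property then keeps
`D₂` away from the apex (`exists_ball_disjoint_of_corner`). So `D₁` itself has the corner. The
complement of the cone in a small ball is connected and contained in `G`; there `W = F = 0`, and the
continuous representatives of `u₁` and `u₂` agree at the apex. Inside the cone `F = λ u₂ - f₁(x,
u₁)` almost everywhere, which tends at the apex to the number `c = λ u₁ - f₁(·, u₁)` that
nondegeneracy requires to be nonzero.

The contradiction is `c = 0` (`IsSolidCone.eq_zero_of_hasDistribLaplacian`). The equation is tested
against `dipole a e t`, a function harmonic near the cone with two poles that approach the apex from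
outside as `t → 0`. It satisfies `|dipole| ≤ C t / (‖x‖ + t)ⁿ⁺¹` on the cone, and the scaling `x ↦ t
x` preserves its integral there. After a cutoff, its Laplacian on the cone is uniformly `O(t)`, so
the `W` side tends to zero, whereas the `F` side tends to `c` times the integral of the dipole over
the whole cone. That integral is negative (`IsSolidCone.integral_dipole_neg`): integration along the
axis turns it into minus the integral of a Poisson kernel over annuli, which is bounded away from
zero by homogeneity. Neither convexity of the domain nor a vanishing rate of `W` at the apex is
used.

Two analytic tools are proved on the way. Continuity of weak solutions for `n ≤ 3` comes from the
Fourier side: a compactly supported cutoff of the solution has two derivatives in `L²`, hence an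
integrable Fourier transform. Unique continuation comes from lifting to `ℝ⁴`: `w(x) exp(μ z₄)` with
`μ² = λ` is harmonic there, and the Newton kernel of `ℝ⁴` is the reciprocal of a polynomial, so
harmonic functions continue holomorphically along segments. -/

/-- The Laplacian as the sum of the second partial derivatives. -/
noncomputable def lap {n : ℕ} (φ : E n → ℂ) (x : E n) : ℂ := ∑ i, pderiv i (pderiv i φ) x

/-! ### Coordinate calculus for the Laplacian -/

section Calculus

variable {n : ℕ} {f g : E n → ℂ} {x : E n} {i : Fin n}

theorem pderiv_congr (h : f =ᶠ[nhds x] g) : pderiv i f =ᶠ[nhds x] pderiv i g := by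
  filter_upwards [h.fderiv (𝕜 := ℝ)] with y hy
  simp only [pderiv, hy]

theorem lap_congr (h : f =ᶠ[nhds x] g) : lap f =ᶠ[nhds x] lap g := by
  have : ∀ᶠ y in nhds x, ∀ i : Fin n, pderiv i (pderiv i f) y = pderiv i (pderiv i g) y :=
    Filter.eventually_all.2 fun i => pderiv_congr (pderiv_congr h)
  filter_upwards [this] with y hy
  simp only [lap, hy]

theorem pderiv_add (hf : DifferentiableAt ℝ f x) (hg : DifferentiableAt ℝ g x) :
    pderiv i (fun y => f y + g y) x = pderiv i f x + pderiv i g x := by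
  simp only [pderiv]
  rw [fderiv_fun_add hf hg]; rfl

theorem pderiv_sub (hf : DifferentiableAt ℝ f x) (hg : DifferentiableAt ℝ g x) :
    pderiv i (fun y => f y - g y) x = pderiv i f x - pderiv i g x := by
  simp only [pderiv]
  rw [fderiv_fun_sub hf hg]; rfl

theorem pderiv_mul (hf : DifferentiableAt ℝ f x) (hg : DifferentiableAt ℝ g x) :
    pderiv i (fun y => f y * g y) x = pderiv i f x * g x + f x * pderiv i g x := by
  simp only [pderiv]
  rw [fderiv_fun_mul hf hg]
  simp only [add_apply, smul_apply, smul_eq_mul]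
  ring

theorem pderiv_comp_sub_const (a : E n) :
    pderiv i (fun y => f (y - a)) x = pderiv i f (x - a) := by
  simp only [pderiv]
  rw [fderiv_comp_sub]

theorem lap_comp_sub_const (a : E n) : lap (fun y => f (y - a)) x = lap f (x - a) := by
  simp only [lap]
  refine Finset.sum_congr rfl fun i _ => ?_
  have : pderiv i (fun y => f (y - a)) = fun y => pderiv i f (y - a) :=
    funext fun y => pderiv_comp_sub_const a
  rw [this, pderiv_comp_sub_const]

theorem contDiffAt_pderiv {k m : WithTop ℕ∞} (hf : ContDiffAt ℝ k f x) (hm : m + 1 ≤ k) :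
    ContDiffAt ℝ m (pderiv i f) x :=
  (hf.fderiv_right hm).clm_apply contDiffAt_const

theorem contDiff_pderiv (hf : ContDiff ℝ ∞ f) : ContDiff ℝ ∞ (pderiv i f) :=
  (hf.fderiv_right (by simp)).clm_apply contDiff_const

theorem contDiff_lap (hf : ContDiff ℝ ∞ f) : ContDiff ℝ ∞ (lap f) := by
  unfold lap
  exact ContDiff.sum fun i _ => contDiff_pderiv (contDiff_pderiv hf)

theorem eventually_differentiableAt (hf : ContDiffAt ℝ 2 f x) :
    ∀ᶠ y in nhds x, DifferentiableAt ℝ f y := by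
  filter_upwards [hf.eventually (by simp)] with y hy using hy.differentiableAt (by simp)

theorem differentiableAt_pderiv (hf : ContDiffAt ℝ 2 f x) : DifferentiableAt ℝ (pderiv i f) x :=
  (contDiffAt_pderiv (m := 1) hf (by norm_num)).differentiableAt (by simp)

theorem lap_mul (hf : ContDiffAt ℝ 2 f x) (hg : ContDiffAt ℝ 2 g x) :
    lap (fun y => f y * g y) x =
      lap f x * g x + 2 * ∑ i, pderiv i f x * pderiv i g x + f x * lap g x := by
  have hf1 := hf.differentiableAt (by simp)
  have hg1 := hg.differentiableAt (by simp)
  simp only [lap, Finset.sum_mul, Finset.mul_sum, ← Finset.sum_add_distrib]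
  refine Finset.sum_congr rfl fun i _ => ?_
  have h1 : pderiv i (fun y => f y * g y) =ᶠ[nhds x]
      fun y => pderiv i f y * g y + f y * pderiv i g y := by
    filter_upwards [eventually_differentiableAt hf, eventually_differentiableAt hg] with y h1 h2
      using pderiv_mul h1 h2
  have h2 := (pderiv_congr (i := i) h1).eq_of_nhds
  rw [h2, pderiv_add (f := fun y => pderiv i f y * g y)
    (g := fun y => f y * pderiv i g y) ((differentiableAt_pderiv hf).mul hg1)
    (hf1.mul (differentiableAt_pderiv hg)),
    pderiv_mul (differentiableAt_pderiv hf) hg1, pderiv_mul hf1 (differentiableAt_pderiv hg)]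
  ring

theorem lap_sub (hf : ContDiffAt ℝ 2 f x) (hg : ContDiffAt ℝ 2 g x) :
    lap (fun y => f y - g y) x = lap f x - lap g x := by
  simp only [lap, ← Finset.sum_sub_distrib]
  refine Finset.sum_congr rfl fun i _ => ?_
  have h1 : pderiv i (fun y => f y - g y) =ᶠ[nhds x] fun y => pderiv i f y - pderiv i g y := by
    filter_upwards [eventually_differentiableAt hf, eventually_differentiableAt hg] with y h1 h2
      using pderiv_sub h1 h2
  rw [(pderiv_congr (i := i) h1).eq_of_nhds,
    pderiv_sub (differentiableAt_pderiv hf) (differentiableAt_pderiv hg)]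

theorem tsupport_pderiv_subset : tsupport (pderiv i f) ⊆ tsupport f :=
  tsupport_fderiv_apply_subset ℝ _

theorem tsupport_lap_subset : tsupport (lap f) ⊆ tsupport f := by
  refine closure_minimal (fun x hx => ?_) (isClosed_tsupport f)
  by_contra hxs
  have h0 : f =ᶠ[nhds x] fun _ => 0 := notMem_tsupport_iff_eventuallyEq.1 hxs
  apply hx
  rw [(lap_congr h0).eq_of_nhds]
  have h1 : ∀ i : Fin n, pderiv i (fun _ : E n => (0 : ℂ)) = fun _ => 0 := fun i => by
    ext y; simp [pderiv]
  simp [lap, h1]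

end Calculus

/-! ### Test functions and integration by parts -/

section TestFunctions

variable {n : ℕ} {Ω : Set (E n)} {φ : E n → ℂ}

theorem IsTestFun.pderiv (hφ : IsTestFun Ω φ) (i : Fin n) : IsTestFun Ω (pderiv i φ) where
  smooth := contDiff_pderiv hφ.smooth
  compact := hφ.compact.fderiv_apply ℝ _
  support := tsupport_pderiv_subset.trans hφ.support

theorem IsTestFun.lap (hφ : IsTestFun Ω φ) : IsTestFun Ω (lap φ) where
  smooth := contDiff_lap hφ.smooth
  compact := hφ.compact.of_isClosed_subset (isClosed_tsupport _) tsupport_lap_subset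
  support := tsupport_lap_subset.trans hφ.support

theorem IsTestFun.mul_left (hφ : IsTestFun Ω φ) {χ : E n → ℂ} (hχ : ContDiff ℝ ∞ χ) :
    IsTestFun Ω (fun x => χ x * φ x) where
  smooth := hχ.mul hφ.smooth
  compact := hφ.compact.mul_left
  support := (tsupport_mul_subset_right).trans hφ.support

theorem IsTestFun.mono {Ω' : Set (E n)} (hφ : IsTestFun Ω φ) (h : Ω ⊆ Ω') : IsTestFun Ω' φ :=
  ⟨hφ.smooth, hφ.compact, hφ.support.trans h⟩

theorem IsTestFun.zero_of_notMem (hφ : IsTestFun Ω φ) {x : E n} (hx : x ∉ Ω) : φ x = 0 :=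
  image_eq_zero_of_notMem_tsupport fun h => hx (hφ.support h)

theorem IsTestFun.comp_sub (hφ : IsTestFun Ω φ) (a : E n) :
    IsTestFun ((fun x => x - a) ⁻¹' Ω) (fun x => φ (x - a)) where
  smooth := hφ.smooth.comp (contDiff_id.sub contDiff_const)
  compact := hφ.compact.comp_homeomorph (Homeomorph.subRight a)
  support := by
    intro x hx
    apply hφ.support
    exact tsupport_comp_subset_preimage φ (f := fun x => x - a) (by fun_prop) hx

theorem setIntegral_mul_test (hφ : IsTestFun Ω φ) (f : E n → ℂ) :
    ∫ x in Ω, f x * φ x = ∫ x, f x * φ x :=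
  setIntegral_eq_integral_of_forall_compl_eq_zero fun x hx => by
    rw [hφ.zero_of_notMem hx, mul_zero]

theorem integral_pderiv_mul {f g : E n → ℂ} (hf : ContDiff ℝ ∞ f) (hg : ContDiff ℝ ∞ g)
    (hc : HasCompactSupport g) (i : Fin n) :
    ∫ x, f x * pderiv i g x = -∫ x, pderiv i f x * g x := by
  have hg' : HasCompactSupport (_root_.pderiv i g) := hc.fderiv_apply ℝ _
  have hd : ∀ {u : E n → ℂ}, ContDiff ℝ ∞ u → Differentiable ℝ u :=
    fun hu => hu.differentiable (by simp)
  refine integral_mul_fderiv_eq_neg_fderiv_mul_of_integrable ?_ ?_ ?_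
    (fun x _ => hd hf x) (fun x _ => hd hg x)
  · exact (((contDiff_pderiv hf).continuous).mul hg.continuous).integrable_of_hasCompactSupport
      hc.mul_left
  · exact (hf.continuous.mul (contDiff_pderiv hg).continuous).integrable_of_hasCompactSupport
      hg'.mul_left
  · exact (hf.continuous.mul hg.continuous).integrable_of_hasCompactSupport hc.mul_left

theorem integral_mul_lap {f g : E n → ℂ} (hf : ContDiff ℝ ∞ f) (hg : ContDiff ℝ ∞ g)
    (hc : HasCompactSupport g) : ∫ x, f x * lap g x = ∫ x, lap f x * g x := by
  have hgc : ∀ i : Fin n, HasCompactSupport (pderiv i g) := fun i => hc.fderiv_apply ℝ _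
  have hgc' : ∀ i : Fin n, HasCompactSupport (pderiv i (pderiv i g)) :=
    fun i => (hgc i).fderiv_apply ℝ _
  simp only [lap, Finset.mul_sum, Finset.sum_mul]
  rw [integral_finsetSum, integral_finsetSum]
  · refine Finset.sum_congr rfl fun i _ => ?_
    rw [integral_pderiv_mul hf (contDiff_pderiv hg) (hgc i),
      integral_pderiv_mul (contDiff_pderiv hf) hg hc, neg_neg]
  · intro i _
    exact ((contDiff_pderiv (contDiff_pderiv hf)).continuous.mul
      hg.continuous).integrable_of_hasCompactSupport hc.mul_left
  · intro i _
    exact (hf.continuous.mul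
      (contDiff_pderiv (contDiff_pderiv hg)).continuous).integrable_of_hasCompactSupport
      (hgc' i).mul_left

theorem HasWeakLaplacian.integral_mul_lap {U : H1 Ω} {w : E n → ℂ} (h : HasWeakLaplacian U w)
    (hφ : IsTestFun Ω φ) : ∫ x in Ω, sobFn U x * lap φ x = ∫ x in Ω, w x * φ x := by
  have h1 := h.2 φ hφ
  simp only [_root_.lap, Finset.mul_sum]
  rw [integral_finsetSum]
  · rw [integral_finsetSum] at h1
    · rw [← neg_neg (∫ x in Ω, w x * φ x), ← h1, ← Finset.sum_neg_distrib]
      exact Finset.sum_congr rfl fun i _ => U.2.2.2 i _ (hφ.pderiv i)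
    · exact fun i _ => (U.2.2.1 i).integrable_mul (hφ.memLp_pderiv i)
  · exact fun i _ => U.2.1.integrable_mul ((hφ.pderiv i).memLp_pderiv i)

end TestFunctions

/-- `ΔW = F` on `V` in the sense of distributions. -/
def HasDistribLaplacian {n : ℕ} (V : Set (E n)) (W F : E n → ℂ) : Prop :=
  ∀ φ, IsTestFun V φ → ∫ x, W x * lap φ x = ∫ x, F x * φ x

/-! ### Sobolev embedding by the Fourier transform -/

section ContinuousRepresentative

open TemperedDistribution FourierTransform Laplacian LineDeriv
open scoped SchwartzMap

theorem lap_schwartz {n : ℕ} (φ : 𝓢(E n, ℂ)) (x : E n) : (Δ φ) x = lap φ x := by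
  rw [SchwartzMap.laplacian_eq_sum (EuclideanSpace.basisFun (Fin n) ℝ)]
  simp only [sum_apply, lap]
  refine Finset.sum_congr rfl fun i _ => ?_
  have h : ∀ ψ : 𝓢(E n, ℂ),
      ⇑(∂_{EuclideanSpace.basisFun (Fin n) ℝ i} ψ : 𝓢(E n, ℂ)) = pderiv i ψ := by
    intro ψ
    ext y
    rw [SchwartzMap.lineDerivOp_apply_eq_fderiv]
    simp [pderiv]
  rw [h, h]

/-- If `ĝ` is (in the sense of tempered distributions) an integrable function, then `g` has a
continuous representative. -/
theorem exists_continuous_of_fourier_memL1 {n : ℕ} (g : Lp ℂ 2 (volume : Measure (E n)))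
    (v : Lp ℂ 1 (volume : Measure (E n))) (h : 𝓕 (g : 𝓢'(E n, ℂ)) = (v : 𝓢'(E n, ℂ))) :
    ∃ k : E n → ℂ, Continuous k ∧ k =ᵐ[volume] g := by
  have hv : Integrable v := L1.integrable_coeFn v
  -- The Fourier transform of the reflected function is the inverse transform of `v`, which is the
  -- candidate for the representative.
  have hv' : Integrable (fun x => v (-x)) := hv.comp_neg
  have hk : Continuous (𝓕 (fun x => v (-x))) :=
    VectorFourier.fourierIntegral_continuous Real.continuous_fourierChar
      (innerSL ℝ).continuous₂ hv'
  refine ⟨_, hk, ?_⟩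
  refine ae_eq_of_integral_contDiff_smul_eq hk.locallyIntegrable
    ((Lp.memLp g).locallyIntegrable (by norm_num)) fun ρ hρ hρc => ?_
  have hg₁ : HasCompactSupport (Complex.ofRealCLM ∘ ρ) := hρc.comp_left rfl
  have hg₂ : ContDiff ℝ ∞ (Complex.ofRealCLM ∘ ρ) := by fun_prop
  set φ : 𝓢(E n, ℂ) := hg₁.toSchwartzMap hg₂ with hφ
  have hφx : ∀ x, φ x = (ρ x : ℂ) := fun x => rfl
  have h1 : (g : 𝓢'(E n, ℂ)) φ = (v : 𝓢'(E n, ℂ)) (𝓕⁻ φ) := by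
    rw [← h, TemperedDistribution.fourier_apply, FourierTransform.fourier_fourierInv_eq]
  rw [Lp.toTemperedDistribution_apply, Lp.toTemperedDistribution_apply] at h1
  have h2 : ∫ x, (𝓕⁻ φ) x • v x = ∫ x, (𝓕 (φ : E n → ℂ)) x • v (-x) := by
    rw [← integral_neg_eq_self]
    refine integral_congr_ae (Filter.Eventually.of_forall fun x => ?_)
    simp only [SchwartzMap.fourierInv_coe]
    rw [Real.fourierInv_eq_fourier_neg, neg_neg]
  have h3 : ∫ x, (𝓕 (φ : E n → ℂ)) x • v (-x) = ∫ x, φ x • (𝓕 (fun x => v (-x))) x := by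
    have := VectorFourier.integral_fourierIntegral_smul_eq_flip (L := innerₗ (E n))
      (μ := volume) (ν := volume) Real.continuous_fourierChar (innerSL ℝ).continuous₂
      (φ.integrable) hv'
    rw [flip_innerₗ] at this
    exact this
  rw [h2, h3] at h1
  simp only [hφx] at h1
  simpa using h1.symm

/-- A function in `L²` with Laplacian in `L²` lies in `H²`, and two derivatives exceed `n / 2` when
`n ≤ 3`. The test functions need no compact support, because they are to be Schwartz functions; this
is harmless for the compactly supported `g` of the application. -/
theorem exists_continuous_of_laplacian_memLp {n : ℕ} (hn : n ≤ 3) {g h : E n → ℂ}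
    (hg : MemLp g 2) (hh : MemLp h 2)
    (H : ∀ φ : E n → ℂ, ContDiff ℝ ∞ φ → ∫ x, g x * lap φ x = ∫ x, h x * φ x) :
    ∃ k : E n → ℂ, Continuous k ∧ k =ᵐ[volume] g := by
  set G : Lp ℂ 2 (volume : Measure (E n)) := hg.toLp g
  set L : Lp ℂ 2 (volume : Measure (E n)) := hh.toLp h
  have hΔ : Δ (G : 𝓢'(E n, ℂ)) = (L : 𝓢'(E n, ℂ)) := by
    ext φ
    rw [TemperedDistribution.laplacian_apply_apply, Lp.toTemperedDistribution_apply,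
      Lp.toTemperedDistribution_apply]
    have e1 : ∫ x, (Δ φ) x • G x = ∫ x, g x * lap φ x := by
      refine integral_congr_ae ?_
      filter_upwards [hg.coeFn_toLp] with x hx
      rw [hx, lap_schwartz, smul_eq_mul, mul_comm]
    have e2 : ∫ x, φ x • L x = ∫ x, h x * φ x := by
      refine integral_congr_ae ?_
      filter_upwards [hh.coeFn_toLp] with x hx
      rw [hx, smul_eq_mul, mul_comm]
    rw [e1, e2, H φ (φ.smooth ⊤)]
  have hmem : MemSobolev 2 2 (G : 𝓢'(E n, ℂ)) := by
    -- With this normalization of the Fourier transform `Δ` has the symbol `-(2π)² ‖ξ‖²`, so `G - c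
    -- ΔG` has the symbol `1 + ‖ξ‖²` applied to `G`.
    set c : ℝ := (((2 * Real.pi) ^ 2)⁻¹ : ℝ) with hc
    refine ⟨G - c • L, ?_⟩
    rw [← besselPotential_neg_apply_eq_iff]
    have e : ((G - c • L : Lp ℂ 2 (volume : Measure (E n))) : 𝓢'(E n, ℂ)) =
        (G : 𝓢'(E n, ℂ)) - c • Δ (G : 𝓢'(E n, ℂ)) := by
      rw [hΔ]
      have := (Lp.toTemperedDistributionCLM ℂ (volume : Measure (E n)) 2).map_sub G (c • L)
      have h2 := (Lp.toTemperedDistributionCLM ℂ (volume : Measure (E n)) 2).map_smul_of_tower c L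
      rw [h2] at this
      exact this
    rw [e, map_sub, ContinuousLinearMap.map_smul_of_tower, besselPotential_neg_two_laplacian_eq,
      smul_smul]
    have hcc : c * -(2 * Real.pi) ^ 2 = -1 := by
      rw [hc]; field_simp
    rw [hcc, besselPotential]
    ext φ
    -- The symbol identity `1 / (1 + ‖ξ‖²) + ‖ξ‖² / (1 + ‖ξ‖²) = 1`.
    have key : ∀ ψ : 𝓢(E n, ℂ),
        SchwartzMap.smulLeftCLM ℂ (fun x : E n => (((1 + ‖x‖ ^ 2) ^ ((-2 : ℝ) / 2) : ℝ) : ℂ)) ψ +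
        SchwartzMap.smulLeftCLM ℂ
          (fun x : E n => Complex.ofReal (‖x‖ ^ 2 * (1 + ‖x‖ ^ 2) ^ (-1 : ℝ))) ψ = ψ := by
      intro ψ
      ext x
      rw [add_apply, SchwartzMap.smulLeftCLM_apply_apply (by fun_prop),
        SchwartzMap.smulLeftCLM_apply_apply (by fun_prop), ← add_smul, ← Complex.ofReal_add]
      have hp : (0 : ℝ) < 1 + ‖x‖ ^ 2 := by positivity
      have : (1 + ‖x‖ ^ 2 : ℝ) ^ ((-2 : ℝ) / 2) + ‖x‖ ^ 2 * (1 + ‖x‖ ^ 2) ^ (-1 : ℝ) = 1 := by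
        rw [show (-2 : ℝ) / 2 = -1 by norm_num, Real.rpow_neg_one]
        field_simp
      rw [this]; simp
    have := congrArg (fun ψ => (G : 𝓢'(E n, ℂ)) (𝓕 ψ)) (key (𝓕⁻ φ))
    simp only [FourierTransform.fourier_add, map_add,
      FourierTransform.fourier_fourierInv_eq] at this
    rw [← this]
    simp
  obtain ⟨v, hv⟩ := hmem.fourier_memL1 (by
    rw [finrank_euclideanSpace_fin]
    have : (n : ℝ) ≤ 3 := by exact_mod_cast hn
    linarith)
  obtain ⟨k, hk, hkg⟩ := exists_continuous_of_fourier_memL1 G v hv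
  exact ⟨k, hk, hkg.trans hg.coeFn_toLp⟩

end ContinuousRepresentative

/-! ### Cutoffs and continuity of weak solutions -/

theorem exists_cutoff {n : ℕ} (p : E n) {r R : ℝ} (hr : 0 < r) (hR : r < R) :
    ∃ η : E n → ℂ, IsTestFun (ball p R) η ∧ ∀ x ∈ closedBall p r, η x = 1 := by
  set b : ContDiffBump p := ⟨r, (r + R) / 2, hr, by linarith⟩ with hb
  refine ⟨fun x => (b x : ℂ), ⟨Complex.ofRealCLM.contDiff.comp b.contDiff,
    b.hasCompactSupport.comp_left Complex.ofReal_zero, ?_⟩, fun x hx => ?_⟩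
  · refine (closure_mono (Function.support_comp_subset Complex.ofReal_zero b)).trans ?_
    change tsupport b ⊆ _
    rw [b.tsupport_eq]
    exact closedBall_subset_ball (show (r + R) / 2 < R by linarith)
  · simp [b.one_of_mem_closedBall hx]

theorem IsTestFun.memLp_mul {n : ℕ} {Ω : Set (E n)} (hΩ : MeasurableSet Ω) {η f : E n → ℂ}
    (hη : IsTestFun Ω η) (hf : MemLp f 2 (volume.restrict Ω)) :
    MemLp (fun x => f x * η x) 2 volume := by
  have h0 : (fun x => f x * η x) = Ω.indicator (fun x => f x * η x) := by
    ext x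
    by_cases hx : x ∈ Ω
    · rw [indicator_of_mem hx]
    · rw [indicator_of_notMem hx, hη.zero_of_notMem hx, mul_zero]
  rw [h0, memLp_indicator_iff_restrict hΩ]
  obtain ⟨C, hC⟩ := hη.smooth.continuous.bounded_above_of_compact_support hη.compact
  refine MemLp.of_le_mul (c := C) hf (hf.1.mul hη.smooth.continuous.aestronglyMeasurable)
    (Filter.Eventually.of_forall fun x => ?_)
  rw [norm_mul, mul_comm]
  exact mul_le_mul_of_nonneg_right (hC x) (norm_nonneg _)

/-- This is `Δ(uη) = η Δu + 2 ∇u · ∇η + u Δη` in weak form. The right-hand side contains only first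
derivatives of `u`, so it is in `L²`, and the cutoff allows arbitrary smooth `φ`. -/
theorem HasWeakLaplacian.integral_cutoff_mul_lap {n : ℕ} {Ω : Set (E n)} {U : H1 Ω}
    {w η φ : E n → ℂ} (hU : HasWeakLaplacian U w) (hη : IsTestFun Ω η) (hφ : ContDiff ℝ ∞ φ) :
    ∫ x, sobFn U x * η x * lap φ x =
      ∫ x, (w x * η x + ∑ i, 2 * (sobGrad U i x * pderiv i η x) + sobFn U x * lap η x) * φ x := by
  have hd : ∀ {u : E n → ℂ}, ContDiff ℝ ∞ u → ∀ x, DifferentiableAt ℝ u x :=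
    fun hu => hu.differentiable (by simp)
  have h2 : ∀ {u : E n → ℂ}, ContDiff ℝ ∞ u → ∀ x, ContDiffAt ℝ 2 u x :=
    fun hu x => (hu.of_le (by norm_cast)).contDiffAt
  have hmul : ∀ {θ : E n → ℂ}, IsTestFun Ω θ → IsTestFun Ω (fun x => θ x * φ x) := by
    intro θ hθ
    simpa only [mul_comm] using hθ.mul_left hφ
  have hi : ∀ {f θ : E n → ℂ}, MemLp f 2 (volume.restrict Ω) → IsTestFun Ω θ →
      Integrable (fun x => f x * θ x) (volume.restrict Ω) :=
    fun hf hθ => hf.integrable_mul hθ.memLp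
  have e1 := hU.integral_mul_lap (hmul hη)
  have e2 : ∀ i, ∫ x in Ω, sobFn U x * pderiv i (fun y => pderiv i η y * φ y) x =
      -∫ x in Ω, sobGrad U i x * (pderiv i η x * φ x) :=
    fun i => U.2.2.2 i _ (hmul (hη.pderiv i))
  -- `η Δφ` is written in terms of `Δ(ηφ)`, `∂ᵢ(∂ᵢη φ)` and `Δη φ`, so that every derivative falls
  -- on a test function and can be moved to `u` by the weak formulation.
  have key : ∀ x, η x * lap φ x = lap (fun y => η y * φ y) x -
      ∑ i, 2 * pderiv i (fun y => pderiv i η y * φ y) x + lap η x * φ x := by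
    intro x
    have h3 : ∀ i, pderiv i (fun y => pderiv i η y * φ y) x =
        pderiv i (pderiv i η) x * φ x + pderiv i η x * pderiv i φ x :=
      fun i => pderiv_mul (hd (contDiff_pderiv hη.smooth) x) (hd hφ x)
    rw [lap_mul (h2 hη.smooth x) (h2 hφ x)]
    simp only [h3, mul_add, Finset.sum_add_distrib, ← Finset.mul_sum, ← Finset.sum_mul]
    rw [show ∑ i, pderiv i (pderiv i η) x = lap η x from rfl]
    ring
  have hUL : MemLp (sobFn U) 2 (volume.restrict Ω) := U.2.1
  have hGL : ∀ i, MemLp (sobGrad U i) 2 (volume.restrict Ω) := U.2.2.1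
  have lhs : ∫ x, sobFn U x * η x * lap φ x = ∫ x in Ω, (sobFn U x * lap (fun y => η y * φ y) x -
      ∑ i, 2 * (sobFn U x * pderiv i (fun y => pderiv i η y * φ y) x) +
      sobFn U x * (lap η x * φ x)) := by
    simp only [mul_assoc]
    rw [← setIntegral_mul_test (Ω := Ω) (φ := fun x => η x * lap φ x)
      (by simpa only [mul_comm] using hη.mul_left (contDiff_lap hφ))]
    congr 1
    ext x
    rw [key, mul_add, mul_sub, Finset.mul_sum]
    congr 2
    exact Finset.sum_congr rfl fun i _ => by ring
  have rhs : ∫ x, (w x * η x + ∑ i, 2 * (sobGrad U i x * pderiv i η x) +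
      sobFn U x * lap η x) * φ x = ∫ x in Ω, (w x * (η x * φ x) +
        ∑ i, 2 * (sobGrad U i x * (pderiv i η x * φ x)) + sobFn U x * (lap η x * φ x)) := by
    rw [← setIntegral_eq_integral_of_forall_compl_eq_zero (s := Ω)]
    · congr 1
      ext x
      rw [add_mul, add_mul, Finset.sum_mul, mul_assoc, mul_assoc]
      congr 2
      exact Finset.sum_congr rfl fun i _ => by ring
    · intro x hx
      simp [hη.zero_of_notMem hx, (hη.pderiv _).zero_of_notMem hx, hη.lap.zero_of_notMem hx]
  have i1 := hi hUL (hmul hη).lap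
  have i2 := fun i => (hi hUL ((hmul (hη.pderiv i)).pderiv i)).const_mul 2
  have i3 := hi hUL (hmul hη.lap)
  have i4 := hi hU.1 (hmul hη)
  have i5 := fun i => (hi (hGL i) (hmul (hη.pderiv i))).const_mul 2
  have j2 := integrable_finsetSum Finset.univ fun i _ => i2 i
  have j5 := integrable_finsetSum Finset.univ fun i _ => i5 i
  have j1 : Integrable (fun x => sobFn U x * lap (fun y => η y * φ y) x -
      ∑ i, 2 * (sobFn U x * pderiv i (fun y => pderiv i η y * φ y) x)) (volume.restrict Ω) :=
    i1.sub j2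
  have j4 : Integrable (fun x => w x * (η x * φ x) +
      ∑ i, 2 * (sobGrad U i x * (pderiv i η x * φ x))) (volume.restrict Ω) := i4.add j5
  rw [lhs, rhs, integral_add j1 i3, integral_sub i1 j2, integral_add j4 i3, integral_add i4 j5,
    integral_finsetSum _ fun i _ => i2 i, integral_finsetSum _ fun i _ => i5 i, e1]
  simp only [integral_const_mul, e2, mul_neg, Finset.sum_neg_distrib, sub_neg_eq_add]

theorem ae_of_locally {n : ℕ} {Ω : Set (E n)} {P : E n → Prop}
    (h : ∀ p ∈ Ω, ∃ r > 0, ∀ᵐ x ∂volume.restrict (ball p r), P x) : ∀ᵐ x, x ∈ Ω → P x := by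
  have h0 : volume {x | x ∈ Ω ∧ ¬P x} = 0 := by
    refine measure_null_of_locally_null _ fun p hp => ?_
    obtain ⟨r, hr, hP⟩ := h p hp.1
    rw [ae_restrict_iff' measurableSet_ball] at hP
    refine ⟨ball p r ∩ {x | x ∈ Ω ∧ ¬P x},
      Filter.inter_mem (mem_nhdsWithin_of_mem_nhds (ball_mem_nhds p hr)) self_mem_nhdsWithin,
      measure_mono_null (fun x hx => ?_) hP⟩
    exact fun h => hx.2.2 (h hx.1)
  refine measure_mono_null (fun x hx => ?_) h0
  simpa using hx

/-- Continuous functions that agree almost everywhere on an open set agree everywhere on it, so the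
local representatives match on overlaps and their diagonal `k x x` is continuous. -/
theorem exists_continuousOn_of_locally {n : ℕ} {Ω : Set (E n)} (hΩ : MeasurableSet Ω)
    {u : E n → ℂ}
    (h : ∀ p ∈ Ω, ∃ r > 0, ∃ k : E n → ℂ, Continuous k ∧ k =ᵐ[volume.restrict (ball p r)] u) :
    ∃ v : E n → ℂ, ContinuousOn v Ω ∧ v =ᵐ[volume.restrict Ω] u := by
  choose! r hr k hk hku using h
  have hloc : ∀ p ∈ Ω, ∀ x ∈ Ω, x ∈ ball p (r p) → k x x = k p x := by
    intro p hp x hx hxp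
    have hO : IsOpen (ball x (r x) ∩ ball p (r p)) := isOpen_ball.inter isOpen_ball
    have hae : k x =ᵐ[volume.restrict (ball x (r x) ∩ ball p (r p))] k p := by
      have h1 := ae_restrict_of_ae_restrict_of_subset
        (inter_subset_left (s := ball x (r x)) (t := ball p (r p))) (hku x hx)
      have h2 := ae_restrict_of_ae_restrict_of_subset
        (inter_subset_right (s := ball x (r x)) (t := ball p (r p))) (hku p hp)
      filter_upwards [h1, h2] with y hy1 hy2 using hy1.trans hy2.symm
    exact Measure.eqOn_open_of_ae_eq hae hO (hk x hx).continuousOn (hk p hp).continuousOn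
      ⟨mem_ball_self (hr x hx), hxp⟩
  refine ⟨fun x => k x x, fun p hp => ?_, ?_⟩
  · refine ((hk p hp).continuousWithinAt (s := Ω)).congr_of_eventuallyEq ?_ rfl
    filter_upwards [self_mem_nhdsWithin, mem_nhdsWithin_of_mem_nhds (ball_mem_nhds p (hr p hp))]
      with x hx hxp using hloc p hp x hx hxp
  · have h1 : ∀ᵐ x, x ∈ Ω → x ∈ Ω → k x x = u x := by
      refine ae_of_locally fun p hp => ⟨r p, hr p hp, ?_⟩
      filter_upwards [hku p hp, ae_restrict_mem measurableSet_ball] with x hx hxp hxΩ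
      exact (hloc p hp x hxΩ hxp).trans hx
    rw [Filter.EventuallyEq, ae_restrict_iff' hΩ]
    filter_upwards [h1] with x hx hxΩ using hx hxΩ hxΩ

theorem HasWeakLaplacian.exists_continuousOn {n : ℕ} (hn : n ≤ 3) {Ω : Set (E n)}
    (hΩ : IsOpen Ω) {U : H1 Ω} {w : E n → ℂ} (hU : HasWeakLaplacian U w) :
    ∃ v : E n → ℂ, ContinuousOn v Ω ∧ v =ᵐ[volume.restrict Ω] sobFn U := by
  refine exists_continuousOn_of_locally hΩ.measurableSet fun p hp => ?_
  obtain ⟨R, hR, hball⟩ := Metric.isOpen_iff.1 hΩ p hp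
  obtain ⟨η, hη, hη1⟩ := exists_cutoff p (half_pos hR) (half_lt_self hR)
  replace hη := hη.mono hball
  have hm := hΩ.measurableSet
  obtain ⟨k, hk, hkg⟩ := exists_continuous_of_laplacian_memLp hn (g := fun x => sobFn U x * η x)
    (h := fun x => w x * η x + ∑ i, 2 * (sobGrad U i x * pderiv i η x) + sobFn U x * lap η x)
    (hη.memLp_mul hm U.2.1)
    (((hη.memLp_mul hm hU.1).add (memLp_finsetSum _ fun i _ =>
      ((hη.pderiv i).memLp_mul hm (U.2.2.1 i)).const_mul 2)).add (hη.lap.memLp_mul hm U.2.1))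
    (fun φ hφ => hU.integral_cutoff_mul_lap hη hφ)
  refine ⟨R / 2, half_pos hR, k, hk, ?_⟩
  filter_upwards [ae_restrict_of_ae hkg, ae_restrict_mem measurableSet_ball] with x hx hxp
  rw [hx, hη1 x (ball_subset_closedBall hxp), mul_one]

/-! ### Derivatives of powers of `‖x‖² + c` -/

section RadialPowers

variable {n : ℕ}

theorem hasFDerivAt_normSq_rpow {c : ℝ} (p : ℝ) {x : E n} (hx : 0 < ‖x‖ ^ 2 + c) :
    HasFDerivAt (fun y : E n => (‖y‖ ^ 2 + c) ^ p)
      ((p * (‖x‖ ^ 2 + c) ^ (p - 1)) • (2 • (innerSL ℝ x))) x :=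
  ((hasStrictFDerivAt_norm_sq x).hasFDerivAt.add_const c).rpow_const (Or.inl hx.ne')

theorem hasFDerivAt_ofReal {f : E n → ℝ} {f' : E n →L[ℝ] ℝ} {x : E n} (hf : HasFDerivAt f f' x) :
    HasFDerivAt (fun y => (f y : ℂ)) (Complex.ofRealCLM.comp f') x :=
  Complex.ofRealCLM.hasFDerivAt.comp x hf

theorem pderiv_ofReal {f : E n → ℝ} {f' : E n →L[ℝ] ℝ} {x : E n} (hf : HasFDerivAt f f' x)
    (i : Fin n) : pderiv i (fun y => (f y : ℂ)) x = (f' (EuclideanSpace.single i 1) : ℝ) := by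
  rw [pderiv, (hasFDerivAt_ofReal hf).fderiv]
  simp

theorem pderiv_normSq_rpow {c : ℝ} (p : ℝ) {x : E n} (hx : 0 < ‖x‖ ^ 2 + c) (i : Fin n) :
    pderiv i (fun y : E n => (((‖y‖ ^ 2 + c) ^ p : ℝ) : ℂ)) x =
      ((2 * p * x i * (‖x‖ ^ 2 + c) ^ (p - 1) : ℝ) : ℂ) := by
  rw [pderiv_ofReal (hasFDerivAt_normSq_rpow p hx)]
  congr 1
  simp [EuclideanSpace.inner_single_right]
  ring

theorem contDiffAt_normSq_rpow {c : ℝ} (p : ℝ) {x : E n} (hx : 0 < ‖x‖ ^ 2 + c) {k : WithTop ℕ∞} :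
    ContDiffAt ℝ k (fun y : E n => (((‖y‖ ^ 2 + c) ^ p : ℝ) : ℂ)) x := by
  have h : ContDiffAt ℝ k (fun y : E n => (‖y‖ ^ 2 + c) ^ p) x :=
    (((contDiff_norm_sq ℝ).contDiffAt).add contDiffAt_const).rpow_const_of_ne hx.ne'
  exact Complex.ofRealCLM.contDiff.contDiffAt.comp x h

theorem pderiv_inner (a x : E n) (i : Fin n) :
    pderiv i (fun y => ((inner ℝ a y : ℝ) : ℂ)) x = (a i : ℂ) := by
  rw [pderiv_ofReal (f := fun y => inner ℝ a y) (f' := innerSL ℝ a) (innerSL ℝ a).hasFDerivAt]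
  simp [EuclideanSpace.inner_single_right]

theorem contDiff_inner_ofReal (a : E n) {k : WithTop ℕ∞} :
    ContDiff ℝ k (fun y => ((inner ℝ a y : ℝ) : ℂ)) :=
  Complex.ofRealCLM.contDiff.comp (innerSL ℝ a).contDiff

theorem lap_inner (a x : E n) : lap (fun y => ((inner ℝ a y : ℝ) : ℂ)) x = 0 := by
  have h : ∀ i : Fin n, pderiv i (fun y => ((inner ℝ a y : ℝ) : ℂ)) = fun _ => (a i : ℂ) :=
    fun i => funext fun y => pderiv_inner a y i
  simp only [lap, h]
  simp [pderiv]

/-- The shift `c` serves two purposes: `c > 0` for the regularized Newton kernel, and `c = 0` away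
from the origin for the Poisson kernel. -/
theorem lap_normSq_rpow {c : ℝ} (p : ℝ) {x : E n} (hx : 0 < ‖x‖ ^ 2 + c) :
    lap (fun y : E n => (((‖y‖ ^ 2 + c) ^ p : ℝ) : ℂ)) x =
      ((2 * p * n * (‖x‖ ^ 2 + c) ^ (p - 1) +
        4 * p * (p - 1) * ‖x‖ ^ 2 * (‖x‖ ^ 2 + c) ^ (p - 2) : ℝ) : ℂ) := by
  have hev : ∀ᶠ y in nhds x, 0 < ‖y‖ ^ 2 + c :=
    (by fun_prop : Continuous fun y : E n => ‖y‖ ^ 2 + c).continuousAt.eventually (lt_mem_nhds hx)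
  have h1 : ∀ i, pderiv i (pderiv i (fun y : E n => (((‖y‖ ^ 2 + c) ^ p : ℝ) : ℂ))) x =
      ((2 * p * (‖x‖ ^ 2 + c) ^ (p - 1) +
        4 * p * (p - 1) * (x i) ^ 2 * (‖x‖ ^ 2 + c) ^ (p - 2) : ℝ) : ℂ) := by
    intro i
    have h2 : pderiv i (fun y : E n => (((‖y‖ ^ 2 + c) ^ p : ℝ) : ℂ)) =ᶠ[nhds x]
        fun y => ((2 * p : ℝ) : ℂ) * ((inner ℝ (EuclideanSpace.single i (1 : ℝ)) y : ℝ) : ℂ) *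
          (((‖y‖ ^ 2 + c) ^ (p - 1) : ℝ) : ℂ) := by
      filter_upwards [hev] with y hy
      rw [pderiv_normSq_rpow p hy]
      simp [EuclideanSpace.inner_single_left]
    have hdi : DifferentiableAt ℝ
        (fun y : E n => ((inner ℝ (EuclideanSpace.single i (1 : ℝ)) y : ℝ) : ℂ)) x :=
      ((contDiff_inner_ofReal (k := 1) _).differentiable (by simp)) x
    have hc : DifferentiableAt ℝ (fun _ : E n => ((2 * p : ℝ) : ℂ)) x := differentiableAt_const _
    have hc0 : pderiv i (fun _ : E n => ((2 * p : ℝ) : ℂ)) x = 0 := by simp [pderiv]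
    rw [(pderiv_congr (i := i) h2).eq_of_nhds, pderiv_mul (f := fun y : E n => ((2 * p : ℝ) : ℂ) *
      ((inner ℝ (EuclideanSpace.single i (1 : ℝ)) y : ℝ) : ℂ)) (hc.mul hdi)
      ((contDiffAt_normSq_rpow (k := 1) _ hx).differentiableAt (by simp)),
      pderiv_mul hc hdi, hc0, pderiv_inner, pderiv_normSq_rpow (p - 1) hx,
      show p - 1 - 1 = p - 2 by ring]
    simp [EuclideanSpace.inner_single_left]
    ring
  simp only [lap, h1]
  rw [← Complex.ofReal_sum, Finset.sum_add_distrib]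
  have e : ∑ i, 4 * p * (p - 1) * (x i) ^ 2 * (‖x‖ ^ 2 + c) ^ (p - 2) =
      4 * p * (p - 1) * ‖x‖ ^ 2 * (‖x‖ ^ 2 + c) ^ (p - 2) := by
    rw [← Finset.sum_mul, ← Finset.mul_sum, ← EuclideanSpace.real_norm_sq_eq]
  rw [e]
  simp
  ring

end RadialPowers

/-! ### Newton potential in dimension four -/

section NewtonPotential

open Filter Topology

/-- The regularized Newton kernel of `ℝ⁴`. -/
noncomputable def newtonKernel (c : ℝ) (z : E 4) : ℂ := (((‖z‖ ^ 2 + c) ^ (-1 : ℝ) : ℝ) : ℂ)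

theorem lap_newtonKernel {c : ℝ} (hc : 0 < c) (z : E 4) :
    lap (newtonKernel c) z = ((-8 * c * ((‖z‖ ^ 2 + c) ^ 3)⁻¹ : ℝ) : ℂ) := by
  have hz : 0 < ‖z‖ ^ 2 + c := by positivity
  have := lap_normSq_rpow (-1) hz
  rw [show newtonKernel c = fun y : E 4 => (((‖y‖ ^ 2 + c) ^ (-1 : ℝ) : ℝ) : ℂ) from rfl, this]
  congr 1
  rw [show (-1 - 1 : ℝ) = ((-2 : ℤ) : ℝ) by norm_num,
    show (-1 - 2 : ℝ) = ((-3 : ℤ) : ℝ) by norm_num,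
    Real.rpow_intCast, Real.rpow_intCast]
  simp only [zpow_neg]
  norm_cast
  push_cast
  field_simp
  ring

theorem integrable_newtonMass : Integrable (fun z : E 4 => ((‖z‖ ^ 2 + 1) ^ 3)⁻¹) := by
  have h := integrable_rpow_neg_one_add_norm_sq (E := E 4) (μ := volume) (r := 6)
    (by rw [finrank_euclideanSpace_fin]; norm_num)
  refine h.congr (Eventually.of_forall fun z => ?_)
  have hz : 0 < 1 + ‖z‖ ^ 2 := by positivity
  simp only
  rw [show (-6 / 2 : ℝ) = ((-3 : ℤ) : ℝ) by norm_num, Real.rpow_intCast, zpow_neg, add_comm]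
  norm_cast

noncomputable def newtonMass : ℝ := ∫ z : E 4, 8 * ((‖z‖ ^ 2 + 1) ^ 3)⁻¹

theorem newtonMass_pos : 0 < newtonMass := by
  refine (integral_pos_iff_support_of_nonneg (fun z => by positivity)
    (integrable_newtonMass.const_mul 8)).2 ?_
  have : Function.support (fun z : E 4 => 8 * ((‖z‖ ^ 2 + 1) ^ 3)⁻¹) = univ := by
    ext z
    have : ‖z‖ ^ 2 + 1 ≠ 0 := by positivity
    simp [this]
  rw [this]
  simp

/-- Green's representation formula away from the support of the Laplacian. -/
theorem integral_lap_mul_newtonKernel {g : E 4 → ℂ} (hg : ContDiff ℝ ∞ g)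
    (hc : HasCompactSupport g) {x : E 4} {δ : ℝ} (hδ : 0 < δ) (hx : ∀ y ∈ ball x δ, lap g y = 0) :
    ∫ y, lap g y * ((‖y - x‖ ^ 2 : ℝ) : ℂ)⁻¹ = -(newtonMass : ℂ) * g x := by
  have hlc : HasCompactSupport (lap g) :=
    hc.of_isClosed_subset (isClosed_tsupport _) tsupport_lap_subset
  have hker : ∀ {c : ℝ}, 0 < c → ContDiff ℝ ∞ (fun y => newtonKernel c (y - x)) := by
    intro c hc
    have : ContDiff ℝ ∞ (newtonKernel c) := contDiff_iff_contDiffAt.2 fun z =>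
      contDiffAt_normSq_rpow _ (by positivity)
    exact this.comp (contDiff_id.sub contDiff_const)
  -- Green's identity moves the Laplacian to the kernel, and `y = x + ε z` rescales the resulting
  -- approximate identity to a fixed profile: the volume factor `ε⁴` cancels the scaling of `ε² /
  -- (‖y‖² + ε²)³`.
  have e1 : ∀ ε : ℝ, 0 < ε → ∫ y, lap g y * newtonKernel (ε ^ 2) (y - x) =
      ∫ z : E 4, -(g (x + ε • z) * ((8 * ((‖z‖ ^ 2 + 1) ^ 3)⁻¹ : ℝ) : ℂ)) := by
    intro ε hε
    have h1 : ∫ y, lap g y * newtonKernel (ε ^ 2) (y - x) =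
        ∫ y, lap (newtonKernel (ε ^ 2)) (y - x) * g y := by
      rw [← funext fun y => mul_comm (newtonKernel (ε ^ 2) (y - x)) (lap g y),
        integral_mul_lap (hker (by positivity)) hg hc]
      simp only [lap_comp_sub_const]
    have h2 : ∫ y, lap (newtonKernel (ε ^ 2)) (y - x) * g y =
        ∫ y, lap (newtonKernel (ε ^ 2)) y * g (x + y) := by
      rw [← integral_sub_right_eq_self (fun y => lap (newtonKernel (ε ^ 2)) y * g (x + y)) x]
      simp
    have h3 := Measure.integral_comp_smul_of_nonneg (volume : Measure (E 4))
      (fun y => lap (newtonKernel (ε ^ 2)) y * g (x + y)) ε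
      (hR := hε.le)
    rw [finrank_euclideanSpace_fin] at h3
    rw [h1, h2]
    have h4 : ∫ y, lap (newtonKernel (ε ^ 2)) y * g (x + y) =
        (ε ^ 4 : ℝ) • ∫ z, lap (newtonKernel (ε ^ 2)) (ε • z) * g (x + ε • z) := by
      rw [h3, smul_smul, mul_inv_cancel₀ (by positivity), one_smul]
    rw [h4, ← integral_smul]
    congr 1
    ext z
    rw [lap_newtonKernel (by positivity), norm_smul, Real.norm_of_nonneg hε.le, Complex.real_smul,
      ← mul_assoc, mul_comm (g _), ← neg_mul, ← Complex.ofReal_mul, ← Complex.ofReal_neg]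
    congr 2
    field_simp
  obtain ⟨C, hC⟩ := hg.continuous.bounded_above_of_compact_support hc
  have hε : Tendsto (fun k : ℕ => (1 / ((k : ℝ) + 1))) atTop (𝓝 0) :=
    tendsto_one_div_add_atTop_nhds_zero_nat
  have hε0 : ∀ k : ℕ, 0 < 1 / ((k : ℝ) + 1) := fun k => by positivity
  have l1 : Tendsto (fun k : ℕ => ∫ z : E 4, -(g (x + (1 / ((k : ℝ) + 1)) • z) *
      ((8 * ((‖z‖ ^ 2 + 1) ^ 3)⁻¹ : ℝ) : ℂ))) atTop
      (𝓝 (∫ z : E 4, -(g x * ((8 * ((‖z‖ ^ 2 + 1) ^ 3)⁻¹ : ℝ) : ℂ)))) := by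
    refine tendsto_integral_of_dominated_convergence
      (fun z => C * (8 * ((‖z‖ ^ 2 + 1) ^ 3)⁻¹)) (fun k => ?_)
      ((integrable_newtonMass.const_mul 8).const_mul C) (fun k => ?_) ?_
    · refine Continuous.aestronglyMeasurable ?_
      have hp : ∀ z : E 4, (‖z‖ ^ 2 + 1) ^ 3 ≠ 0 := fun z => by positivity
      have := hg.continuous
      fun_prop (disch := exact hp _)
    · refine Eventually.of_forall fun z => ?_
      rw [norm_neg, norm_mul, Complex.norm_real, Real.norm_of_nonneg (by positivity)]
      exact mul_le_mul_of_nonneg_right (hC _) (by positivity)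
    · refine Eventually.of_forall fun z => ?_
      refine ((Tendsto.mul_const _ ?_)).neg
      have : Tendsto (fun k : ℕ => x + (1 / ((k : ℝ) + 1)) • z) atTop (𝓝 (x + (0 : ℝ) • z)) :=
        (hε.smul_const z).const_add x
      rw [zero_smul, add_zero] at this
      exact (hg.continuous.tendsto x).comp this
  -- The kernel is singular only at `x`, and `lap g` vanishes on the ball of radius `δ` there, so
  -- `δ⁻²` bounds all regularized kernels where they matter.
  have l2 : Tendsto (fun k : ℕ => ∫ y, lap g y * newtonKernel ((1 / ((k : ℝ) + 1)) ^ 2) (y - x))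
      atTop (𝓝 (∫ y, lap g y * ((‖y - x‖ ^ 2 : ℝ) : ℂ)⁻¹)) := by
    refine tendsto_integral_of_dominated_convergence (fun y => ‖lap g y‖ * (δ ^ 2)⁻¹)
      (fun k => ?_) ?_ (fun k => ?_) ?_
    · exact ((contDiff_lap hg).continuous.mul
        (hker (by have := hε0 k; positivity)).continuous).aestronglyMeasurable
    · exact (((contDiff_lap hg).continuous.norm).integrable_of_hasCompactSupport
        hlc.norm).mul_const _
    · refine Eventually.of_forall fun y => ?_
      by_cases hy : y ∈ ball x δ
      · simp [hx y hy]
      · rw [mem_ball, not_lt, dist_eq_norm] at hy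
        have h0 := hε0 k
        rw [norm_mul, newtonKernel, Complex.norm_real, Real.rpow_neg_one,
          Real.norm_of_nonneg (by positivity)]
        gcongr
        nlinarith [sq_nonneg (1 / ((k : ℝ) + 1))]
    · refine Eventually.of_forall fun y => ?_
      by_cases hy : y ∈ ball x δ
      · simp [hx y hy]
      · rw [mem_ball, not_lt, dist_eq_norm] at hy
        have hpos : 0 < ‖y - x‖ := hδ.trans_le hy
        refine Tendsto.const_mul _ ?_
        simp only [newtonKernel, Real.rpow_neg_one, ← Complex.ofReal_inv]
        refine (Complex.continuous_ofReal.tendsto _).comp ?_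
        have : Tendsto (fun k : ℕ => ‖y - x‖ ^ 2 + (1 / ((k : ℝ) + 1)) ^ 2) atTop
            (𝓝 (‖y - x‖ ^ 2 + 0 ^ 2)) := (hε.pow 2).const_add _
        rw [zero_pow two_ne_zero, add_zero] at this
        exact this.inv₀ (by positivity)
  simp only [fun k : ℕ => e1 _ (hε0 k)] at l2
  rw [tendsto_nhds_unique l2 l1, integral_neg, integral_const_mul, newtonMass]
  have h5 : ∫ z : E 4, ((8 * ((‖z‖ ^ 2 + 1) ^ 3)⁻¹ : ℝ) : ℂ) =
      ((∫ z : E 4, 8 * ((‖z‖ ^ 2 + 1) ^ 3)⁻¹ : ℝ) : ℂ) := integral_ofReal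
  rw [h5]
  ring

end NewtonPotential

/-! ### Unique continuation for harmonic functions in dimension four -/

section HarmonicContinuation

open Filter Topology

/-- The polynomial extension to complex `s` of `‖y - (Q + s d)‖²`. -/
noncomputable def complexDistSq (Q d : E 4) (s : ℂ) (y : E 4) : ℂ :=
  ((‖y - Q‖ ^ 2 : ℝ) : ℂ) - 2 * s * ((inner ℝ (y - Q) d : ℝ) : ℂ) + s ^ 2 * ((‖d‖ ^ 2 : ℝ) : ℂ)

theorem complexDistSq_ofReal (Q d y : E 4) (t : ℝ) :
    complexDistSq Q d t y = ((‖y - (Q + t • d)‖ ^ 2 : ℝ) : ℂ) := by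
  have : ‖y - (Q + t • d)‖ ^ 2 = ‖y - Q‖ ^ 2 - 2 * t * inner ℝ (y - Q) d + t ^ 2 * ‖d‖ ^ 2 := by
    rw [← sub_sub, norm_sub_sq_real, inner_smul_right, norm_smul, mul_pow, Real.norm_eq_abs, sq_abs]
    ring
  rw [this, complexDistSq]
  push_cast
  ring

theorem re_complexDistSq (Q d y : E 4) (s : ℂ) :
    (complexDistSq Q d s y).re = ‖y - (Q + s.re • d)‖ ^ 2 - s.im ^ 2 * ‖d‖ ^ 2 := by
  have : ‖y - (Q + s.re • d)‖ ^ 2 =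
      ‖y - Q‖ ^ 2 - 2 * s.re * inner ℝ (y - Q) d + s.re ^ 2 * ‖d‖ ^ 2 := by
    rw [← sub_sub, norm_sub_sq_real, inner_smul_right, norm_smul, mul_pow, Real.norm_eq_abs, sq_abs]
    ring
  rw [this, complexDistSq]
  simp only [Complex.add_re, Complex.sub_re, Complex.mul_re, Complex.ofReal_re, Complex.ofReal_im,
    pow_two, Complex.mul_im, Complex.re_ofNat, Complex.im_ofNat]
  ring

theorem hasDerivAt_complexDistSq (Q d y : E 4) (s : ℂ) :
    HasDerivAt (fun s => complexDistSq Q d s y)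
      (-2 * ((inner ℝ (y - Q) d : ℝ) : ℂ) + 2 * s * ((‖d‖ ^ 2 : ℝ) : ℂ)) s := by
  have h1 := (((hasDerivAt_id s).const_mul 2).mul_const ((inner ℝ (y - Q) d : ℝ) : ℂ)).const_sub
    ((‖y - Q‖ ^ 2 : ℝ) : ℂ)
  have h2 := ((hasDerivAt_id s).pow 2).mul_const ((‖d‖ ^ 2 : ℝ) : ℂ)
  refine (h1.add h2).congr_deriv ?_
  simp

/-- The set of complex parameters used to continue harmonic functions along segments. -/
def segmentNhd : Set ℂ := Complex.re ⁻¹' Ioo (-1) (5 / 4) ∩ Complex.im ⁻¹' Ioo (-(1 / 8)) (1 / 8)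

theorem isOpen_segmentNhd : IsOpen segmentNhd :=
  (isOpen_Ioo.preimage Complex.continuous_re).inter (isOpen_Ioo.preimage Complex.continuous_im)

theorem isPreconnected_segmentNhd : IsPreconnected segmentNhd :=
  (((convex_Ioo (-1 : ℝ) (5 / 4)).linear_preimage Complex.reLm).inter
    ((convex_Ioo (-(1 / 8) : ℝ) (1 / 8)).linear_preimage Complex.imLm)).isPreconnected

theorem norm_lineMap_sub_lt {P Q X : E 4} {r t : ℝ} (hQ : Q ∈ ball P (r / 8))
    (hX : X ∈ ball P (r / 8)) (ht : |t| ≤ 5 / 4) : ‖Q + t • (X - Q) - P‖ ≤ 7 / 16 * r := by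
  rw [mem_ball, dist_eq_norm] at hQ hX
  have hd : ‖X - Q‖ ≤ r / 4 := by
    calc ‖X - Q‖ = ‖(X - P) - (Q - P)‖ := by congr 1; abel
      _ ≤ ‖X - P‖ + ‖Q - P‖ := norm_sub_le _ _
      _ ≤ r / 4 := by linarith
  calc ‖Q + t • (X - Q) - P‖ = ‖(Q - P) + t • (X - Q)‖ := by congr 1; abel
    _ ≤ ‖Q - P‖ + |t| * ‖X - Q‖ := (norm_add_le _ _).trans_eq (by rw [norm_smul, Real.norm_eq_abs])
    _ ≤ r / 8 + 5 / 4 * (r / 4) := by gcongr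
    _ = 7 / 16 * r := by ring

/-- The segment, extended to the real parts allowed in `segmentNhd`, stays within `7r/16` of `P`,
hence at distance at least `r/16` from `y`. The imaginary part costs at most `(1/8)² (r/4)² =
(r/32)²`, and `(r/16)² - (r/32)² > r²/512`. -/
theorem norm_complexDistSq_ge {P Q X y : E 4} {r : ℝ} {s : ℂ} (hr : 0 < r)
    (hQ : Q ∈ ball P (r / 8)) (hX : X ∈ ball P (r / 8)) (hs : s ∈ segmentNhd)
    (hy : y ∉ ball P (r / 2)) : r ^ 2 / 512 ≤ ‖complexDistSq Q (X - Q) s y‖ := by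
  refine le_trans ?_ (Complex.re_le_norm _)
  rw [re_complexDistSq]
  obtain ⟨⟨h1, h2⟩, h3, h4⟩ := hs
  have h5 := norm_lineMap_sub_lt hQ hX (t := s.re) (abs_le.2 ⟨by linarith, h2.le⟩)
  rw [mem_ball, not_lt, dist_eq_norm] at hy
  rw [mem_ball, dist_eq_norm] at hQ hX
  have hd : ‖X - Q‖ ≤ r / 4 := by
    calc ‖X - Q‖ = ‖(X - P) - (Q - P)‖ := by congr 1; abel
      _ ≤ ‖X - P‖ + ‖Q - P‖ := norm_sub_le _ _
      _ ≤ r / 4 := by linarith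
  have h6 : r / 16 ≤ ‖y - (Q + s.re • (X - Q))‖ := by
    have : ‖y - P‖ ≤ ‖y - (Q + s.re • (X - Q))‖ + ‖Q + s.re • (X - Q) - P‖ := by
      refine (le_of_eq ?_).trans (norm_add_le _ _)
      congr 1; abel
    linarith
  have h7 : (r / 16) ^ 2 ≤ ‖y - (Q + s.re • (X - Q))‖ ^ 2 := by gcongr
  have h8 : s.im ^ 2 * ‖X - Q‖ ^ 2 ≤ (1 / 8) ^ 2 * (r / 4) ^ 2 := by
    gcongr ?_ * ?_ ^ 2
    rw [← sq_abs]
    gcongr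
    exact abs_le.2 ⟨h3.le, h4.le⟩
  nlinarith

/-- Unique continuation for harmonic functions on balls of `ℝ⁴`. -/
theorem harmonic_eq_zero {v : E 4 → ℂ} (hv : ContDiff ℝ ∞ v) {P Q X : E 4} {r : ℝ} (hr : 0 < r)
    (hlap : ∀ y ∈ ball P r, lap v y = 0) (hQ : Q ∈ ball P (r / 8)) (hX : X ∈ ball P (r / 8))
    (hv0 : v =ᶠ[𝓝 Q] 0) : v X = 0 := by
  obtain ⟨η, hη, hη1⟩ := exists_cutoff P (half_pos hr) (half_lt_self hr)
  -- The cutoff makes `v` a Newton potential on the small ball; the density `lap g` lives only where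
  -- `r/2 ≤ ‖y - P‖ < r`, away from the segment.
  set g : E 4 → ℂ := fun y => v y * η y with hg
  have hgt : IsTestFun (ball P r) g := hη.mul_left hv
  have hgv : ∀ y ∈ ball P (r / 2), g =ᶠ[𝓝 y] v := by
    intro y hy
    filter_upwards [isOpen_ball.mem_nhds hy] with z hz
    simp [hg, hη1 z (ball_subset_closedBall hz)]
  set h := lap g with hh
  have hht : IsTestFun (ball P r) h := hgt.lap
  have hh0 : ∀ y ∈ ball P (r / 2), h y = 0 := fun y hy => by
    rw [hh, (lap_congr (hgv y hy)).eq_of_nhds, hlap y (ball_subset_ball (by linarith) hy)]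
  set d := X - Q with hd
  -- Up to a constant, the potential along the line through `Q` and `X`, with the parameter made
  -- complex. In dimension four no root is needed: the integrand is rational in `s` and its poles
  -- are off `segmentNhd`.
  set Φ : ℂ → ℂ := fun s => ∫ y, h y * (complexDistSq Q d s y)⁻¹ with hΦ
  have hreal : ∀ t : ℝ, |t| ≤ 5 / 4 → Φ t = -(newtonMass : ℂ) * v (Q + t • d) := by
    intro t ht
    have hmem := norm_lineMap_sub_lt hQ hX ht
    rw [← hd] at hmem
    have hball : ball (Q + t • d) (r / 16) ⊆ ball P (r / 2) := by
      intro y hy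
      rw [mem_ball, dist_eq_norm] at hy ⊢
      calc ‖y - P‖ = ‖(y - (Q + t • d)) + (Q + t • d - P)‖ := by congr 1; abel
        _ ≤ _ := norm_add_le _ _
        _ < r / 2 := by linarith
    have := integral_lap_mul_newtonKernel hgt.smooth hgt.compact (x := Q + t • d)
      (δ := r / 16) (by positivity) (fun y hy => hh0 y (hball hy))
    simp only [hΦ, complexDistSq_ofReal]
    rw [this, (hgv _ (hball (mem_ball_self (by positivity)))).eq_of_nhds]
  have hcont : ∀ s, Continuous fun y => complexDistSq Q d s y := fun s => by
    unfold complexDistSq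
    fun_prop
  have hdiff : DifferentiableOn ℂ Φ segmentNhd := by
    intro s₀ hs₀
    -- Bounds the `s`-derivative of `complexDistSq`, using `‖y - Q‖ ≤ 2r` on the support of `h` and
    -- `‖s‖ ≤ 2` on `segmentNhd`.
    set M : ℝ := 2 * (2 * r * ‖d‖) + 2 * 2 * ‖d‖ ^ 2 with hM
    have key := hasDerivAt_integral_of_dominated_loc_of_deriv_le (μ := (volume : Measure (E 4)))
      (F := fun s y => h y * (complexDistSq Q d s y)⁻¹)
      (F' := fun s y => h y * (-(-2 * ((inner ℝ (y - Q) d : ℝ) : ℂ) + 2 * s * ((‖d‖ ^ 2 : ℝ) : ℂ)) /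
        complexDistSq Q d s y ^ 2))
      (x₀ := s₀) (s := segmentNhd) (bound := fun y => ‖h y‖ * (M / (r ^ 2 / 512) ^ 2))
      (isOpen_segmentNhd.mem_nhds hs₀) ?_ ?_ ?_ ?_ ?_ ?_
    · exact key.2.differentiableAt.differentiableWithinAt
    · exact Eventually.of_forall fun s =>
        (hht.smooth.continuous.measurable.mul (hcont s).measurable.inv).aestronglyMeasurable
    · refine Integrable.mono' (g := fun y => ‖h y‖ * (r ^ 2 / 512)⁻¹) ?_
        (hht.smooth.continuous.measurable.mul (hcont s₀).measurable.inv).aestronglyMeasurable ?_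
      · exact (hht.smooth.continuous.norm.integrable_of_hasCompactSupport
          hht.compact.norm).mul_const _
      · refine Eventually.of_forall fun y => ?_
        by_cases hy : y ∈ ball P (r / 2)
        · simp [hh0 y hy]
        · rw [norm_mul, norm_inv]
          gcongr
          exact norm_complexDistSq_ge hr hQ hX hs₀ hy
    · refine (Measurable.mul hht.smooth.continuous.measurable
        (Measurable.div ?_ ((hcont s₀).measurable.pow_const 2))).aestronglyMeasurable
      exact Continuous.measurable (by fun_prop)
    · refine Eventually.of_forall fun y s hs => ?_
      by_cases hy : y ∈ ball P (r / 2)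
      · simp [hh0 y hy]
      by_cases hy' : y ∈ ball P r
      · have h1 := norm_complexDistSq_ge hr hQ hX hs hy
        rw [← hd] at h1
        have h2 : ‖y - Q‖ ≤ 2 * r := by
          rw [mem_ball, dist_eq_norm] at hy' hQ
          calc ‖y - Q‖ = ‖(y - P) - (Q - P)‖ := by congr 1; abel
            _ ≤ ‖y - P‖ + ‖Q - P‖ := norm_sub_le _ _
            _ ≤ 2 * r := by linarith
        have h3 : ‖s‖ ≤ 2 := by
          refine (Complex.norm_le_abs_re_add_abs_im s).trans ?_
          have e1 : |s.re| ≤ 5 / 4 := abs_le.2 ⟨by linarith [hs.1.1], hs.1.2.le⟩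
          have e2 : |s.im| ≤ 1 / 8 := abs_le.2 ⟨hs.2.1.le, hs.2.2.le⟩
          linarith
        have h4 : ‖-2 * ((inner ℝ (y - Q) d : ℝ) : ℂ) + 2 * s * ((‖d‖ ^ 2 : ℝ) : ℂ)‖ ≤ M := by
          refine (norm_add_le _ _).trans ?_
          rw [norm_mul, norm_mul, norm_mul, Complex.norm_real, Complex.norm_real, norm_neg,
            Complex.norm_ofNat, Real.norm_eq_abs, Real.norm_of_nonneg (by positivity : 0 ≤ ‖d‖ ^ 2)]
          have h5 : |inner ℝ (y - Q) d| ≤ 2 * r * ‖d‖ :=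
            (abs_real_inner_le_norm _ _).trans (by gcongr)
          rw [hM]
          gcongr
        rw [norm_mul, norm_div, norm_neg, norm_pow]
        gcongr
      · simp [hht.zero_of_notMem hy']
    · exact (hht.smooth.continuous.norm.integrable_of_hasCompactSupport
        hht.compact.norm).mul_const _
    · refine Eventually.of_forall fun y s hs => ?_
      by_cases hy : y ∈ ball P (r / 2)
      · simp only [hh0 y hy, zero_mul]
        exact hasDerivAt_const _ _
      · refine ((hasDerivAt_complexDistSq Q d y s).inv fun h0 => ?_).const_mul (h y)
        have := norm_complexDistSq_ge hr hQ hX hs hy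
        rw [← hd, h0, norm_zero] at this
        have : 0 < r ^ 2 / 512 := by positivity
        linarith
  -- Identity theorem: `v` vanishes near `Q`, so `Φ` vanishes at all small real parameters. The
  -- value at `s = 1` then gives `v X = 0`.
  have hΦ0 : EqOn Φ 0 segmentNhd := by
    refine (hdiff.analyticOnNhd isOpen_segmentNhd).eqOn_zero_of_preconnected_of_frequently_eq_zero
      isPreconnected_segmentNhd (z₀ := 0) ⟨by simp, by simp⟩ ?_
    have ht : Tendsto (fun t : ℝ => (t : ℂ)) (𝓝[≠] 0) (𝓝[≠] 0) := by
      refine tendsto_nhdsWithin_iff.2 ⟨?_, ?_⟩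
      · exact (Complex.continuous_ofReal.tendsto' 0 0 (by simp)).mono_left nhdsWithin_le_nhds
      · filter_upwards [self_mem_nhdsWithin] with t ht
        simpa using ht
    refine ht.frequently (Eventually.frequently ?_)
    have hc : Tendsto (fun t : ℝ => Q + t • d) (𝓝 0) (𝓝 Q) :=
      (by fun_prop : Continuous fun t : ℝ => Q + t • d).tendsto' _ _ (by simp)
    have h1 : ∀ᶠ t : ℝ in 𝓝 0, v (Q + t • d) = 0 := hc.eventually hv0
    have h2 : ∀ᶠ t : ℝ in 𝓝 0, |t| ≤ 5 / 4 := by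
      filter_upwards [Metric.closedBall_mem_nhds (0 : ℝ) (by norm_num : (0 : ℝ) < 5 / 4)] with t ht
      simpa using ht
    refine Eventually.filter_mono nhdsWithin_le_nhds ?_
    filter_upwards [h1, h2] with t h1 h2
    rw [hreal t h2, h1, mul_zero]
  have h1 := hreal 1 (by norm_num)
  have h2 : Φ ((1 : ℝ) : ℂ) = 0 := hΦ0 (by constructor <;> norm_num)
  rw [h2, one_smul, hd, add_sub_cancel] at h1
  have h3 : (newtonMass : ℂ) ≠ 0 := by exact_mod_cast newtonMass_pos.ne'
  rcases mul_eq_zero.1 h1.symm with h | h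
  · exact absurd h (neg_ne_zero.2 h3)
  · exact h

end HarmonicContinuation

/-! ### Unique continuation for the Helmholtz equation -/

section HelmholtzContinuation

open Filter Topology

variable {n : ℕ}

/-- The projection of `ℝ⁴` to its first `n ≤ 3` coordinates. -/
noncomputable def projFirst (hn : n ≤ 3) : E 4 →L[ℝ] E n :=
  LinearMap.toContinuousLinearMap
    { toFun := fun z => WithLp.toLp 2 fun i => z (Fin.castLE (by omega) i)
      map_add' := fun x y => by ext i; simp
      map_smul' := fun c x => by ext i; simp }

/-- The inclusion of `ℝⁿ`, `n ≤ 3`, into `ℝ⁴`. -/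
noncomputable def inclFirst (x : E n) : E 4 :=
  WithLp.toLp 2 fun j => if h : (j : ℕ) < n then x ⟨j, h⟩ else 0

theorem projFirst_apply (hn : n ≤ 3) (z : E 4) (i : Fin n) :
    projFirst hn z i = z (Fin.castLE (by omega) i) := rfl

theorem inclFirst_apply (x : E n) (j : Fin 4) :
    inclFirst x j = if h : (j : ℕ) < n then x ⟨j, h⟩ else 0 := rfl

theorem projFirst_inclFirst (hn : n ≤ 3) (x : E n) : projFirst hn (inclFirst x) = x := by
  ext i
  rw [projFirst_apply, inclFirst_apply]
  simp

theorem norm_projFirst_le (hn : n ≤ 3) (z : E 4) : ‖projFirst hn z‖ ≤ ‖z‖ := by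
  rw [← sq_le_sq₀ (norm_nonneg _) (norm_nonneg _), EuclideanSpace.real_norm_sq_eq,
    EuclideanSpace.real_norm_sq_eq]
  have h := Finset.sum_map Finset.univ (Fin.castLEEmb (by omega : n ≤ 4)) (fun j => z j ^ 2)
  refine (le_of_eq h.symm).trans ?_
  exact Finset.sum_le_sum_of_subset_of_nonneg (Finset.subset_univ _) fun _ _ _ => sq_nonneg _

theorem norm_inclFirst_sub (hn : n ≤ 3) (x y : E n) : ‖inclFirst x - inclFirst y‖ = ‖x - y‖ := by
  rw [← sq_eq_sq₀ (norm_nonneg _) (norm_nonneg _), EuclideanSpace.real_norm_sq_eq,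
    EuclideanSpace.real_norm_sq_eq]
  simp only [PiLp.sub_apply, inclFirst_apply]
  interval_cases n <;> simp [Fin.sum_univ_succ]

theorem projFirst_single (hn : n ≤ 3) (j : Fin 4) : projFirst hn (EuclideanSpace.single j 1) =
    if h : (j : ℕ) < n then EuclideanSpace.single ⟨j, h⟩ 1 else 0 := by
  ext i
  rw [projFirst_apply]
  by_cases h : (j : ℕ) < n
  · simp [h, Fin.ext_iff]
  · have : (Fin.castLE (by omega : n ≤ 4) i) ≠ j := by
      intro h'
      apply h
      rw [← h']
      exact i.2
    simp [h, this]

theorem pderiv_comp_projFirst (hn : n ≤ 3) {w : E n → ℂ} (hw : ContDiff ℝ ∞ w) (j : Fin 4) :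
    pderiv j (fun z => w (projFirst hn z)) =
      fun z => if h : (j : ℕ) < n then pderiv ⟨j, h⟩ w (projFirst hn z) else 0 := by
  ext z
  have h1 : HasFDerivAt (fun z => w (projFirst hn z))
      ((fderiv ℝ w (projFirst hn z)).comp (projFirst hn)) z :=
    ((hw.differentiable (by simp)) _).hasFDerivAt.comp z (projFirst hn).hasFDerivAt
  rw [pderiv, h1.fderiv, ContinuousLinearMap.comp_apply, projFirst_single]
  by_cases h : (j : ℕ) < n
  · simp [h, pderiv]
  · simp [h]

theorem lap_comp_projFirst (hn : n ≤ 3) {w : E n → ℂ} (hw : ContDiff ℝ ∞ w) (z : E 4) :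
    lap (fun z => w (projFirst hn z)) z = lap w (projFirst hn z) := by
  have h : ∀ j : Fin 4, pderiv j (pderiv j (fun z => w (projFirst hn z))) z =
      if h : (j : ℕ) < n then pderiv ⟨j, h⟩ (pderiv ⟨j, h⟩ w) (projFirst hn z) else 0 := by
    intro j
    rw [pderiv_comp_projFirst hn hw]
    by_cases h : (j : ℕ) < n
    · simp only [h, dite_true]
      rw [pderiv_comp_projFirst hn (contDiff_pderiv hw)]
      simp [h]
    · simp [h, pderiv]
  simp only [lap, h]
  interval_cases n <;> simp [Fin.sum_univ_succ]

theorem contDiff_expLast (μ : ℂ) : ContDiff ℝ ∞ (fun z : E 4 => Complex.exp (μ * (z 3 : ℂ))) := by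
  have : ContDiff ℝ ∞ (fun z : E 4 => ((z 3 : ℝ) : ℂ)) :=
    Complex.ofRealCLM.contDiff.comp (EuclideanSpace.proj (𝕜 := ℝ) (3 : Fin 4)).contDiff
  exact (contDiff_const.mul this).cexp

theorem pderiv_expLast (μ : ℂ) (j : Fin 4) :
    pderiv j (fun z : E 4 => Complex.exp (μ * (z 3 : ℂ))) =
      fun z => (if j = 3 then μ else 0) * Complex.exp (μ * (z 3 : ℂ)) := by
  ext z
  have h1 : HasFDerivAt (fun z : E 4 => ((z 3 : ℝ) : ℂ))
      (Complex.ofRealCLM.comp (EuclideanSpace.proj (𝕜 := ℝ) (3 : Fin 4))) z :=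
    Complex.ofRealCLM.hasFDerivAt.comp z (EuclideanSpace.proj (𝕜 := ℝ) (3 : Fin 4)).hasFDerivAt
  have h2 := (h1.const_mul μ).cexp
  rw [pderiv, h2.fderiv]
  by_cases h : j = 3
  · subst h; simp; ring
  · simp [h, Ne.symm h]

theorem lap_expLast (μ : ℂ) (z : E 4) :
    lap (fun z : E 4 => Complex.exp (μ * (z 3 : ℂ))) z = μ ^ 2 * Complex.exp (μ * (z 3 : ℂ)) := by
  have h : ∀ j : Fin 4, pderiv j (pderiv j (fun z : E 4 => Complex.exp (μ * (z 3 : ℂ)))) z =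
      if j = 3 then μ ^ 2 * Complex.exp (μ * (z 3 : ℂ)) else 0 := by
    intro j
    rw [pderiv_expLast]
    rw [pderiv_mul (f := fun _ => if j = 3 then μ else 0) (differentiableAt_const _)
      ((contDiff_expLast μ).differentiable (by simp) z), pderiv_expLast]
    by_cases h : j = 3
    · simp [h, pderiv]; ring
    · simp [h, pderiv]
  simp only [lap, h]
  simp

/-- With `μ² = λ`, the function `w(x) exp(μ z₃)` on `ℝ⁴` has the Laplacian `(Δw + λw) exp(μ z₃)`, so
it is harmonic over the ball and `harmonic_eq_zero` applies. A complex `λ` makes no difference, and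
`n ≤ 3` leaves the last coordinate, of index `3`, free. -/
theorem helmholtz_eq_zero (hn : n ≤ 3) (lam : ℂ) {w : E n → ℂ} (hw : ContDiff ℝ ∞ w)
    {p q x : E n} {r : ℝ} (hr : 0 < r) (hlap : ∀ y ∈ ball p r, lap w y + lam * w y = 0)
    (hq : q ∈ ball p (r / 8)) (hx : x ∈ ball p (r / 8)) (hw0 : w =ᶠ[𝓝 q] 0) : w x = 0 := by
  obtain ⟨μ, hμ⟩ := IsAlgClosed.exists_pow_nat_eq lam two_pos
  set e : E 4 → ℂ := fun z => Complex.exp (μ * (z 3 : ℂ)) with he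
  have hwp : ContDiff ℝ ∞ (fun z => w (projFirst hn z)) := hw.comp (projFirst hn).contDiff
  have hball : ∀ {y : E n} {s : ℝ}, y ∈ ball p s → inclFirst y ∈ ball (inclFirst p) s := by
    intro y s hy
    rwa [mem_ball, dist_eq_norm, norm_inclFirst_sub hn, ← dist_eq_norm]
  have h2 : ∀ {m : ℕ} {u : E m → ℂ}, ContDiff ℝ ∞ u → ∀ x, ContDiffAt ℝ 2 u x :=
    fun hu x => (hu.of_le (by norm_cast)).contDiffAt
  have hv : w (projFirst hn (inclFirst x)) * e (inclFirst x) = 0 := by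
    refine harmonic_eq_zero (v := fun z => w (projFirst hn z) * e z) (hwp.mul (contDiff_expLast μ))
      hr (fun z hz => ?_) (hball hq) (hball hx) ?_
    · rw [lap_mul (h2 hwp z) (h2 (contDiff_expLast μ) z), lap_comp_projFirst hn hw, lap_expLast,
        hμ]
      have hz' : projFirst hn z ∈ ball p r := by
        rw [mem_ball, dist_eq_norm] at hz ⊢
        calc ‖projFirst hn z - p‖ = ‖projFirst hn (z - inclFirst p)‖ := by
              rw [map_sub, projFirst_inclFirst]
          _ ≤ ‖z - inclFirst p‖ := norm_projFirst_le hn _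
          _ < r := hz
      -- The two factors depend on disjoint sets of coordinates.
      have hcross : ∑ j, pderiv j (fun z => w (projFirst hn z)) z * pderiv j e z = 0 := by
        refine Finset.sum_eq_zero fun j _ => ?_
        rw [pderiv_comp_projFirst hn hw, he, pderiv_expLast]
        by_cases h : j = 3
        · subst h
          have : ¬ 3 < n := by omega
          simp [this]
        · simp [h]
      have := hlap _ hz'
      rw [hcross]
      linear_combination e z * this
    · have hc : Tendsto (projFirst hn) (𝓝 (inclFirst q)) (𝓝 q) :=
        (projFirst hn).continuous.tendsto' _ _ (projFirst_inclFirst hn q)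
      filter_upwards [hc.eventually hw0] with z hz
      rw [hz]
      simp
  rw [projFirst_inclFirst] at hv
  exact (mul_eq_zero.1 hv).resolve_right (Complex.exp_ne_zero _)

/-- The convolution of `W` with the kernel `φ`. -/
noncomputable def mollify (W φ : E n → ℂ) (x : E n) : ℂ := ∫ t, W t * φ (x - t)

theorem mollify_eq_convolution (W φ : E n → ℂ) :
    mollify W φ = convolution W φ (ContinuousLinearMap.mul ℝ ℂ) volume := rfl

theorem contDiff_mollify {W φ : E n → ℂ} (hW : LocallyIntegrable W) (hφ : ContDiff ℝ ∞ φ)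
    (hc : HasCompactSupport φ) : ContDiff ℝ ∞ (mollify W φ) :=
  hc.contDiff_convolution_right (ContinuousLinearMap.mul ℝ ℂ) hW hφ

theorem pderiv_mollify {W φ : E n → ℂ} (hW : LocallyIntegrable W) (hφ : ContDiff ℝ ∞ φ)
    (hc : HasCompactSupport φ) (i : Fin n) : pderiv i (mollify W φ) = mollify W (pderiv i φ) := by
  ext x
  have h := hc.hasFDerivAt_convolution_right (ContinuousLinearMap.mul ℝ ℂ) hW
    (hφ.of_le (by simp) : ContDiff ℝ 1 φ) x
  rw [pderiv, mollify_eq_convolution, h.fderiv,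
    convolution_precompR_apply _ hW (hc.fderiv ℝ) (hφ.continuous_fderiv (by simp))]
  rfl

theorem lap_mollify {W φ : E n → ℂ} (hW : LocallyIntegrable W) (hφ : ContDiff ℝ ∞ φ)
    (hc : HasCompactSupport φ) (x : E n) : lap (mollify W φ) x = ∫ t, W t * lap φ (x - t) := by
  have h : ∀ i : Fin n, pderiv i (pderiv i (mollify W φ)) x =
      ∫ t, W t * pderiv i (pderiv i φ) (x - t) := fun i => by
    rw [pderiv_mollify hW hφ hc, pderiv_mollify hW (contDiff_pderiv hφ) (hc.fderiv_apply ℝ _)]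
    rfl
  simp only [lap, h, Finset.mul_sum]
  rw [integral_finsetSum]
  intro i _
  have hc2 : HasCompactSupport (pderiv i (pderiv i φ)) :=
    HasCompactSupport.fderiv_apply ℝ (hc.fderiv_apply ℝ _) _
  exact hc2.convolutionExists_right (ContinuousLinearMap.mul ℝ ℂ) hW
    (contDiff_pderiv (contDiff_pderiv hφ)).continuous x

theorem lap_comp_const_sub {φ : E n → ℂ} (hφ : ContDiff ℝ ∞ φ) (a x : E n) :
    lap (fun y => φ (a - y)) x = lap φ (a - x) := by
  have h : ∀ {ψ : E n → ℂ}, ContDiff ℝ ∞ ψ → ∀ i : Fin n,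
      pderiv i (fun y => ψ (a - y)) = fun y => -pderiv i ψ (a - y) := by
    intro ψ hψ i
    ext y
    have h1 : HasFDerivAt (fun y => ψ (a - y))
        ((fderiv ℝ ψ (a - y)).comp (-ContinuousLinearMap.id ℝ (E n))) y :=
      ((hψ.differentiable (by simp)) _).hasFDerivAt.comp y ((hasFDerivAt_id y).const_sub a)
    rw [pderiv, h1.fderiv]
    simp [pderiv]
  simp only [lap]
  refine Finset.sum_congr rfl fun i _ => ?_
  rw [h hφ]
  have h2 : pderiv i (fun y => -pderiv i φ (a - y)) x =
      -pderiv i (fun y => pderiv i φ (a - y)) x := by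
    simp only [pderiv]
    rw [fderiv_fun_neg]
    rfl
  rw [h2, h (contDiff_pderiv hφ), neg_neg]

/-- Mollification commutes with constant coefficients, so the mollified functions are smooth
solutions on a slightly smaller ball and vanish near `q`. They vanish on the ball of radius `r/16`
and converge to `W` almost everywhere. -/
theorem helmholtz_unique_continuation_ball (hn : n ≤ 3) (lam : ℂ) {W : E n → ℂ}
    (hW : LocallyIntegrable W) {p q : E n} {r ε : ℝ} (hr : 0 < r) (hε : 0 < ε)
    (hlap : HasDistribLaplacian (ball p r) W (fun x => -lam * W x)) (hq : q ∈ ball p (r / 16))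
    (h0 : ∀ᵐ x ∂volume.restrict (ball q ε), W x = 0) :
    ∀ᵐ x ∂volume.restrict (ball p (r / 16)), W x = 0 := by
  set δ : ℕ → ℝ := fun k => 1 / ((k : ℝ) + 1) with hδ
  have hδ0 : ∀ k, 0 < δ k := fun k => by positivity
  have hδt : Tendsto δ atTop (𝓝 0) := tendsto_one_div_add_atTop_nhds_zero_nat
  set b : ℕ → ContDiffBump (0 : E n) := fun k =>
    ⟨δ k / 2, δ k, half_pos (hδ0 k), half_lt_self (hδ0 k)⟩ with hb
  have hlim := ContDiffBump.ae_convolution_tendsto_right_of_locallyIntegrable (φ := b) (l := atTop)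
    (K := 2) hδt (Eventually.of_forall fun k => by
      change δ k ≤ 2 * (δ k / 2); linarith) hW
  set φ : ℕ → E n → ℂ := fun k x => (((b k).normed volume x : ℝ) : ℂ) with hφ
  have hφs : ∀ k, ContDiff ℝ ∞ (φ k) := fun k =>
    Complex.ofRealCLM.contDiff.comp (b k).contDiff_normed
  have hφsupp : ∀ k, Function.support (φ k) ⊆ ball 0 (δ k) := fun k =>
    (Function.support_comp_subset Complex.ofReal_zero _).trans
      ((b k).support_normed_eq (μ := volume)).subset
  have hφt : ∀ k, tsupport (φ k) ⊆ closedBall 0 (δ k) := fun k =>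
    closure_minimal ((hφsupp k).trans ball_subset_closedBall) isClosed_closedBall
  have hφc : ∀ k, HasCompactSupport (φ k) := fun k =>
    (isCompact_closedBall 0 (δ k)).of_isClosed_subset (isClosed_tsupport _) (hφt k)
  have hconv : ∀ k x, convolution ((b k).normed volume) W (ContinuousLinearMap.lsmul ℝ ℝ) volume x =
      mollify W (φ k) x := by
    intro k x
    rw [convolution_lsmul_swap, mollify]
    congr 1
    ext t
    rw [Complex.real_smul, mul_comm]
  simp only [hconv] at hlim
  have htest : ∀ k x, δ k < r / 2 → x ∈ ball p (r / 2) →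
      IsTestFun (ball p r) (fun t => φ k (x - t)) := by
    intro k x hk hx
    refine ⟨(hφs k).comp (contDiff_const.sub contDiff_id),
      (hφc k).comp_homeomorph (Homeomorph.subLeft x), fun t ht => ?_⟩
    have h1 : x - t ∈ tsupport (φ k) :=
      tsupport_comp_subset_preimage (φ k) (f := fun t => x - t) (by fun_prop) ht
    have h2 := hφt k h1
    rw [mem_closedBall, dist_zero_right] at h2
    rw [mem_ball, dist_eq_norm] at hx ⊢
    calc ‖t - p‖ = ‖(x - p) - (x - t)‖ := by congr 1; abel
      _ ≤ ‖x - p‖ + ‖x - t‖ := norm_sub_le _ _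
      _ < r := by linarith
  have hzero : ∀ᶠ k in atTop, ∀ x ∈ ball p (r / 16), mollify W (φ k) x = 0 := by
    filter_upwards [hδt.eventually (gt_mem_nhds (half_pos hr)),
      hδt.eventually (gt_mem_nhds (half_pos hε))] with k hk1 hk2 x hx
    -- The mollified equation holds on the ball of radius `r/2`, and `(r/2)/8 = r/16`. Near `q` the
    -- mollified function is zero on the ball of radius `ε/2`, as the kernel has radius less than
    -- `ε/2`.
    refine helmholtz_eq_zero hn lam (contDiff_mollify hW (hφs k) (hφc k)) (p := p) (q := q)
      (half_pos hr) (fun y hy => ?_) (by convert hq using 2; ring) (by convert hx using 2; ring) ?_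
    · have h1 := hlap _ (htest k y hk1 hy)
      simp only [lap_comp_const_sub (hφs k)] at h1
      rw [lap_mollify hW (hφs k) (hφc k), h1, mollify, ← integral_const_mul,
        ← integral_add]
      · simp [mul_assoc]
      · have := ((hφc k).convolutionExists_right (ContinuousLinearMap.mul ℝ ℂ) hW
          (hφs k).continuous y).const_mul (-lam)
        simpa [mul_assoc] using this
      · exact ((hφc k).convolutionExists_right (ContinuousLinearMap.mul ℝ ℂ) hW
          (hφs k).continuous y).const_mul lam
    · filter_upwards [ball_mem_nhds q (half_pos hε)] with y hy
      rw [mollify, Pi.zero_apply]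
      rw [ae_restrict_iff' measurableSet_ball] at h0
      refine integral_eq_zero_of_ae ?_
      filter_upwards [h0] with t ht
      by_cases htq : t ∈ ball q ε
      · simp [ht htq]
      · have : φ k (y - t) = 0 := by
          by_contra hne
          have h3 := hφsupp k hne
          rw [mem_ball, dist_zero_right] at h3
          apply htq
          rw [mem_ball, dist_eq_norm] at hy ⊢
          calc ‖t - q‖ = ‖(y - q) - (y - t)‖ := by congr 1; abel
            _ ≤ ‖y - q‖ + ‖y - t‖ := norm_sub_le _ _
            _ < ε := by linarith
        simp [this]
  filter_upwards [ae_restrict_of_ae hlim, ae_restrict_mem measurableSet_ball] with x hx hxb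
  refine tendsto_nhds_unique hx (tendsto_const_nhds.congr' ?_)
  filter_upwards [hzero] with k hk using (hk x hxb).symm

/-- Unique continuation for the Helmholtz equation with a complex coefficient. -/
theorem helmholtz_unique_continuation (hn : n ≤ 3) (lam : ℂ) {V S : Set (E n)} (hV : IsOpen V)
    {W : E n → ℂ} (hW : LocallyIntegrable W)
    (hlap : HasDistribLaplacian V W (fun x => -lam * W x)) (hS : IsPreconnected S) (hSV : S ⊆ V)
    {x₀ : E n} (hx₀ : x₀ ∈ S)
    (h0 : ∃ r > 0, ∀ᵐ x ∂volume.restrict (ball x₀ r), W x = 0) :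
    ∀ x ∈ S, ∃ r > 0, ∀ᵐ y ∂volume.restrict (ball x r), W y = 0 := by
  set Z : Set (E n) := {x | ∃ r > 0, ∀ᵐ y ∂volume.restrict (ball x r), W y = 0} with hZ
  have hZo : IsOpen Z := by
    refine Metric.isOpen_iff.2 fun x hx => ?_
    obtain ⟨r, hr, hx⟩ := hx
    refine ⟨r, hr, fun y hy => ⟨r - dist y x, by rwa [mem_ball, ← sub_pos] at hy, ?_⟩⟩
    exact ae_restrict_of_ae_restrict_of_subset (ball_subset_ball' (by linarith)) hx
  -- The radius in the ball version does not depend on the point `q`: a point of `Z` anywhere in the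
  -- ball of radius `r/16` about `x` would already put `x` into `Z`.
  have hVo : IsOpen (V \ Z) := by
    refine Metric.isOpen_iff.2 fun x hx => ?_
    obtain ⟨r, hr, hball⟩ := Metric.isOpen_iff.1 hV x hx.1
    refine ⟨r / 16, by positivity, fun y hy => ⟨hball (ball_subset_ball (by linarith) hy), ?_⟩⟩
    rintro ⟨ε, hε, hyZ⟩
    exact hx.2 ⟨r / 16, by positivity, helmholtz_unique_continuation_ball hn lam hW hr hε
      (fun φ hφ => hlap φ (hφ.mono hball)) hy hyZ⟩
  refine hS.subset_left_of_subset_union hZo hVo disjoint_sdiff_right (fun x hx => ?_)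
    ⟨x₀, hx₀, h0⟩
  by_cases h : x ∈ Z
  · exact Or.inl h
  · exact Or.inr ⟨hSV hx, h⟩

end HelmholtzContinuation

/-! ### The Poisson kernel of a half space and homogeneity -/

section HalfSpaceKernel

open Filter Topology

variable {n : ℕ}

/-- The Poisson kernel of the half space `⟪a, x⟫ > 0` up to a constant factor. -/
noncomputable def halfSpaceKernel (a x : E n) : ℝ := inner ℝ a x * (‖x‖ ^ 2) ^ (-(n : ℝ) / 2)

/-- The derivative of the Poisson kernel in the direction `e`. -/
noncomputable def halfSpaceKernelDeriv (a e x : E n) : ℝ := fderiv ℝ (halfSpaceKernel a) x e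

theorem contDiffAt_halfSpaceKernel (a : E n) {x : E n} (hx : x ≠ 0) {k : WithTop ℕ∞} :
    ContDiffAt ℝ k (halfSpaceKernel a) x := by
  have hx2 : ‖x‖ ^ 2 ≠ 0 := by positivity
  exact (innerSL ℝ a).contDiff.contDiffAt.mul
    ((contDiff_norm_sq ℝ).contDiffAt.rpow_const_of_ne hx2)

theorem contDiffAt_halfSpaceKernelDeriv (a e : E n) {x : E n} (hx : x ≠ 0) {k : ℕ∞} :
    ContDiffAt ℝ k (halfSpaceKernelDeriv a e) x :=
  ((contDiffAt_halfSpaceKernel a hx (k := ∞)).fderiv_right (m := k)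
    (by norm_cast; exact le_top)).clm_apply contDiffAt_const

theorem halfSpaceKernel_ofReal (a : E n) : (fun x => ((halfSpaceKernel a x : ℝ) : ℂ)) = fun x =>
    ((inner ℝ a x : ℝ) : ℂ) * (((‖x‖ ^ 2 + 0) ^ (-(n : ℝ) / 2) : ℝ) : ℂ) := by
  ext x
  simp [halfSpaceKernel]

/-- With `p = -n/2`, the cross term contributes `4p = -2n` and the radial term `2pn + 4p(p-1) = 2n`,
both times `⟪a, x⟫ ‖x‖^(-n-2)`. -/
theorem lap_halfSpaceKernel (a : E n) {x : E n} (hx : x ≠ 0) :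
    lap (fun x => ((halfSpaceKernel a x : ℝ) : ℂ)) x = 0 := by
  have hx2 : 0 < ‖x‖ ^ 2 + 0 := by positivity
  rw [halfSpaceKernel_ofReal, lap_mul (contDiff_inner_ofReal a).contDiffAt
    (contDiffAt_normSq_rpow _ hx2), lap_inner, lap_normSq_rpow _ hx2]
  have h1 : ∑ i, pderiv i (fun x => ((inner ℝ a x : ℝ) : ℂ)) x *
      pderiv i (fun x : E n => (((‖x‖ ^ 2 + 0) ^ (-(n : ℝ) / 2) : ℝ) : ℂ)) x =
      ((2 * (-(n : ℝ) / 2) * inner ℝ a x * (‖x‖ ^ 2 + 0) ^ (-(n : ℝ) / 2 - 1) : ℝ) : ℂ) := by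
    rw [PiLp.inner_apply, Finset.mul_sum, Finset.sum_mul, Complex.ofReal_sum]
    refine Finset.sum_congr rfl fun i _ => ?_
    rw [pderiv_inner, pderiv_normSq_rpow _ hx2, ← Complex.ofReal_mul]
    congr 1
    simp
    ring
  have h2 : (‖x‖ ^ 2 + 0) ^ (-(n : ℝ) / 2 - 1) =
      (‖x‖ ^ 2 + 0) * (‖x‖ ^ 2 + 0) ^ (-(n : ℝ) / 2 - 2) := by
    rw [← Real.rpow_one_add' hx2.le]
    · congr 1; ring
    · have : (0 : ℝ) ≤ n := Nat.cast_nonneg n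
      intro h; linarith
  rw [h1, h2, zero_mul, zero_add]
  norm_cast
  push_cast
  ring

theorem fderiv_fderiv_apply_comm {f : E n → ℂ} {x : E n} (hf : ContDiffAt ℝ 2 f x) (u v : E n) :
    fderiv ℝ (fun y => fderiv ℝ f y u) x v = fderiv ℝ (fun y => fderiv ℝ f y v) x u := by
  have hd : DifferentiableAt ℝ (fderiv ℝ f) x :=
    (hf.fderiv_right (m := 1) (by norm_num)).differentiableAt (by simp)
  have h : ∀ w : E n, fderiv ℝ (fun y => fderiv ℝ f y w) x = (fderiv ℝ (fderiv ℝ f) x).flip w := by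
    intro w
    have := (hd.hasFDerivAt.clm_apply (hasFDerivAt_const w x)).fderiv
    rw [this]
    ext z
    simp
  rw [h, h]
  exact (hf.isSymmSndFDerivAt (by simp)).eq v u

/-- Partial derivatives commute, so a derivative in a constant direction passes through the
Laplacian. -/
theorem lap_fderiv_apply {f : E n → ℂ} {x : E n} (hf : ∀ᶠ y in 𝓝 x, ContDiffAt ℝ ∞ f y)
    (hl : ∀ᶠ y in 𝓝 x, lap f y = 0) (e : E n) : lap (fun y => fderiv ℝ f y e) x = 0 := by
  have hsm : ∀ {y : E n} {g : E n → ℂ}, ContDiffAt ℝ ∞ g y → ContDiffAt ℝ 2 g y :=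
    fun h => h.of_le (by norm_cast)
  have h1 : ∀ i, pderiv i (pderiv i (fun y => fderiv ℝ f y e)) x =
      fderiv ℝ (pderiv i (pderiv i f)) x e := by
    intro i
    have h2 : pderiv i (fun y => fderiv ℝ f y e) =ᶠ[𝓝 x] fun y => fderiv ℝ (pderiv i f) y e := by
      filter_upwards [hf] with y hy
      exact fderiv_fderiv_apply_comm (hsm hy) e _
    rw [(pderiv_congr (i := i) h2).eq_of_nhds]
    exact fderiv_fderiv_apply_comm (hsm (contDiffAt_pderiv hf.self_of_nhds (by simp))) e _
  have h3 : ∀ i : Fin n, DifferentiableAt ℝ (pderiv i (pderiv i f)) x := fun i =>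
    (contDiffAt_pderiv (m := ∞) (contDiffAt_pderiv (m := ∞) hf.self_of_nhds (by simp))
      (by simp)).differentiableAt (by simp)
  have h4 : fderiv ℝ (lap f) x e = ∑ i, fderiv ℝ (pderiv i (pderiv i f)) x e := by
    have : lap f = fun y => ∑ i, pderiv i (pderiv i f) y := rfl
    rw [this, fderiv_fun_sum fun i _ => h3 i]
    simp
  have h5 : lap f =ᶠ[𝓝 x] fun _ => 0 := hl
  rw [lap]
  simp only [h1]
  rw [← h4, h5.fderiv_eq]
  simp

theorem halfSpaceKernelDeriv_ofReal (a e : E n) {x : E n} (hx : x ≠ 0) :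
    ((halfSpaceKernelDeriv a e x : ℝ) : ℂ) =
      fderiv ℝ (fun x => ((halfSpaceKernel a x : ℝ) : ℂ)) x e := by
  rw [(hasFDerivAt_ofReal
    ((contDiffAt_halfSpaceKernel a hx (k := 1)).differentiableAt (by simp)).hasFDerivAt).fderiv]
  rfl

theorem lap_halfSpaceKernelDeriv (a e : E n) {x : E n} (hx : x ≠ 0) :
    lap (fun x => ((halfSpaceKernelDeriv a e x : ℝ) : ℂ)) x = 0 := by
  have hev : ∀ᶠ y in 𝓝 x, y ≠ 0 := isOpen_ne.mem_nhds hx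
  have h : (fun x => ((halfSpaceKernelDeriv a e x : ℝ) : ℂ)) =ᶠ[𝓝 x]
      fun x => fderiv ℝ (fun x => ((halfSpaceKernel a x : ℝ) : ℂ)) x e := by
    filter_upwards [hev] with y hy using halfSpaceKernelDeriv_ofReal a e hy
  rw [(lap_congr h).eq_of_nhds]
  refine lap_fderiv_apply ?_ ?_ e
  · filter_upwards [hev] with y hy
    exact Complex.ofRealCLM.contDiff.contDiffAt.comp y (contDiffAt_halfSpaceKernel a hy)
  · filter_upwards [hev] with y hy using lap_halfSpaceKernel a hy

/-- `f` is positively homogeneous of degree `-k`. -/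
def NegHomogeneous {F : Type*} [NormedAddCommGroup F] [NormedSpace ℝ F] (k : ℕ) (f : E n → F) :
    Prop := ∀ t : ℝ, 0 < t → ∀ x, t ^ k • f (t • x) = f x

section

variable {F : Type*} [NormedAddCommGroup F] [NormedSpace ℝ F] {k : ℕ} {f : E n → F}

theorem NegHomogeneous.fderiv (hf : NegHomogeneous k f) : NegHomogeneous (k + 1) (fderiv ℝ f) := by
  intro t ht x
  have h1 : (fun x => t ^ k • f (t • x)) = f := funext fun x => hf t ht x
  have h2 : _root_.fderiv ℝ (fun x => t ^ k • f (t • x)) x =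
      t ^ k • (t • _root_.fderiv ℝ f (t • x)) := by
    have := fderiv_const_smul_field (𝕜 := ℝ) (t ^ k) (f := fun x => f (t • x))
    rw [show (fun x => t ^ k • f (t • x)) = (t ^ k) • (fun x => f (t • x)) from rfl, this,
      Pi.smul_apply, fderiv_comp_smul]
  rw [h1] at h2
  rw [h2, smul_smul, pow_succ]

theorem NegHomogeneous.apply {G : Type*} [NormedAddCommGroup G] [NormedSpace ℝ G]
    {f : E n → G →L[ℝ] F} (hf : NegHomogeneous k f) (v : G) : NegHomogeneous k fun x => f x v := by
  intro t ht x
  exact congrArg (fun L : G →L[ℝ] F => L v) (hf t ht x)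

/-- Compactness of the unit sphere gives the bound there, and homogeneity carries it to every
nonzero point. -/
theorem NegHomogeneous.exists_bound (hf : NegHomogeneous k f) (hc : ContinuousOn f {0}ᶜ) :
    ∃ C, 0 ≤ C ∧ ∀ x, x ≠ 0 → ‖f x‖ * ‖x‖ ^ k ≤ C := by
  have hs : sphere (0 : E n) 1 ⊆ {0}ᶜ := fun x hx h => by
    rw [mem_singleton_iff.1 h] at hx
    simp at hx
  obtain ⟨C, hC⟩ := (isCompact_sphere (0 : E n) 1).exists_bound_of_continuousOn (hc.mono hs)
  refine ⟨max C 0, le_max_right _ _, fun x hx => (le_trans ?_ (le_max_left C 0))⟩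
  have hx0 : 0 < ‖x‖ := norm_pos_iff.2 hx
  have h1 := hC (‖x‖⁻¹ • x) (by simp [norm_smul, hx0.ne'])
  rw [← hf ‖x‖ hx0, smul_smul, mul_inv_cancel₀ hx0.ne', one_smul, norm_smul, norm_pow, norm_norm,
    mul_comm] at h1
  exact h1

end

theorem negHomogeneous_halfSpaceKernel (hn : 1 ≤ n) (a : E n) :
    NegHomogeneous (n - 1) (halfSpaceKernel a) := by
  intro t ht x
  have h1 : (t ^ 2) ^ (-(n : ℝ) / 2) = (t ^ n)⁻¹ := by
    rw [← Real.rpow_natCast t 2, ← Real.rpow_mul ht.le, ← Real.rpow_natCast t n,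
      ← Real.rpow_neg ht.le]
    congr 1
    push_cast
    ring
  rw [halfSpaceKernel, halfSpaceKernel, norm_smul, mul_pow,
    Real.mul_rpow (by positivity) (by positivity), Real.norm_of_nonneg ht.le, h1, inner_smul_right,
    smul_eq_mul]
  obtain ⟨m, rfl⟩ := Nat.exists_eq_add_of_le' hn
  rw [Nat.add_sub_cancel]
  field_simp
  ring

theorem negHomogeneous_halfSpaceKernelDeriv (hn : 1 ≤ n) (a e : E n) :
    NegHomogeneous n (halfSpaceKernelDeriv a e) := by
  have := (negHomogeneous_halfSpaceKernel hn a).fderiv.apply e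
  rwa [Nat.sub_add_cancel hn] at this

end HalfSpaceKernel

/-! ### Solid cones and the dipole -/

section SolidCones

open Filter Topology

variable {n : ℕ} {K : Set (E n)} {a e : E n} {δ : ℝ}

/-- `K` is a closed convex cone with the unit vector `e` in its interior on which the linear
function `⟪a, ·⟫` is bounded below by `δ ‖·‖`. -/
structure IsSolidCone (K : Set (E n)) (a e : E n) (δ : ℝ) : Prop where
  isClosed : IsClosed K
  convex : Convex ℝ K
  smul_mem : ∀ x ∈ K, ∀ t : ℝ, 0 ≤ t → t • x ∈ K
  mem_interior : e ∈ interior K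
  norm_eq : ‖e‖ = 1
  pos : 0 < δ
  le_inner : ∀ x ∈ K, δ * ‖x‖ ≤ inner ℝ a x

namespace IsSolidCone

theorem add_mem (hK : IsSolidCone K a e δ) {x y : E n} (hx : x ∈ K) (hy : y ∈ K) : x + y ∈ K := by
  have h := hK.convex hx hy (by norm_num : (0 : ℝ) ≤ 1 / 2) (by norm_num : (0 : ℝ) ≤ 1 / 2)
    (by norm_num)
  have := hK.smul_mem _ h 2 (by norm_num)
  rwa [smul_add, smul_smul, smul_smul, mul_one_div_cancel two_ne_zero, one_smul, one_smul] at this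

theorem add_smul_mem (hK : IsSolidCone K a e δ) {x : E n} (hx : x ∈ K) {t : ℝ} (ht : 0 ≤ t) :
    x + t • e ∈ K :=
  hK.add_mem hx (hK.smul_mem e (interior_subset hK.mem_interior) t ht)

theorem norm_pos (hK : IsSolidCone K a e δ) : 0 < ‖a‖ := by
  have h := hK.le_inner e (interior_subset hK.mem_interior)
  rw [hK.norm_eq, mul_one] at h
  have h2 := real_inner_le_norm a e
  rw [hK.norm_eq, mul_one] at h2
  linarith [hK.pos]

/-- There is no cancellation inside the cone: `⟪a, ·⟫` is at least `δ ‖·‖` on both `x` and `t • e`,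
and it is at most `‖a‖ ‖·‖` on the sum. Hence the poles of translates along `-e` keep a distance
comparable to `‖x‖ + t`. -/
theorem mul_le_norm_add (hK : IsSolidCone K a e δ) {x : E n} (hx : x ∈ K) {t : ℝ} (ht : 0 ≤ t) :
    δ / ‖a‖ * (‖x‖ + t) ≤ ‖x + t • e‖ := by
  have h1 := hK.le_inner x hx
  have h2 := hK.le_inner e (interior_subset hK.mem_interior)
  rw [hK.norm_eq, mul_one] at h2
  have h3 := real_inner_le_norm a (x + t • e)
  rw [inner_add_right, inner_smul_right] at h3
  rw [div_mul_eq_mul_div, div_le_iff₀ hK.norm_pos]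
  have h4 : t * δ ≤ t * inner ℝ a e := by gcongr
  nlinarith

theorem norm_add_pos (hK : IsSolidCone K a e δ) {x : E n} (hx : x ∈ K) {t : ℝ} (ht : 0 < t) :
    0 < ‖x + t • e‖ := by
  have h1 := hK.norm_pos
  have h2 := hK.pos
  exact lt_of_lt_of_le (by positivity) (hK.mul_le_norm_add hx ht.le)

theorem add_ne_zero (hK : IsSolidCone K a e δ) {x : E n} (hx : x ∈ K) {t : ℝ} (ht : 0 < t) :
    x + t • e ≠ 0 := norm_pos_iff.1 (hK.norm_add_pos hx ht)

theorem norm_mul_pow_le {F : Type*} [NormedAddCommGroup F] (hK : IsSolidCone K a e δ) {f : E n → F}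
    {k : ℕ} {C : ℝ} (hf : ∀ x, x ≠ 0 → ‖f x‖ * ‖x‖ ^ k ≤ C) {x : E n} (hx : x ∈ K) {t : ℝ}
    (ht : 0 < t) : ‖f (x + t • e)‖ * (‖x‖ + t) ^ k ≤ C * (‖a‖ / δ) ^ k := by
  have h1 := hf _ (hK.add_ne_zero hx ht)
  have h2 := hK.mul_le_norm_add hx ht.le
  have h3 := hK.norm_pos
  have h4 := hK.pos
  calc ‖f (x + t • e)‖ * (‖x‖ + t) ^ k
      = ‖f (x + t • e)‖ * (δ / ‖a‖ * (‖x‖ + t)) ^ k * (‖a‖ / δ) ^ k := by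
        rw [mul_assoc, ← mul_pow]
        congr 2
        field_simp
    _ ≤ ‖f (x + t • e)‖ * ‖x + t • e‖ ^ k * (‖a‖ / δ) ^ k := by gcongr
    _ ≤ C * (‖a‖ / δ) ^ k := by gcongr

/-- Mean value inequality on the segment from `x + t • e` to `x + (2 * t) • e`, which has length
`t`. -/
theorem norm_sub_mul_pow_le {F : Type*} [NormedAddCommGroup F] [NormedSpace ℝ F]
    (hK : IsSolidCone K a e δ) {f : E n → F} {k : ℕ} {C : ℝ}
    (hd : ∀ x, x ≠ 0 → DifferentiableAt ℝ f x)
    (hf : ∀ x, x ≠ 0 → ‖fderiv ℝ f x‖ * ‖x‖ ^ k ≤ C) {x : E n} (hx : x ∈ K) {t : ℝ}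
    (ht : 0 < t) : ‖f (x + t • e) - f (x + (2 * t) • e)‖ * (‖x‖ + t) ^ k ≤
      C * (‖a‖ / δ) ^ k * t := by
  have hpos : 0 < (‖x‖ + t) ^ k := by positivity
  have hC : 0 ≤ C := (by positivity : (0 : ℝ) ≤ _).trans (hf _ (hK.add_ne_zero hx ht))
  have h3 := hK.norm_pos
  have h4 := hK.pos
  set s : Set (E n) := (fun σ : ℝ => x + σ • e) '' Icc t (2 * t) with hs
  have hconv : Convex ℝ s := by
    rintro _ ⟨σ, hσ, rfl⟩ _ ⟨τ, hτ, rfl⟩ u v hu hv huv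
    refine ⟨u * σ + v * τ, convex_Icc t (2 * t) hσ hτ hu hv huv, ?_⟩
    obtain rfl : v = 1 - u := by linarith
    module
  have hbound : ∀ y ∈ s, ‖fderiv ℝ f y‖ ≤ C * (‖a‖ / δ) ^ k / (‖x‖ + t) ^ k := by
    rintro _ ⟨σ, hσ, rfl⟩
    have hσ0 : 0 < σ := ht.trans_le hσ.1
    rw [le_div_iff₀ hpos]
    refine le_trans ?_ (hK.norm_mul_pow_le hf hx hσ0)
    gcongr
    exact hσ.1
  have hdiff : ∀ y ∈ s, DifferentiableAt ℝ f y := by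
    rintro _ ⟨σ, hσ, rfl⟩
    exact hd _ (hK.add_ne_zero hx (ht.trans_le hσ.1))
  have key := hconv.norm_image_sub_le_of_norm_fderiv_le hdiff hbound
    (x := x + (2 * t) • e) (y := x + t • e) ⟨2 * t, ⟨by linarith, le_rfl⟩, rfl⟩
    ⟨t, ⟨le_rfl, by linarith⟩, rfl⟩
  have hnorm : ‖x + t • e - (x + (2 * t) • e)‖ = t := by
    rw [show x + t • e - (x + (2 * t) • e) = -(t • e) by module, norm_neg, norm_smul, hK.norm_eq,
      mul_one, Real.norm_of_nonneg ht.le]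
  rw [hnorm, div_mul_eq_mul_div, le_div_iff₀ hpos] at key
  exact key

end IsSolidCone

/-- A harmonic function with poles at `-t e` and `-2 t e` which decays like `‖x‖ ^ (-n-1)`. -/
noncomputable def dipole (a e : E n) (t : ℝ) (x : E n) : ℝ :=
  halfSpaceKernelDeriv a e (x + t • e) - halfSpaceKernelDeriv a e (x + (2 * t) • e)

/-- The kernel derivative has degree `-n`, exactly the power that a change of variables in `ℝⁿ`
compensates; integrals of the dipole over a cone are therefore independent of `t`. -/
theorem dipole_smul (hn : 1 ≤ n) (a e : E n) {t : ℝ} (ht : 0 < t) (x : E n) :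
    t ^ n * dipole a e t (t • x) = dipole a e 1 x := by
  have h := negHomogeneous_halfSpaceKernelDeriv hn a e t ht
  simp only [smul_eq_mul] at h
  rw [dipole, dipole, ← h (x + (1 : ℝ) • e), ← h (x + (2 * 1 : ℝ) • e), mul_sub]
  congr 3 <;> module

/-- The difference of two translates gains one order of decay over the kernel derivative, whose
degree `-n` just fails to be integrable at infinity. The factor `t` makes the dipole small away from
the apex. -/
theorem IsSolidCone.exists_dipole_bound (hn : 1 ≤ n) (hK : IsSolidCone K a e δ) :
    ∃ C, 0 ≤ C ∧ ∀ x ∈ K, ∀ t : ℝ, 0 < t → |dipole a e t x| * (‖x‖ + t) ^ (n + 1) ≤ C * t := by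
  have hd : ∀ x : E n, x ≠ 0 → DifferentiableAt ℝ (halfSpaceKernelDeriv a e) x := fun x hx =>
    (contDiffAt_halfSpaceKernelDeriv a e hx (k := 1)).differentiableAt (by simp)
  obtain ⟨C, hC0, hC⟩ := (negHomogeneous_halfSpaceKernelDeriv hn a e).fderiv.exists_bound
    fun x hx => (((contDiffAt_halfSpaceKernelDeriv a e hx (k := 1)).fderiv_right
      (m := 0) (by norm_num)).continuousAt).continuousWithinAt
  have h3 := hK.norm_pos
  have h4 := hK.pos
  refine ⟨C * (‖a‖ / δ) ^ (n + 1), by positivity, fun x hx t ht => ?_⟩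
  exact hK.norm_sub_mul_pow_le hd hC hx ht

theorem contDiffAt_dipole (a e : E n) {x : E n} {t : ℝ} (h1 : x + t • e ≠ 0)
    (h2 : x + (2 * t) • e ≠ 0) : ContDiffAt ℝ ∞ (fun x => ((dipole a e t x : ℝ) : ℂ)) x := by
  refine Complex.ofRealCLM.contDiff.contDiffAt.comp x (ContDiffAt.sub ?_ ?_)
  · exact (contDiffAt_halfSpaceKernelDeriv a e h1).comp x (contDiffAt_id.add contDiffAt_const)
  · exact (contDiffAt_halfSpaceKernelDeriv a e h2).comp x (contDiffAt_id.add contDiffAt_const)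

theorem lap_dipole (a e : E n) {x : E n} {t : ℝ} (h1 : x + t • e ≠ 0)
    (h2 : x + (2 * t) • e ≠ 0) : lap (fun x => ((dipole a e t x : ℝ) : ℂ)) x = 0 := by
  have h : ∀ s : ℝ, x + s • e ≠ 0 →
      ContDiffAt ℝ 2 (fun y => ((halfSpaceKernelDeriv a e (y - -(s • e)) : ℝ) : ℂ)) x ∧
      lap (fun y => ((halfSpaceKernelDeriv a e (y - -(s • e)) : ℝ) : ℂ)) x = 0 := by
    intro s hs
    have hs' : x - -(s • e) ≠ 0 := by rwa [sub_neg_eq_add]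
    refine ⟨?_, ?_⟩
    · have := (contDiffAt_halfSpaceKernelDeriv a e hs' (k := 2)).comp x
        (contDiffAt_id.sub contDiffAt_const)
      exact Complex.ofRealCLM.contDiff.contDiffAt.comp x this
    · rw [lap_comp_sub_const (f := fun y => ((halfSpaceKernelDeriv a e y : ℝ) : ℂ)),
        lap_halfSpaceKernelDeriv a e hs']
  have h3 := lap_sub (h t h1).1 (h (2 * t) h2).1
  rw [(h t h1).2, (h (2 * t) h2).2, sub_zero] at h3
  rw [← h3]
  congr 1
  ext y
  simp [dipole]

/-- The same mean value argument one derivative higher. It controls the commutator with a cutoff. -/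
theorem IsSolidCone.exists_pderiv_dipole_bound (hn : 1 ≤ n) (hK : IsSolidCone K a e δ) :
    ∃ C, 0 ≤ C ∧ ∀ x ∈ K, ∀ t : ℝ, 0 < t → ∀ i,
      ‖pderiv i (fun x => ((dipole a e t x : ℝ) : ℂ)) x‖ * (‖x‖ + t) ^ (n + 2) ≤ C * t := by
  set f := fderiv ℝ (halfSpaceKernelDeriv a e) with hf
  have hcd : ∀ x : E n, x ≠ 0 → ContDiffAt ℝ 1 f x := fun x hx =>
    (contDiffAt_halfSpaceKernelDeriv a e hx (k := 2)).fderiv_right (by norm_num)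
  obtain ⟨C, hC0, hC⟩ := (negHomogeneous_halfSpaceKernelDeriv hn a e).fderiv.fderiv.exists_bound
    fun x hx => (((hcd x hx).fderiv_right (m := 0) (by norm_num)).continuousAt).continuousWithinAt
  have h3 := hK.norm_pos
  have h4 := hK.pos
  refine ⟨C * (‖a‖ / δ) ^ (n + 2), by positivity, fun x hx t ht i => ?_⟩
  have key := hK.norm_sub_mul_pow_le (fun x hx => (hcd x hx).differentiableAt (by simp)) hC hx ht
  refine le_trans (mul_le_mul_of_nonneg_right ?_ (by positivity)) key
  have hder : ∀ s : ℝ, 0 < s →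
      HasFDerivAt (fun x => halfSpaceKernelDeriv a e (x + s • e)) (f (x + s • e)) x := by
    intro s hs
    have := ((contDiffAt_halfSpaceKernelDeriv a e (hK.add_ne_zero hx hs)
      (k := 1)).differentiableAt (by simp)).hasFDerivAt
    have h := this.comp x ((hasFDerivAt_id x).add_const (s • e))
    exact h
  have hd := (hder t ht).sub (hder (2 * t) (by linarith))
  have he : pderiv i (fun x => ((dipole a e t x : ℝ) : ℂ)) x =
      (((f (x + t • e) - f (x + (2 * t) • e)) (EuclideanSpace.single i 1) : ℝ) : ℂ) :=
    pderiv_ofReal hd i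
  rw [he, Complex.norm_real]
  refine (ContinuousLinearMap.le_opNorm _ _).trans_eq ?_
  simp

end SolidCones

/-- An orthonormal basis that starts with `e` gives the height `s` along `e` and `m` coordinates on
the orthogonal hyperplane. The last bound holds as `s` is the inner product with the unit vector
`e`. -/
theorem exists_cylindrical_coordinates {m : ℕ} (e : E (m + 1)) (he : ‖e‖ = 1) :
    ∃ (T : (ℝ × (Fin m → ℝ)) ≃ᵐ E (m + 1)) (L : (Fin m → ℝ) →L[ℝ] E (m + 1)),
      MeasurePreserving T ∧ (∀ p, T p = p.1 • e + L p.2) ∧ ∀ s y, |s| ≤ ‖s • e + L y‖ := by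
  obtain ⟨b, hb⟩ := Orthonormal.exists_orthonormalBasis_extension_of_card_eq (𝕜 := ℝ)
    (E := E (m + 1)) (ι := Fin (m + 1)) (by simp) (v := fun _ => e) (s := {0}) (by
      rw [orthonormal_iff_ite]
      rintro ⟨i, rfl⟩ ⟨j, rfl⟩
      simp [he])
  have hb0 : b 0 = e := hb 0 rfl
  set T : (ℝ × (Fin m → ℝ)) ≃ᵐ E (m + 1) :=
    (MeasurableEquiv.piFinSuccAbove (fun _ : Fin (m + 1) => ℝ) 0).symm.trans
      ((MeasurableEquiv.toLp 2 (Fin (m + 1) → ℝ)).trans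
        b.repr.symm.toHomeomorph.toMeasurableEquiv) with hT
  set L : (Fin m → ℝ) →L[ℝ] E (m + 1) := LinearMap.toContinuousLinearMap
    (∑ j : Fin m, (LinearMap.proj j : (Fin m → ℝ) →ₗ[ℝ] ℝ).smulRight (b j.succ)) with hL
  have hLy : ∀ y, L y = ∑ j, y j • b j.succ := fun y => by simp [hL]
  refine ⟨T, L, ?_, ?_, ?_⟩
  · exact (b.measurePreserving_repr_symm.comp
      (PiLp.volume_preserving_toLp (Fin (m + 1)))).comp
      ((volume_preserving_piFinSuccAbove (fun _ : Fin (m + 1) => ℝ) 0).symm _)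
  · intro p
    have h1 : T p = b.repr.symm (WithLp.toLp 2 (Fin.insertNth (0 : Fin (m + 1)) p.1 p.2)) := rfl
    rw [h1, ← b.sum_repr_symm, Fin.sum_univ_succ, hLy, hb0]
    simp
  · intro s y
    have h : inner ℝ e (s • e + L y) = s := by
      rw [inner_add_right, inner_smul_right, real_inner_self_eq_norm_sq, he, hLy, inner_sum,
        ← hb0]
      simp [inner_smul_right, b.inner_eq_ite, (Fin.succ_ne_zero _).symm]
    have h2 := abs_real_inner_le_norm e (s • e + L y)
    rwa [h, he, one_mul] at h2

/-! ### The integral of the dipole over a cone -/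

section DipoleIntegral

open Filter Topology

variable {m : ℕ} {K : Set (E (m + 1))} {a e : E (m + 1)} {δ : ℝ}

/-- The cone is an epigraph over the hyperplane. Each vertical line meets it because `e` is
interior; the infimum is finite because `⟪a, ·⟫` is nonnegative on the cone; and it is attained by
closedness. Homogeneity is recorded only for the factor `2`, the ratio of the two pole distances. -/
theorem IsSolidCone.exists_height (hK : IsSolidCone K a e δ) (L : (Fin m → ℝ) →L[ℝ] E (m + 1)) :
    ∃ (g : (Fin m → ℝ) → ℝ) (C : ℝ), (∀ s y, s • e + L y ∈ K ↔ g y ≤ s) ∧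
      (∀ y, g ((2 : ℝ) • y) = 2 * g y) ∧ 0 ≤ C ∧ ∀ y, |g y| ≤ C * ‖y‖ := by
  obtain ⟨r, hr, hball⟩ := Metric.isOpen_iff.1 isOpen_interior e hK.mem_interior
  have hae : 0 < inner ℝ a e := by
    have := hK.le_inner e (interior_subset hK.mem_interior)
    rw [hK.norm_eq, mul_one] at this
    exact hK.pos.trans_le this
  have hupper : ∀ y, (2 * ‖L y‖ / r) • e + L y ∈ K := by
    intro y
    by_cases h0 : L y = 0
    · simpa [h0] using hK.smul_mem e (interior_subset hK.mem_interior) 0 le_rfl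
    · have hy : 0 < ‖L y‖ := norm_pos_iff.2 h0
      have h1 : e + (r / (2 * ‖L y‖)) • L y ∈ ball e r := by
        rw [mem_ball, dist_eq_norm, add_sub_cancel_left, norm_smul,
          Real.norm_of_nonneg (by positivity)]
        field_simp
        linarith
      have h2 := hK.smul_mem _ (interior_subset (hball h1)) (2 * ‖L y‖ / r) (by positivity)
      rw [smul_add, smul_smul] at h2
      have h3 : 2 * ‖L y‖ / r * (r / (2 * ‖L y‖)) = 1 := by field_simp
      rwa [h3, one_smul] at h2
  have hlower : ∀ s y, s • e + L y ∈ K → -(‖a‖ * ‖L y‖ / inner ℝ a e) ≤ s := by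
    intro s y hs
    have h1 := hK.le_inner _ hs
    have h2 : 0 ≤ inner ℝ a (s • e + L y) := (by have := hK.pos; positivity : (0 : ℝ) ≤ _).trans h1
    rw [inner_add_right, inner_smul_right] at h2
    have h3 := real_inner_le_norm a (L y)
    rw [neg_le, le_div_iff₀ hae]
    linarith
  set g : (Fin m → ℝ) → ℝ := fun y => sInf {s | s • e + L y ∈ K} with hg
  have hbdd : ∀ y, BddBelow {s | s • e + L y ∈ K} := fun y => ⟨_, fun s hs => hlower s y hs⟩
  have hne : ∀ y, {s | s • e + L y ∈ K}.Nonempty := fun y => ⟨_, hupper y⟩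
  have hclosed : ∀ y, IsClosed {s : ℝ | s • e + L y ∈ K} := fun y =>
    hK.isClosed.preimage (by fun_prop : Continuous fun s : ℝ => s • e + L y)
  have hiff : ∀ s y, s • e + L y ∈ K ↔ g y ≤ s := by
    refine fun s y => ⟨fun hs => csInf_le (hbdd y) hs, fun hs => ?_⟩
    have h1 : g y • e + L y ∈ K := (hclosed y).csInf_mem (hne y) (hbdd y)
    have h2 := hK.add_smul_mem h1 (sub_nonneg.2 hs)
    convert h2 using 1
    module
  refine ⟨g, max (2 * ‖L‖ / r) (‖a‖ * ‖L‖ / inner ℝ a e), hiff, fun y => ?_, by positivity,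
    fun y => abs_le.2 ⟨?_, ?_⟩⟩
  · have h1 : ∀ s, g ((2 : ℝ) • y) ≤ 2 * s ↔ g y ≤ s := by
      intro s
      rw [← hiff, ← hiff, map_smul, mul_smul, ← smul_add]
      refine ⟨fun h => ?_, fun h => hK.smul_mem _ h 2 (by norm_num)⟩
      have := hK.smul_mem _ h (1 / 2) (by norm_num)
      rwa [smul_smul, one_div_mul_cancel two_ne_zero, one_smul] at this
    have h2 := (h1 (g y)).2 le_rfl
    have h3 := (h1 (g ((2 : ℝ) • y) / 2)).1 (by linarith)
    linarith
  · have h1 := hlower _ y ((hiff (g y) y).2 le_rfl)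
    have h2 : ‖a‖ * ‖L y‖ / inner ℝ a e ≤ ‖a‖ * ‖L‖ / inner ℝ a e * ‖y‖ := by
      rw [div_mul_eq_mul_div, mul_assoc]
      gcongr
      exact L.le_opNorm y
    have h3 : ‖a‖ * ‖L‖ / inner ℝ a e * ‖y‖ ≤
        max (2 * ‖L‖ / r) (‖a‖ * ‖L‖ / inner ℝ a e) * ‖y‖ := by
      gcongr
      exact le_max_right _ _
    linarith
  · have h1 := (hiff _ y).1 (hupper y)
    have h2 : 2 * ‖L y‖ / r ≤ 2 * ‖L‖ / r * ‖y‖ := by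
      rw [div_mul_eq_mul_div, mul_assoc]
      gcongr
      exact L.le_opNorm y
    refine (h1.trans h2).trans ?_
    gcongr
    exact le_max_left _ _

theorem IsSolidCone.exists_halfSpaceKernelDeriv_le (hK : IsSolidCone K a e δ) :
    ∃ C, 0 ≤ C ∧ ∀ x ∈ K, ∀ τ : ℝ, 1 ≤ τ →
      ‖halfSpaceKernelDeriv a e (x + τ • e)‖ ≤ C * (1 + ‖x‖) ^ (-((m + 1 : ℕ) : ℝ)) := by
  obtain ⟨C, hC0, hC⟩ := (negHomogeneous_halfSpaceKernelDeriv (Nat.succ_le_succ (Nat.zero_le m))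
    a e).exists_bound fun x hx =>
      ((contDiffAt_halfSpaceKernelDeriv a e hx (k := 0)).continuousAt).continuousWithinAt
  have h3 := hK.norm_pos
  have h4 := hK.pos
  refine ⟨C * (‖a‖ / δ) ^ (m + 1), by positivity, fun x hx τ hτ => ?_⟩
  have h := hK.norm_mul_pow_le hC hx (zero_lt_one.trans_le hτ)
  rw [Real.rpow_neg (by positivity), Real.rpow_natCast, ← div_eq_mul_inv,
    le_div_iff₀ (by positivity)]
  refine le_trans ?_ h
  gcongr ?_ * ?_ ^ _
  linarith

theorem tendsto_halfSpaceKernel_smul_add (hm : 1 ≤ m) (he : ‖e‖ = 1) (x : E (m + 1)) :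
    Tendsto (fun s : ℝ => halfSpaceKernel a (s • e + x)) atTop (𝓝 0) := by
  obtain ⟨C, hC0, hC⟩ := (negHomogeneous_halfSpaceKernel (Nat.succ_le_succ (Nat.zero_le m))
    a).exists_bound fun x hx =>
      ((contDiffAt_halfSpaceKernel a hx (k := 0)).continuousAt).continuousWithinAt
  have hpow : Tendsto (fun s : ℝ => C / (s - ‖x‖) ^ m) atTop (𝓝 0) := by
    refine Tendsto.div_atTop tendsto_const_nhds ?_
    exact (tendsto_pow_atTop (by lia)).comp (tendsto_atTop_add_const_right _ _ tendsto_id)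
  refine squeeze_zero_norm' ?_ hpow
  filter_upwards [eventually_gt_atTop (‖x‖ + 1)] with s hs
  have h1 : s - ‖x‖ ≤ ‖s • e + x‖ := by
    have := norm_sub_norm_le (s • e) (-x)
    rw [sub_neg_eq_add, norm_neg, norm_smul, he, mul_one, Real.norm_eq_abs] at this
    linarith [le_abs_self s]
  have hne : s • e + x ≠ 0 := norm_pos_iff.1 (by linarith)
  rw [le_div_iff₀ (pow_pos (by linarith) _)]
  refine le_trans ?_ (hC _ hne)
  rw [Nat.succ_sub_one]
  gcongr
  linarith

theorem IsSolidCone.le_halfSpaceKernel (hK : IsSolidCone K a e δ) {x : E (m + 1)} (hx : x ∈ K)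
    (h0 : x ≠ 0) : δ / ‖x‖ ^ m ≤ halfSpaceKernel a x := by
  have hx0 : 0 < ‖x‖ := norm_pos_iff.2 h0
  have h1 : (‖x‖ ^ 2) ^ (-(((m + 1 : ℕ) : ℝ)) / 2) = (‖x‖ ^ (m + 1))⁻¹ := by
    rw [← Real.rpow_natCast ‖x‖ 2, ← Real.rpow_mul hx0.le, ← Real.rpow_natCast ‖x‖ (m + 1),
      ← Real.rpow_neg hx0.le]
    congr 1
    push_cast
    ring
  rw [halfSpaceKernel, h1, ← div_eq_mul_inv, div_le_div_iff₀ (by positivity) (by positivity),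
    pow_succ]
  have := hK.le_inner x hx
  calc δ * (‖x‖ ^ m * ‖x‖) = δ * ‖x‖ * ‖x‖ ^ m := by ring
    _ ≤ _ := by gcongr

theorem IsSolidCone.continuousOn_comp_add (hK : IsSolidCone K a e δ) {τ : ℝ} (hτ : 0 < τ) :
    ContinuousOn (fun x => halfSpaceKernelDeriv a e (x + τ • e)) K := fun x hx =>
  ((contDiffAt_halfSpaceKernelDeriv a e (hK.add_ne_zero hx hτ) (k := 0)).continuousAt.comp
    (f := fun x => x + τ • e) (by fun_prop)).continuousWithinAt

/-- A translated kernel derivative decays like `(1 + ‖x‖)^(-(m+1))`: integrable along vertical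
lines, but not guaranteed to be so over the whole cone. The horizontal coordinate is therefore
truncated. -/
theorem IsSolidCone.integrableOn_cylinder (hK : IsSolidCone K a e δ) (hm : 1 ≤ m)
    (T : (ℝ × (Fin m → ℝ)) ≃ᵐ E (m + 1)) (hT : ∀ p, |p.1| ≤ ‖T p‖) {τ : ℝ} (hτ : 1 ≤ τ) (R : ℝ) :
    IntegrableOn (fun p => halfSpaceKernelDeriv a e (T p + τ • e))
      (T ⁻¹' K ∩ Prod.snd ⁻¹' ball 0 R) := by
  obtain ⟨C, hC0, hC⟩ := hK.exists_halfSpaceKernelDeriv_le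
  have hmeas : MeasurableSet (T ⁻¹' K ∩ Prod.snd ⁻¹' ball (0 : Fin m → ℝ) R) :=
    (T.measurable hK.isClosed.measurableSet).inter (measurable_snd measurableSet_ball)
  have h1 : Integrable (fun s : ℝ => C * (1 + ‖s‖) ^ (-((m + 1 : ℕ) : ℝ))) :=
    (integrable_one_add_norm (by simp; lia)).const_mul C
  have h2 : Integrable ((ball (0 : Fin m → ℝ) R).indicator fun _ => (1 : ℝ)) :=
    (integrable_indicator_iff measurableSet_ball).2 (integrableOn_const measure_ball_lt_top.ne)
  have h3 := h1.mul_prod h2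
  rw [← integrable_indicator_iff hmeas]
  refine h3.mono' ?_ (Eventually.of_forall fun p => ?_)
  · have h4 : StronglyMeasurable (K.indicator fun x => halfSpaceKernelDeriv a e (x + τ • e)) := by
      classical
      refine Measurable.stronglyMeasurable ?_
      have := (hK.continuousOn_comp_add (zero_lt_one.trans_le hτ)).measurable_piecewise
        (g := fun _ => (0 : ℝ)) continuousOn_const hK.isClosed.measurableSet
      convert this using 1
      ext x
      by_cases hx : x ∈ K <;> simp [hx]
    have h5 : (T ⁻¹' K ∩ Prod.snd ⁻¹' ball (0 : Fin m → ℝ) R).indicator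
        (fun p => halfSpaceKernelDeriv a e (T p + τ • e)) =
        (Prod.snd ⁻¹' ball (0 : Fin m → ℝ) R).indicator
          ((K.indicator fun x => halfSpaceKernelDeriv a e (x + τ • e)) ∘ T) := by
      ext p
      by_cases h6 : p ∈ T ⁻¹' K <;> by_cases h7 : p ∈ Prod.snd ⁻¹' ball (0 : Fin m → ℝ) R <;>
        simp_all [indicator]
    rw [h5]
    exact ((h4.comp_measurable T.measurable).indicator
      (measurable_snd measurableSet_ball)).aestronglyMeasurable
  · by_cases hp : p ∈ T ⁻¹' K ∩ Prod.snd ⁻¹' ball (0 : Fin m → ℝ) R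
    · rw [indicator_of_mem hp, indicator_of_mem (show p.2 ∈ ball 0 R from hp.2), mul_one]
      refine (hC _ hp.1 τ hτ).trans ?_
      gcongr C * ?_
      refine Real.rpow_le_rpow_of_nonpos (by positivity) ?_ (neg_nonpos.2 (Nat.cast_nonneg _))
      gcongr
      exact hT p
    · rw [indicator_of_notMem hp, norm_zero]
      exact mul_nonneg (by positivity) (indicator_nonneg (fun _ _ => zero_le_one) _)

/-- Fubini and the fundamental theorem of calculus along `e`: the primitive is the Poisson kernel,
which vanishes at infinity since `m ≥ 1`, leaving only its value on the shifted boundary graph. -/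
theorem IsSolidCone.integral_cylinder (hK : IsSolidCone K a e δ) (hm : 1 ≤ m)
    (T : (ℝ × (Fin m → ℝ)) ≃ᵐ E (m + 1)) (L : (Fin m → ℝ) →L[ℝ] E (m + 1))
    (hTL : ∀ p, T p = p.1 • e + L p.2) (hT : ∀ s y, |s| ≤ ‖s • e + L y‖)
    {g : (Fin m → ℝ) → ℝ} (hg : ∀ s y, s • e + L y ∈ K ↔ g y ≤ s) {τ : ℝ} (hτ : 1 ≤ τ) (R : ℝ) :
    IntegrableOn (fun y => halfSpaceKernel a ((g y + τ) • e + L y)) (ball 0 R) ∧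
    ∫ p in T ⁻¹' K ∩ Prod.snd ⁻¹' ball 0 R, halfSpaceKernelDeriv a e (T p + τ • e) =
      - ∫ y in ball 0 R, halfSpaceKernel a ((g y + τ) • e + L y) := by
  have hτ0 : 0 < τ := zero_lt_one.trans_le hτ
  have hint := hK.integrableOn_cylinder hm T (fun p => by rw [hTL]; exact hT _ _) hτ R
  have hmeas : MeasurableSet (T ⁻¹' K ∩ Prod.snd ⁻¹' ball (0 : Fin m → ℝ) R) :=
    (T.measurable hK.isClosed.measurableSet).inter (measurable_snd measurableSet_ball)
  rw [← integrable_indicator_iff hmeas] at hint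
  have hinner : ∀ y, ∫ s : ℝ, (T ⁻¹' K ∩ Prod.snd ⁻¹' ball (0 : Fin m → ℝ) R).indicator
      (fun p => halfSpaceKernelDeriv a e (T p + τ • e)) (s, y) =
      (ball (0 : Fin m → ℝ) R).indicator
        (fun y => - halfSpaceKernel a ((g y + τ) • e + L y)) y := by
    intro y
    by_cases hy : y ∈ ball (0 : Fin m → ℝ) R
    · have h1 : ∀ s : ℝ, (T ⁻¹' K ∩ Prod.snd ⁻¹' ball (0 : Fin m → ℝ) R).indicator
          (fun p => halfSpaceKernelDeriv a e (T p + τ • e)) (s, y) =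
          (Ici (g y)).indicator (fun s => halfSpaceKernelDeriv a e (s • e + L y + τ • e)) s := by
        intro s
        classical
        simp only [indicator_apply, mem_inter_iff, mem_preimage, hy, and_true, mem_Ici, hTL, hg]
      simp_rw [h1]
      rw [indicator_of_mem hy, integral_indicator measurableSet_Ici, integral_Ici_eq_integral_Ioi]
      have hmem : ∀ s ∈ Ici (g y), s • e + L y ∈ K := fun s hs => (hg s y).2 hs
      have hsum : ∀ s : ℝ, s • e + L y + τ • e = s • e + (L y + τ • e) := fun s => add_assoc _ _ _
      have hder : ∀ s ∈ Ici (g y), HasDerivAt (fun s : ℝ => halfSpaceKernel a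
          (s • e + (L y + τ • e))) (halfSpaceKernelDeriv a e (s • e + L y + τ • e)) s := by
        intro s hs
        have hne := hK.add_ne_zero (hmem s hs) hτ0
        have hd := ((contDiffAt_halfSpaceKernel a hne (k := 1)).differentiableAt
          (by simp)).hasFDerivAt
        rw [hsum] at hd
        have hc : HasDerivAt (fun s : ℝ => s • e + (L y + τ • e)) ((1 : ℝ) • e) s :=
          ((hasDerivAt_id s).smul_const e).add_const _
        have := hd.comp_hasDerivAt s hc
        rw [one_smul, ← hsum] at this
        exact this
      obtain ⟨C, hC0, hC⟩ := hK.exists_halfSpaceKernelDeriv_le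
      have h2 : Integrable (fun s : ℝ => C * (1 + ‖s‖) ^ (-((m + 1 : ℕ) : ℝ))) :=
        (integrable_one_add_norm (by simp; lia)).const_mul C
      have hi : IntegrableOn (fun s : ℝ => halfSpaceKernelDeriv a e (s • e + L y + τ • e))
          (Ioi (g y)) := by
        refine Integrable.mono' h2.integrableOn ?_ ?_
        · refine ContinuousOn.aestronglyMeasurable (fun s hs => ?_) measurableSet_Ioi
          exact ((hK.continuousOn_comp_add hτ0).comp (s := Ici (g y)) (by fun_prop)
            hmem).mono Ioi_subset_Ici_self s hs
        · refine (ae_restrict_iff' measurableSet_Ioi).2 (Eventually.of_forall fun s hs => ?_)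
          refine (hC _ (hmem s (Ioi_subset_Ici_self hs)) τ hτ).trans ?_
          gcongr C * ?_
          refine Real.rpow_le_rpow_of_nonpos (by positivity) ?_ (neg_nonpos.2 (Nat.cast_nonneg _))
          gcongr
          exact hT s y
      rw [integral_Ioi_of_hasDerivAt_of_tendsto' hder hi
        (tendsto_halfSpaceKernel_smul_add hm hK.norm_eq _), zero_sub]
      congr 2
      module
    · rw [indicator_of_notMem hy]
      have h1 : ∀ s : ℝ, (T ⁻¹' K ∩ Prod.snd ⁻¹' ball (0 : Fin m → ℝ) R).indicator
          (fun p => halfSpaceKernelDeriv a e (T p + τ • e)) (s, y) = 0 := fun s =>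
        indicator_of_notMem (fun h => hy h.2) _
      simp [h1]
  constructor
  · have := hint.integral_prod_right
    simp_rw [hinner] at this
    rw [integrable_indicator_iff measurableSet_ball] at this
    simpa using this.neg
  · rw [← integral_indicator hmeas, Measure.volume_eq_prod, integral_prod_symm _ hint]
    simp_rw [hinner]
    rw [integral_indicator measurableSet_ball, integral_neg]

theorem IsSolidCone.continuousOn_dipole (hK : IsSolidCone K a e δ) {t : ℝ} (ht : 0 < t) :
    ContinuousOn (dipole a e t) K :=
  (hK.continuousOn_comp_add ht).sub (hK.continuousOn_comp_add (by positivity))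

theorem IsSolidCone.integrableOn_dipole (hK : IsSolidCone K a e δ) {t : ℝ} (ht : 0 < t) :
    IntegrableOn (dipole a e t) K := by
  obtain ⟨C, hC0, hC⟩ := hK.exists_dipole_bound (Nat.succ_le_succ (Nat.zero_le m))
  have hl : 0 < min 1 t := lt_min one_pos ht
  have h1 : Integrable (fun x : E (m + 1) =>
      (C * t / min 1 t ^ (m + 1 + 1)) * (1 + ‖x‖) ^ (-((m + 1 + 1 : ℕ) : ℝ))) :=
    (integrable_one_add_norm (by simp)).const_mul _
  refine Integrable.mono' h1.integrableOn
    ((hK.continuousOn_dipole ht).aestronglyMeasurable hK.isClosed.measurableSet) ?_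
  refine (ae_restrict_iff' hK.isClosed.measurableSet).2 (Eventually.of_forall fun x hx => ?_)
  have h2 := hC x hx t ht
  rw [Real.rpow_neg (by positivity), Real.rpow_natCast, ← div_eq_mul_inv, div_div,
    le_div_iff₀ (by positivity), ← mul_pow]
  refine le_trans ?_ h2
  rw [Real.norm_eq_abs]
  gcongr
  have h3 := mul_le_mul_of_nonneg_right (min_le_left 1 t) (norm_nonneg x)
  have h4 := min_le_right 1 t
  linarith

/-- On a cylinder of radius `R` each of the two translates integrates to minus a boundary integral
of the Poisson kernel. By homogeneity the boundary integral with shift `2` over radius `R` is that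
with shift `1` over radius `R/2`, so the difference is minus an integral over the annulus between
`R/2` and `R`. There the positive kernel is of order `R⁻ᵐ` or larger and the volume is of order
`Rᵐ`: the bound survives `R → ∞`. -/
theorem IsSolidCone.integral_dipole_neg (hK : IsSolidCone K a e δ) (hm : 1 ≤ m) :
    ∫ x in K, dipole a e 1 x < 0 := by
  obtain ⟨T, L, hTm, hTL, hT⟩ := exists_cylindrical_coordinates e hK.norm_eq
  obtain ⟨g, C, hg, hg2, hC0, hC⟩ := hK.exists_height L
  set H : ℝ → (Fin m → ℝ) → ℝ := fun τ y => halfSpaceKernel a ((g y + τ) • e + L y) with hH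
  have hcyl := fun τ (hτ : (1 : ℝ) ≤ τ) R => hK.integral_cylinder hm T L hTL hT hg hτ R
  have hcylint := fun τ (hτ : (1 : ℝ) ≤ τ) R =>
    hK.integrableOn_cylinder hm T (fun p => by rw [hTL]; exact hT _ _) hτ R
  have hscale : ∀ y, (2 : ℝ) ^ m * H 2 ((2 : ℝ) • y) = H 1 y := by
    intro y
    have h1 := negHomogeneous_halfSpaceKernel (Nat.succ_le_succ (Nat.zero_le m)) a 2 two_pos
      ((g y + 1) • e + L y)
    rw [Nat.succ_sub_one, smul_eq_mul] at h1
    simp only [hH]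
    rw [← h1, hg2, map_smul]
    congr 2
    module
  -- The Poisson kernel has degree `-m` on an `m`-dimensional hyperplane, so dilation by `2`
  -- produces no factor.
  have hhalf : ∀ R, ∫ y in ball 0 R, H 2 y = ∫ y in ball 0 (R / 2), H 1 y := by
    intro R
    have h1 := Measure.setIntegral_comp_smul_of_pos volume (H 2) (ball (0 : Fin m → ℝ) (R / 2))
      two_pos
    rw [smul_ball two_ne_zero, smul_zero, Real.norm_of_nonneg two_pos.le,
      mul_div_cancel₀ R two_ne_zero] at h1
    simp_rw [← hscale]
    rw [integral_const_mul, h1]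
    simp
  set S : ℕ → Set (E (m + 1)) := fun R => K ∩ T.symm ⁻¹' (Prod.snd ⁻¹' ball 0 R) with hS
  have hJ : ∀ R : ℕ, ∫ x in S R, dipole a e 1 x =
      - ∫ y in ball 0 R \ ball 0 ((R : ℝ) / 2), H 1 y := by
    intro R
    have h1 : T ⁻¹' (S R) = T ⁻¹' K ∩ Prod.snd ⁻¹' ball 0 (R : ℝ) := by
      ext p
      simp [hS]
    rw [← hTm.setIntegral_preimage_emb T.measurableEmbedding, h1]
    simp only [dipole]
    rw [integral_sub (hcylint 1 le_rfl R) (hcylint (2 * 1) (by norm_num) R), (hcyl 1 le_rfl R).2,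
      (hcyl (2 * 1) (by norm_num) R).2, setIntegral_sdiff measurableSet_ball (hcyl 1 le_rfl R).1
        (ball_subset_ball (half_le_self (Nat.cast_nonneg R))), ← hhalf, mul_one]
    ring
  -- For `R ≥ 1`, points of the shifted graph over the ball of radius `R` have norm at most `M R`;
  -- the summand `1` absorbs the shift.
  set M := C + ‖L‖ + 1 with hM
  have hM0 : 0 < M := by positivity
  set v := volume.real (ball (0 : Fin m → ℝ) 1) with hv
  have hv0 : 0 < v := by
    rw [hv, measureReal_def]
    exact ENNReal.toReal_pos (measure_ball_pos _ _ one_pos).ne' measure_ball_lt_top.ne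
  have hlow : ∀ R : ℕ, 1 ≤ R →
      δ / M ^ m * (v / 2) ≤ ∫ y in ball 0 R \ ball 0 ((R : ℝ) / 2), H 1 y := by
    intro R hR
    have hR0 : (1 : ℝ) ≤ R := by exact_mod_cast hR
    have hball : ∀ r : ℝ, 0 ≤ r → volume.real (ball (0 : Fin m → ℝ) r) = r ^ m * v := by
      intro r hr
      have : Nonempty (Fin m) := ⟨⟨0, by lia⟩⟩
      rw [hv, measureReal_def, measureReal_def, Measure.addHaar_ball _ _ hr]
      simp [ENNReal.toReal_mul, hr]
    have hvol : volume.real (ball (0 : Fin m → ℝ) R \ ball 0 ((R : ℝ) / 2)) =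
        R ^ m * v - (R / 2) ^ m * v := by
      rw [measureReal_sdiff (ball_subset_ball (half_le_self (by positivity))) measurableSet_ball
        measure_ball_lt_top.ne, hball _ (by positivity), hball _ (by positivity)]
    have hpt : ∀ y ∈ ball (0 : Fin m → ℝ) R \ ball 0 ((R : ℝ) / 2),
        δ / (M * R) ^ m ≤ H 1 y := by
      intro y hy
      have hyR : ‖y‖ ≤ R := by simpa using (mem_ball.1 hy.1).le
      have hmem : g y • e + L y ∈ K := (hg _ _).2 le_rfl
      have hxe : (g y + 1) • e + L y = g y • e + L y + (1 : ℝ) • e := by module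
      have hne := hK.add_ne_zero hmem one_pos
      have h1 := hK.le_halfSpaceKernel (hK.add_smul_mem hmem zero_le_one) hne
      rw [← hxe] at h1 hne
      refine le_trans ?_ h1
      have hpos := hK.pos
      have hnpos := norm_pos_iff.2 hne
      have hnorm : ‖(g y + 1) • e + L y‖ ≤ M * R := by
        calc ‖(g y + 1) • e + L y‖ ≤ ‖(g y + 1) • e‖ + ‖L y‖ := norm_add_le _ _
          _ ≤ (C * R + 1) + ‖L‖ * R := by
            rw [norm_smul, hK.norm_eq, mul_one, Real.norm_eq_abs]
            gcongr
            · refine (abs_add_le _ _).trans ?_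
              rw [abs_one]
              gcongr
              exact (hC y).trans (by gcongr)
            · exact (L.le_opNorm y).trans (by gcongr)
          _ ≤ M * R := by rw [hM]; nlinarith
      gcongr
    have h2 := setIntegral_ge_of_const_le_real
      (measurableSet_ball.diff measurableSet_ball) (measure_ne_top_of_subset sdiff_subset
        measure_ball_lt_top.ne) hpt ((hcyl 1 le_rfl R).1.mono_set sdiff_subset)
    refine le_trans ?_ h2
    rw [hvol]
    have hpos := hK.pos
    have h3 : ((R : ℝ) / 2) ^ m ≤ R ^ m / 2 := by
      rw [div_pow]
      gcongr
      exact le_self_pow₀ one_le_two (by lia)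
    calc δ / M ^ m * (v / 2) = δ / (M * R) ^ m * (R ^ m * v - R ^ m / 2 * v) := by
          rw [mul_pow]
          have : (R : ℝ) ^ m ≠ 0 := by positivity
          field_simp
          ring
      _ ≤ _ := by gcongr
  have hlim : Tendsto (fun R : ℕ => ∫ x in S R, dipole a e 1 x) atTop
      (𝓝 (∫ x in ⋃ R, S R, dipole a e 1 x)) := by
    refine tendsto_setIntegral_of_monotone (fun R => ?_) (fun R R' h x hx => ⟨hx.1, ?_⟩) ?_
    · exact hK.isClosed.measurableSet.inter
        (T.symm.measurable (measurable_snd measurableSet_ball))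
    · exact ball_subset_ball (Nat.cast_le.2 h) hx.2
    · exact (hK.integrableOn_dipole one_pos).mono_set (iUnion_subset fun R => inter_subset_left)
  have hU : ⋃ R, S R = K := by
    rw [hS, ← inter_iUnion, ← preimage_iUnion, ← preimage_iUnion, iUnion_ball_nat]
    simp
  rw [hU] at hlim
  have hpos := hK.pos
  refine (le_of_tendsto hlim ((eventually_ge_atTop 1).mono fun R hR => ?_)).trans_lt
    (neg_neg_of_pos (by positivity : 0 < δ / M ^ m * (v / 2)))
  rw [hJ]
  exact neg_le_neg (hlow R hR)

end DipoleIntegral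

/-! ### Vanishing of the source at the apex -/

section CornerValue

open Filter Topology
open scoped Pointwise

variable {m : ℕ} {K : Set (E (m + 1))} {a e : E (m + 1)} {δ : ℝ}

theorem IsSolidCone.inner_pos (hK : IsSolidCone K a e δ) : 0 < inner ℝ a e := by
  have h := hK.le_inner e (interior_subset hK.mem_interior)
  rw [hK.norm_eq, mul_one] at h
  exact hK.pos.trans_le h

/-- Both poles lie strictly on the negative side of the hyperplane `⟪a, x⟫ = 0`, so a transition
function of `⟪a, x⟫` removes them without touching a neighbourhood of the cone. -/
theorem IsSolidCone.exists_smooth_dipole (hK : IsSolidCone K a e δ) {t : ℝ} (ht : 0 < t) :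
    ∃ Θ : E (m + 1) → ℂ, ContDiff ℝ ∞ Θ ∧
      ∀ x ∈ K, Θ =ᶠ[𝓝 x] fun y => ((dipole a e t y : ℝ) : ℂ) := by
  have hα := hK.inner_pos
  set α := inner ℝ a e with hαdef
  -- On the cone `σ ≥ 2`, where the transition equals `1`; at the poles `-t e` and `-2t e` its
  -- values are `-1` and `-4`, where the transition is `0`.
  set σ : E (m + 1) → ℝ := fun x => 2 + 3 * (inner ℝ a x / (t * α)) with hσ
  have hσc : ContDiff ℝ ∞ σ := by
    have : ContDiff ℝ ∞ fun x : E (m + 1) => inner ℝ a x := contDiff_const.inner ℝ contDiff_id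
    fun_prop
  refine ⟨fun x => ((Real.smoothTransition (σ x) : ℝ) : ℂ) * ((dipole a e t x : ℝ) : ℂ), ?_, ?_⟩
  · refine contDiff_iff_contDiffAt.2 fun x => ?_
    by_cases hx : σ x < 0
    · refine (contDiffAt_const (c := (0 : ℂ))).congr_of_eventuallyEq ?_
      filter_upwards [hσc.continuous.continuousAt.eventually_lt continuousAt_const hx] with y hy
      rw [Real.smoothTransition.zero_of_nonpos hy.le, Complex.ofReal_zero, zero_mul]
    · have hne : ∀ s : ℝ, t ≤ s → x + s • e ≠ 0 := by
        intro s hs h0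
        apply hx
        have h1 : inner ℝ a x = -(s * α) := by
          rw [eq_neg_of_add_eq_zero_left h0, inner_neg_right, inner_smul_right]
        have h2 : s * α / (t * α) = s / t := by field_simp
        have h3 : 1 ≤ s / t := (one_le_div ht).2 hs
        simp only [hσ]
        rw [h1, neg_div, h2]
        linarith
      refine ContDiffAt.mul ?_ (contDiffAt_dipole a e (hne t le_rfl) (hne _ (by linarith)))
      exact (Complex.ofRealCLM.contDiff.comp (Real.smoothTransition.contDiff.comp hσc)).contDiffAt
  · intro x hx
    have h0 : 0 ≤ inner ℝ a x := by
      have := hK.pos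
      exact (by positivity : (0 : ℝ) ≤ _).trans (hK.le_inner x hx)
    have h1 : 1 < σ x := by
      have : 0 ≤ inner ℝ a x / (t * α) := by positivity
      simp only [hσ]
      linarith
    filter_upwards [continuousAt_const.eventually_lt hσc.continuous.continuousAt h1] with y hy
    rw [Real.smoothTransition.one_of_one_le hy.le, Complex.ofReal_one, one_mul]

/-- The dipole is harmonic near the cone, so the Laplacian of its cutoff there consists of terms
with derivatives of `η`. These live at `‖x‖ ≥ h/2`, where the dipole and its gradient are `O(t)`.
The constant does not depend on `t`. -/
theorem IsSolidCone.exists_isTestFun_dipole (hK : IsSolidCone K a e δ) {h : ℝ} (hh : 0 < h) :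
    ∃ C, 0 ≤ C ∧ ∀ t : ℝ, 0 < t → ∃ θ : E (m + 1) → ℂ, IsTestFun (ball 0 h) θ ∧
      (∀ x ∈ K, ‖x‖ ≤ h / 2 → θ x = ((dipole a e t x : ℝ) : ℂ)) ∧
      (∀ x ∈ K, ‖θ x‖ ≤ C * |dipole a e t x|) ∧ ∀ x ∈ K, ‖lap θ x‖ ≤ C * t := by
  obtain ⟨η, hη, hη1⟩ := exists_cutoff (0 : E (m + 1)) (half_pos hh) (half_lt_self hh)
  obtain ⟨B0, hB0⟩ := hη.compact.exists_bound_of_continuous hη.smooth.continuous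
  obtain ⟨B2, hB2⟩ := hη.lap.compact.exists_bound_of_continuous hη.lap.smooth.continuous
  choose B1 hB1 using fun i =>
    (hη.pderiv i).compact.exists_bound_of_continuous (hη.pderiv i).smooth.continuous
  obtain ⟨C1, hC10, hC1⟩ := hK.exists_dipole_bound (Nat.succ_le_succ (Nat.zero_le m))
  obtain ⟨C2, hC20, hC2⟩ := hK.exists_pderiv_dipole_bound (Nat.succ_le_succ (Nat.zero_le m))
  have hB1n : ∀ i, 0 ≤ B1 i := fun i => (norm_nonneg _).trans (hB1 i 0)
  have hB0n : 0 ≤ B0 := (norm_nonneg _).trans (hB0 0)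
  have hB2n : 0 ≤ B2 := (norm_nonneg _).trans (hB2 0)
  set C' := 2 * ∑ i, C2 / (h / 2) ^ (m + 1 + 2) * B1 i + C1 / (h / 2) ^ (m + 1 + 1) * B2 with hC'
  have hC'0 : 0 ≤ C' := by
    have : 0 ≤ ∑ i, C2 / (h / 2) ^ (m + 1 + 2) * B1 i :=
      Finset.sum_nonneg fun i _ => mul_nonneg (by positivity) (hB1n i)
    positivity
  refine ⟨max B0 C', by positivity, fun t ht => ?_⟩
  obtain ⟨Θ, hΘ, hΘe⟩ := hK.exists_smooth_dipole ht
  refine ⟨fun x => Θ x * η x, hη.mul_left hΘ, fun x hx hxh => ?_, fun x hx => ?_, fun x hx => ?_⟩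
  · simp only
    rw [(hΘe x hx).eq_of_nhds, hη1 x (by simpa using hxh), mul_one]
  · simp only
    rw [(hΘe x hx).eq_of_nhds, norm_mul, Complex.norm_real, mul_comm, Real.norm_eq_abs]
    gcongr
    exact (hB0 x).trans (le_max_left _ _)
  · refine le_trans ?_ (mul_le_mul_of_nonneg_right (le_max_right B0 C') ht.le)
    rw [lap_mul (hΘ.of_le (WithTop.coe_le_coe.2 le_top)).contDiffAt
      (hη.smooth.of_le (WithTop.coe_le_coe.2 le_top)).contDiffAt, (lap_congr (hΘe x hx)).eq_of_nhds,
      lap_dipole a e (hK.add_ne_zero hx ht) (hK.add_ne_zero hx (by positivity)), zero_mul, zero_add]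
    by_cases hxh : ‖x‖ < h / 2
    · have h1 : η =ᶠ[𝓝 x] fun _ => 1 := by
        filter_upwards [isOpen_ball.mem_nhds (show x ∈ ball 0 (h / 2) by simpa using hxh)] with y hy
        exact hη1 y (ball_subset_closedBall hy)
      have h2 : ∀ i, pderiv i η x = 0 := fun i => by
        rw [(pderiv_congr h1).eq_of_nhds]
        simp [pderiv]
      have h3 : lap η x = 0 := by
        rw [(lap_congr h1).eq_of_nhds]
        have : ∀ i : Fin (m + 1), pderiv i (fun _ => (1 : ℂ)) = fun _ => 0 := fun i => by
          ext y
          simp [pderiv]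
        simp [lap, this, pderiv]
      simp only [h2, h3, mul_zero, Finset.sum_const_zero, add_zero, norm_zero]
      positivity
    · have hle : h / 2 ≤ ‖x‖ + t := by linarith
      have h1 : ‖Θ x‖ ≤ C1 * t / (h / 2) ^ (m + 1 + 1) := by
        rw [(hΘe x hx).eq_of_nhds, le_div_iff₀ (by positivity), Complex.norm_real]
        refine le_trans ?_ (hC1 x hx t ht)
        rw [Real.norm_eq_abs]
        gcongr
      have h2 : ∀ i, ‖pderiv i Θ x‖ ≤ C2 * t / (h / 2) ^ (m + 1 + 2) := fun i => by
        rw [(pderiv_congr (hΘe x hx)).eq_of_nhds, le_div_iff₀ (by positivity)]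
        refine le_trans ?_ (hC2 x hx t ht i)
        gcongr
      calc _ ≤ ‖2 * ∑ i, pderiv i Θ x * pderiv i η x‖ + ‖Θ x * lap η x‖ := norm_add_le _ _
        _ ≤ 2 * ∑ i, C2 * t / (h / 2) ^ (m + 1 + 2) * B1 i +
            C1 * t / (h / 2) ^ (m + 1 + 1) * B2 := by
          rw [norm_mul, norm_mul, Complex.norm_ofNat]
          gcongr
          · refine (norm_sum_le _ _).trans (Finset.sum_le_sum fun i _ => ?_)
            rw [norm_mul]
            exact mul_le_mul (h2 i) (hB1 i x) (norm_nonneg _) (by positivity)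
          · exact hB2 x
        _ = C' * t := by
          rw [hC', add_mul, mul_assoc 2, Finset.sum_mul]
          have h3 : ∀ i, C2 * t / (h / 2) ^ (m + 1 + 2) * B1 i =
              C2 / (h / 2) ^ (m + 1 + 2) * B1 i * t := fun i => by ring
          simp_rw [h3]
          ring

theorem setIntegral_dipole_smul (G : ℝ → ℝ) (hG : ∀ s t : ℝ, 0 < s → G (s * t) = s * G t)
    (a e : E (m + 1)) {t : ℝ} (ht : 0 < t) (S : Set (E (m + 1))) :
    ∫ x in t • S, G (dipole a e t x) = ∫ x in S, G (dipole a e 1 x) := by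
  have h1 := Measure.setIntegral_comp_smul_of_pos volume (fun x => G (dipole a e t x)) S ht
  have h2 : ∀ x, G (dipole a e 1 x) = t ^ (m + 1) * G (dipole a e t (t • x)) := fun x => by
    rw [← dipole_smul (Nat.succ_le_succ (Nat.zero_le m)) a e ht x, hG _ _ (by positivity)]
  simp_rw [h2]
  rw [integral_const_mul, h1]
  simp [ht.ne']

theorem IsSolidCone.smul_eq (hK : IsSolidCone K a e δ) {t : ℝ} (ht : 0 < t) : t • K = K := by
  refine Subset.antisymm ?_ fun x hx => ?_
  · rintro _ ⟨x, hx, rfl⟩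
    exact hK.smul_mem x hx t ht.le
  · exact ⟨t⁻¹ • x, hK.smul_mem x hx _ (by positivity), by simp [ht.ne']⟩

theorem IsSolidCone.setIntegral_dipole_ball (hK : IsSolidCone K a e δ) {t : ℝ} (ht : 0 < t)
    (ρ : ℝ) :
    ∫ x in K ∩ ball 0 ρ, dipole a e t x = ∫ x in K ∩ ball 0 (ρ / t), dipole a e 1 x := by
  have h := setIntegral_dipole_smul id (fun _ _ _ => rfl) a e ht (K ∩ ball 0 (ρ / t))
  rw [ smul_set_inter₀ ht.ne', hK.smul_eq ht,
    _root_.smul_ball ht.ne', smul_zero, Real.norm_of_nonneg ht.le, mul_div_cancel₀ _ ht.ne'] at h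
  exact h

theorem IsSolidCone.setIntegral_abs_dipole (hK : IsSolidCone K a e δ) {t : ℝ} (ht : 0 < t) :
    ∫ x in K, |dipole a e t x| = ∫ x in K, |dipole a e 1 x| := by
  conv_lhs => rw [← hK.smul_eq ht]
  exact setIntegral_dipole_smul (fun s => |s|) (fun s t hs => by rw [abs_mul, abs_of_pos hs])
    a e ht K

/-- Testing with the cut off dipole gives `∫ W Δθ = O(t)`, since `W` is integrable and supported in
the cone. On the other side, replacing `F` by `c` near the apex costs at most `ε` times the scale
invariant `L¹` norm, the far part is `O(t)`, and the main term tends to `c J` with `J < 0`. Only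
continuity of `F` at the apex enters, not a rate. -/
theorem IsSolidCone.eq_zero_of_hasDistribLaplacian (hK : IsSolidCone K a e δ) (hm : 1 ≤ m)
    {h : ℝ} (hh : 0 < h) {W F : E (m + 1) → ℂ} (hW : IntegrableOn W (ball 0 h))
    (hF : IntegrableOn F (ball 0 h)) (hlap : HasDistribLaplacian (ball 0 h) W F)
    (hW0 : ∀ᵐ x, x ∈ ball 0 h → x ∉ K → W x = 0) (hF0 : ∀ᵐ x, x ∈ ball 0 h → x ∉ K → F x = 0)
    {c : ℂ} (hc : ∀ ε > 0, ∃ ρ > 0, ∀ᵐ x, x ∈ ball (0 : E (m + 1)) ρ → x ∈ K → ‖F x - c‖ ≤ ε) :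
    c = 0 := by
  obtain ⟨C, hC0, hC⟩ := hK.exists_isTestFun_dipole hh
  obtain ⟨C1, hC10, hC1⟩ := hK.exists_dipole_bound (Nat.succ_le_succ (Nat.zero_le m))
  set A := ∫ x in K, |dipole a e 1 x| with hA
  set J := ∫ x in K, dipole a e 1 x with hJ
  have hJ0 : J < 0 := hK.integral_dipole_neg hm
  have hKm : MeasurableSet K := hK.isClosed.measurableSet
  have key : ∀ ε > 0, ‖c‖ * |J| ≤ ε * A := by
    intro ε hε
    obtain ⟨ρ', hρ', hρF⟩ := hc ε hε
    set ρ := min ρ' (h / 2) with hρdef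
    have hρ : 0 < ρ := lt_min hρ' (half_pos hh)
    set M := C * ∫ x in ball 0 h, ‖W x‖ with hM
    set M' := C * C1 / ρ ^ (m + 1 + 1) * ∫ x in ball 0 h, ‖F x‖ with hM'
    -- By scaling, the dipole with parameter `t` on the ball of radius `ρ` becomes the fixed dipole
    -- on radius `ρ / t`, which exhausts the cone as `t → 0`.
    have hstep : ∀ t : ℝ, 0 < t →
        ‖c‖ * |∫ x in K ∩ ball 0 (ρ / t), dipole a e 1 x| ≤ ε * A + (M + M') * t := by
      intro t ht
      obtain ⟨θ, hθ, hθ1, hθ2, hθ3⟩ := hC t ht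
      have hWle : ‖∫ x, W x * lap θ x‖ ≤ M * t := by
        have hi : Integrable (fun x => C * t * (ball 0 h).indicator (fun x => ‖W x‖) x) :=
          ((integrable_indicator_iff measurableSet_ball).2 hW.norm).const_mul _
        refine (norm_integral_le_of_norm_le hi ?_).trans_eq ?_
        · filter_upwards [hW0] with x hx
          by_cases hxb : x ∈ ball 0 h
          · rw [indicator_of_mem hxb, norm_mul, mul_comm]
            by_cases hxK : x ∈ K
            · gcongr
              exact hθ3 x hxK
            · simp [hx hxb hxK]
          · rw [indicator_of_notMem hxb, hθ.lap.zero_of_notMem hxb]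
            simp
        · rw [integral_const_mul, integral_indicator measurableSet_ball, hM]
          ring
      rw [hlap θ hθ] at hWle
      have hFθ : Integrable (fun x => F x * θ x) := by
        obtain ⟨B, hB⟩ := hθ.compact.exists_bound_of_continuous hθ.smooth.continuous
        have h1 := ((integrable_indicator_iff measurableSet_ball).2 hF).mul_bdd (c := B)
          hθ.smooth.continuous.aestronglyMeasurable (Eventually.of_forall hB)
        refine h1.congr (Eventually.of_forall fun x => ?_)
        by_cases hxb : x ∈ ball 0 h
        · simp [indicator_of_mem hxb]
        · simp [hθ.zero_of_notMem hxb]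
      have hdip :
          Integrable ((K ∩ ball 0 ρ).indicator fun x => c * ((dipole a e t x : ℝ) : ℂ)) := by
        rw [integrable_indicator_iff (hKm.inter measurableSet_ball)]
        exact (((hK.integrableOn_dipole ht).mono_set inter_subset_left).ofReal).const_mul c
      -- Inside radius `ρ` the integrand is `(F - c)` times the dipole; in the rest of the cone the
      -- decay bound gives at most `C * C1 * t / ρ^(m+2)` times `‖F‖`; off the cone it is zero.
      have hdiff : ‖∫ x, (F x * θ x -
          (K ∩ ball 0 ρ).indicator (fun x => c * ((dipole a e t x : ℝ) : ℂ)) x)‖ ≤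
          ε * A + M' * t := by
        have hi1 : Integrable (fun x => ε * K.indicator (fun x => |dipole a e t x|) x) :=
          ((integrable_indicator_iff hKm).2 (hK.integrableOn_dipole ht).abs).const_mul _
        have hi2 : Integrable (fun x => C * C1 / ρ ^ (m + 1 + 1) * t *
            (ball 0 h).indicator (fun x => ‖F x‖) x) :=
          ((integrable_indicator_iff measurableSet_ball).2 hF.norm).const_mul _
        refine (norm_integral_le_of_norm_le (hi1.add hi2) ?_).trans_eq ?_
        · filter_upwards [hF0, hρF] with x hx0 hxρ
          have hp1 : 0 ≤ ε * K.indicator (fun x => |dipole a e t x|) x :=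
            mul_nonneg hε.le (indicator_nonneg (fun _ _ => abs_nonneg _) _)
          have hp2 : 0 ≤ C * C1 / ρ ^ (m + 1 + 1) * t * (ball 0 h).indicator (fun x => ‖F x‖) x :=
            mul_nonneg (by positivity) (indicator_nonneg (fun _ _ => norm_nonneg _) _)
          simp only [Pi.add_apply]
          by_cases hxK : x ∈ K
          · by_cases hxr : x ∈ ball 0 ρ
            · have hnx : ‖x‖ < ρ := by simpa using hxr
              rw [indicator_of_mem (show x ∈ K ∩ ball 0 ρ from ⟨hxK, hxr⟩),
                hθ1 x hxK (hnx.le.trans (min_le_right _ _)), ← sub_mul, norm_mul]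
              refine le_add_of_le_of_nonneg ?_ hp2
              rw [indicator_of_mem hxK, Complex.norm_real, Real.norm_eq_abs]
              gcongr
              exact hxρ (ball_subset_ball (min_le_left _ _) hxr) hxK
            · have hnx : ρ ≤ ‖x‖ := by simpa using hxr
              rw [indicator_of_notMem (fun h => hxr h.2), sub_zero]
              refine le_add_of_nonneg_of_le hp1 ?_
              by_cases hxb : x ∈ ball 0 h
              · rw [indicator_of_mem hxb, norm_mul, mul_comm]
                gcongr
                refine (hθ2 x hxK).trans ?_
                rw [mul_div_assoc, mul_assoc]
                gcongr
                rw [div_mul_eq_mul_div, le_div_iff₀ (by positivity)]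
                refine le_trans ?_ (hC1 x hxK t ht)
                gcongr
                linarith
              · rw [hθ.zero_of_notMem hxb, mul_zero, norm_zero]
                exact hp2
          · rw [indicator_of_notMem (fun h => hxK h.1), sub_zero]
            by_cases hxb : x ∈ ball 0 h
            · rw [hx0 hxb hxK, zero_mul, norm_zero]
              positivity
            · rw [hθ.zero_of_notMem hxb, mul_zero, norm_zero]
              positivity
        · simp only [Pi.add_apply]
          rw [integral_add hi1 hi2, integral_const_mul, integral_const_mul,
            integral_indicator measurableSet_ball, integral_indicator hKm,
            hK.setIntegral_abs_dipole ht, hM']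
          ring
      rw [integral_sub hFθ hdip, integral_indicator (hKm.inter measurableSet_ball),
        integral_const_mul, integral_complex_ofReal, hK.setIntegral_dipole_ball ht] at hdiff
      set j := ∫ x in K ∩ ball 0 (ρ / t), dipole a e 1 x with hj
      calc ‖c‖ * |j| = ‖c * (j : ℂ)‖ := by rw [norm_mul, Complex.norm_real, Real.norm_eq_abs]
        _ = ‖(∫ x, F x * θ x) - ((∫ x, F x * θ x) - c * (j : ℂ))‖ := by rw [sub_sub_cancel]
        _ ≤ M * t + (ε * A + M' * t) := (norm_sub_le _ _).trans (add_le_add hWle hdiff)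
        _ = _ := by ring
    have hlim : Tendsto (fun k : ℕ => ∫ x in K ∩ ball 0 (ρ / (1 / ((k : ℝ) + 1))), dipole a e 1 x)
        atTop (𝓝 (∫ x in ⋃ k : ℕ, K ∩ ball 0 (ρ / (1 / ((k : ℝ) + 1))), dipole a e 1 x)) := by
      refine tendsto_setIntegral_of_monotone (fun k => hKm.inter measurableSet_ball)
        (fun k l hkl => inter_subset_inter_right _ (ball_subset_ball ?_))
        ((hK.integrableOn_dipole one_pos).mono_set (iUnion_subset fun R => inter_subset_left))
      gcongr
    have hU : ⋃ k : ℕ, K ∩ ball 0 (ρ / (1 / ((k : ℝ) + 1))) = K := by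
      refine Subset.antisymm (iUnion_subset fun k => inter_subset_left) fun x hx => ?_
      obtain ⟨k, hk⟩ := exists_nat_gt (‖x‖ / ρ)
      refine mem_iUnion.2 ⟨k, hx, ?_⟩
      rw [mem_ball_zero_iff, div_div_eq_mul_div, div_one]
      rw [div_lt_iff₀ hρ] at hk
      nlinarith
    rw [hU] at hlim
    have h0 : Tendsto (fun k : ℕ => (1 / ((k : ℝ) + 1))) atTop (𝓝 0) :=
      tendsto_one_div_add_atTop_nhds_zero_nat
    refine le_of_tendsto_of_tendsto' (hlim.abs.const_mul ‖c‖)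
      (b := atTop) (g := fun k : ℕ => ε * A + (M + M') * (1 / ((k : ℝ) + 1))) ?_
      fun k => hstep _ (by positivity)
    simpa using (h0.const_mul (M + M')).const_add (ε * A)
  have hA0 : 0 ≤ A := integral_nonneg fun _ => abs_nonneg _
  have h2 : ‖c‖ * |J| ≤ 0 := by
    refine le_of_forall_pos_le_add fun ε hε => ?_
    refine (key (ε / (A + 1)) (by positivity)).trans ?_
    rw [zero_add, div_mul_eq_mul_div, div_le_iff₀ (by positivity)]
    nlinarith
  have h3 : 0 < |J| := abs_pos.2 hJ0.ne
  by_contra hc0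
  have := mul_pos (norm_pos_iff.2 hc0) h3
  linarith

end CornerValue

/-! ### Corners as solid cones -/

section CornerCones

open Filter Topology

variable {n : ℕ}

/-- The linear bound and the cone properties pass to the closure. The axis `e` is any nonzero
interior point, normalized; it need not be related to `a`. -/
theorem exists_isSolidCone_closure {K : Set (E n)} {a : E n} {δ : ℝ} (ha : a ≠ 0)
    (hconv : Convex ℝ K) (hsmul : ∀ x ∈ K, ∀ t : ℝ, 0 ≤ t → t • x ∈ K) (hδ : 0 < δ)
    (hle : ∀ x ∈ K, δ * ‖x‖ ≤ inner ℝ a x) (hint : (interior K).Nonempty) :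
    ∃ e, IsSolidCone (closure K) a e δ := by
  have : Nontrivial (E n) := nontrivial_of_ne a 0 ha
  obtain ⟨p, hp, hp0⟩ := (dense_compl_singleton (0 : E n)).inter_open_nonempty _
    isOpen_interior hint
  have hp0 : p ≠ 0 := hp0
  have hpn : 0 < ‖p‖ := norm_pos_iff.2 hp0
  refine ⟨‖p‖⁻¹ • p, isClosed_closure, hconv.closure, fun x hx t ht => ?_, ?_, ?_, hδ, ?_⟩
  · exact map_mem_closure (continuous_const_smul t) hx fun y hy => hsmul y hy t ht
  · have h1 : (fun x => ‖p‖⁻¹ • x) '' interior K ⊆ interior K := by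
      refine interior_maximal ?_ (isOpenMap_smul₀ (inv_ne_zero hpn.ne') _ isOpen_interior)
      rintro _ ⟨x, hx, rfl⟩
      exact hsmul x (interior_subset hx) _ (by positivity)
    exact interior_mono subset_closure (h1 ⟨p, hp, rfl⟩)
  · rw [norm_smul, norm_inv, norm_norm, inv_mul_cancel₀ hpn.ne']
  · refine closure_minimal hle (isClosed_le (continuous_const.mul continuous_norm) ?_)
    exact continuous_const.inner continuous_id

theorem mem_conicCone_zero {v : E n} (hv : v ≠ 0) {θ : ℝ} (hθ : θ ∈ Ioo 0 (Real.pi / 2))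
    {y : E n} : y ∈ conicCone 0 v θ ↔ Real.cos θ * ‖v‖ * ‖y‖ ≤ inner ℝ v y := by
  by_cases hy : y = 0
  · simp [conicCone, hy]
  have hv' := norm_pos_iff.2 hv
  have hy' := norm_pos_iff.2 hy
  simp only [conicCone, mem_ofPred_eq, hy, false_or, sub_zero]
  rw [← Real.strictAntiOn_cos.le_iff_ge ⟨hθ.1.le, by linarith [hθ.2, Real.pi_pos]⟩
    ⟨InnerProductGeometry.angle_nonneg _ _, InnerProductGeometry.angle_le_pi _ _⟩,
    InnerProductGeometry.cos_angle, le_div_iff₀ (by positivity), real_inner_comm, mul_assoc,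
    mul_comm ‖y‖]

/-- The cones that define corners are, up to their boundary, solid cones. -/
theorem exists_isSolidCone_of_corner {x₀ : E n} {K : Set (E n)}
    (hK : IsConicCorner x₀ K ∨ IsPolyhedralCorner x₀ K) :
    ∃ C a e δ, IsSolidCone C a e δ ∧ ∀ x, x ∈ interior K ↔ x - x₀ ∈ interior C := by
  set K₀ : Set (E n) := (fun y => y + x₀) ⁻¹' K with hK₀
  have htrans : ∀ x, x ∈ interior K ↔ x - x₀ ∈ interior K₀ := by
    intro x
    have := (Homeomorph.addRight x₀).preimage_interior K
    change _ = interior K₀ at this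
    rw [← this]
    simp
  have hconic : ∀ v θ, (fun y => y + x₀) ⁻¹' (conicCone x₀ v θ) = conicCone 0 v θ := by
    intro v θ
    ext y
    simp [conicCone]
  suffices h : ∃ v : E n, v ≠ 0 ∧ ∃ θ ∈ Ioo (0 : ℝ) (Real.pi / 2), K₀ ⊆ conicCone 0 v θ ∧
      Convex ℝ K₀ ∧ (∀ x ∈ K₀, ∀ t : ℝ, 0 ≤ t → t • x ∈ K₀) ∧ (interior K₀).Nonempty by
    obtain ⟨v, hv, θ, hθ, hsub, hconv, hsmul, hint⟩ := h
    have hcos : 0 < Real.cos θ :=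
      Real.cos_pos_of_mem_Ioo ⟨by linarith [hθ.1, Real.pi_pos], hθ.2⟩
    obtain ⟨e, he⟩ := exists_isSolidCone_closure hv hconv hsmul
      (mul_pos hcos (norm_pos_iff.2 hv)) (fun x hx => (mem_conicCone_zero hv hθ).1 (hsub hx)) hint
    refine ⟨_, _, _, _, he, fun x => ?_⟩
    -- Taking the closure of a convex set with interior points does not change its interior, so the
    -- open cone is the same and closedness of `K` need not be known.
    rw [hconv.interior_closure_eq_interior_of_nonempty_interior hint, htrans]
  rcases hK with ⟨v, hv, θ, hθ, rfl⟩ | ⟨-, ℓ, b, -, -, hspan, rfl, v, hv, θ, hθ, hsub⟩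
  · rw [hK₀, hconic]
    have hcos : 0 < Real.cos θ :=
      Real.cos_pos_of_mem_Ioo ⟨by linarith [hθ.1, Real.pi_pos], hθ.2⟩
    have hv' := norm_pos_iff.2 hv
    refine ⟨v, hv, θ, hθ, Subset.rfl, ?_, ?_, v, ?_⟩
    · intro x hx y hy s t hs ht hst
      rw [mem_conicCone_zero hv hθ] at *
      rw [inner_add_right, inner_smul_right, inner_smul_right]
      have h1 : ‖s • x + t • y‖ ≤ s * ‖x‖ + t * ‖y‖ := by
        refine (norm_add_le _ _).trans_eq ?_
        rw [norm_smul, norm_smul, Real.norm_of_nonneg hs, Real.norm_of_nonneg ht]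
      have h2 : 0 < Real.cos θ * ‖v‖ := by positivity
      have h3 := mul_le_mul_of_nonneg_left h1 h2.le
      have h4 := mul_le_mul_of_nonneg_left hx hs
      have h5 := mul_le_mul_of_nonneg_left hy ht
      linarith
    · intro x hx t ht
      rw [mem_conicCone_zero hv hθ] at *
      rw [inner_smul_right, norm_smul, Real.norm_of_nonneg ht]
      have h4 := mul_le_mul_of_nonneg_left hx ht
      linarith
    · have hopen : IsOpen {y : E n | Real.cos θ * ‖v‖ * ‖y‖ < inner ℝ v y} :=
        isOpen_lt (by fun_prop) (continuous_const.inner continuous_id)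
      have hsub : {y : E n | Real.cos θ * ‖v‖ * ‖y‖ < inner ℝ v y} ⊆ conicCone 0 v θ :=
        fun y hy => (mem_conicCone_zero hv hθ).2 (le_of_lt hy)
      refine interior_maximal hsub hopen ?_
      have h1 : Real.cos θ < 1 := by
        rw [← Real.cos_zero]
        exact Real.cos_lt_cos_of_nonneg_of_le_pi le_rfl (by linarith [hθ.2, Real.pi_pos]) hθ.1
      rw [mem_ofPred_eq, real_inner_self_eq_norm_sq]
      have := mul_lt_mul_of_pos_right h1 (mul_pos hv' hv')
      linarith
  · have hmem : ∀ y, y ∈ K₀ ↔ ∃ c : Fin ℓ → ℝ, (∀ i, 0 ≤ c i) ∧ y = ∑ i, c i • b i := by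
      intro y
      simp only [hK₀, polyhedralCone, mem_preimage, mem_ofPred_eq]
      simp only [add_comm y x₀, add_right_inj]
    refine ⟨v, hv, θ, hθ, ?_, ?_, ?_, ?_⟩
    · rw [← hconic]
      exact preimage_mono hsub
    · intro x hx y hy s t hs ht hst
      obtain ⟨c, hc, rfl⟩ := (hmem x).1 hx
      obtain ⟨d, hd, rfl⟩ := (hmem y).1 hy
      refine (hmem _).2 ⟨fun i => s * c i + t * d i, fun i => ?_, ?_⟩
      · have := hc i
        have := hd i
        positivity
      · simp [add_smul, Finset.sum_add_distrib, Finset.smul_sum, smul_smul]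
    · intro x hx t ht
      obtain ⟨c, hc, rfl⟩ := (hmem x).1 hx
      refine (hmem _).2 ⟨fun i => t * c i, fun i => mul_nonneg ht (hc i), ?_⟩
      simp [Finset.smul_sum, smul_smul]
    -- This is where the generators must span: the combination map is then open and sends the open
    -- positive orthant onto an open subset of the cone.
    · have hsurj : Function.Surjective (Fintype.linearCombination ℝ b) := by
        rw [← LinearMap.range_eq_top, Fintype.range_linearCombination, hspan]
      have hop := LinearMap.isOpenMap_of_finiteDimensional _ hsurj (Set.pi univ fun _ => Ioi 0)
        (isOpen_set_pi finite_univ fun _ _ => isOpen_Ioi)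
      refine ⟨Fintype.linearCombination ℝ b fun _ => 1,
        interior_maximal ?_ hop ⟨_, fun _ _ => mem_Ioi.2 one_pos, rfl⟩⟩
      rintro _ ⟨c, hc, rfl⟩
      exact (hmem _).2 ⟨c, fun i => le_of_lt (hc i (mem_univ i)),
        Fintype.linearCombination_apply ℝ b c⟩

variable {C : Set (E n)} {a e : E n} {δ : ℝ}

theorem IsSolidCone.neg_smul_notMem (hC : IsSolidCone C a e δ) {s : ℝ} (hs : 0 < s) :
    -(s • e) ∉ C := by
  intro h
  have h1 := hC.le_inner _ h
  have h2 := hC.le_inner e (interior_subset hC.mem_interior)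
  have h3 := hC.pos
  rw [norm_neg, norm_smul, hC.norm_eq, mul_one, Real.norm_of_nonneg hs.le, inner_neg_right,
    inner_smul_right] at h1
  rw [hC.norm_eq, mul_one] at h2
  nlinarith [mul_pos hs h3, mul_le_mul_of_nonneg_left h2 hs.le]

/-- The set is star-shaped about `-(r/2) e`: if a point `s(-(r/2) e) + t y` of a segment lay in the
cone, adding `s(r/2) e` would put `t y`, hence `y`, into the cone. -/
theorem IsSolidCone.isPreconnected_ball_diff (hC : IsSolidCone C a e δ) {r : ℝ} (hr : 0 < r) :
    IsPreconnected (ball 0 r \ C) := by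
  have hmem : -((r / 2) • e) ∈ ball 0 r \ C := by
    refine ⟨?_, hC.neg_smul_notMem (half_pos hr)⟩
    rw [mem_ball_zero_iff, norm_neg, norm_smul, hC.norm_eq, mul_one,
      Real.norm_of_nonneg (by positivity)]
    linarith
  have hstar : StarConvex ℝ (-((r / 2) • e)) (ball 0 r \ C) := by
    intro y hy s t hs ht hst
    refine ⟨convex_ball 0 r hmem.1 hy.1 hs ht hst, fun hin => ?_⟩
    have h1 := hC.add_smul_mem hin (t := s * (r / 2)) (by positivity)
    rw [show s • -((r / 2) • e) + t • y + (s * (r / 2)) • e = t • y by module] at h1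
    rcases ht.eq_or_lt with rfl | ht
    · obtain rfl : s = 1 := by linarith
      rw [one_smul, zero_smul, add_zero] at hin
      exact hmem.2 hin
    · have h2 := hC.smul_mem _ h1 t⁻¹ (by positivity)
      rw [smul_smul, inv_mul_cancel₀ ht.ne', one_smul] at h2
      exact hy.2 h2
  exact (hstar.isPathConnected hmem).isConnected.isPreconnected

theorem IsSolidCone.smul_mem_interior (hC : IsSolidCone C a e δ) {s : ℝ} (hs : 0 < s) :
    s • e ∈ interior C := by
  have h1 : (fun x => s • x) '' interior C ⊆ interior C := by
    refine interior_maximal ?_ (isOpenMap_smul₀ hs.ne' _ isOpen_interior)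
    rintro _ ⟨x, hx, rfl⟩
    exact hC.smul_mem x (interior_subset hx) _ hs.le
  exact h1 ⟨e, hC.mem_interior, rfl⟩

end CornerCones

/-! ### Local geometry of Lipschitz domains -/

section LipschitzDomains

variable {n : ℕ} {D : Set (E n)}

/-- Near a boundary point a Lipschitz domain is locally connected. -/
theorem IsBoundedLipschitzDomain.exists_joined (hD : IsBoundedLipschitzDomain D) {p : E n}
    (hp : p ∈ frontier D) {ε : ℝ} (hε : 0 < ε) : ∃ r > 0, ∀ x ∈ D ∩ ball p r, ∀ y ∈ D ∩ ball p r,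
      ∃ T, IsPreconnected T ∧ T ⊆ D ∩ ball p ε ∧ x ∈ T ∧ y ∈ T := by
  obtain ⟨r₀, hr₀, e, he, L, g, hg, hgr⟩ := hD.locally_graph p hp
  set ε' := min ε r₀ with hε'
  have hε'0 : 0 < ε' := lt_min hε hr₀
  have hL : (0 : ℝ) ≤ L := L.2
  -- Nearby points are joined by going up by `τ`, across, and down. The crossing has length at most
  -- `2r`: the height drops by at most `2r`, and the graph rises by at most `4Lr`, as the projection
  -- at most doubles the norm. This is `τ = (4L + 2) r`, and `r + τ < ε'` keeps the path in the
  -- ball.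
  set r := ε' / (4 * L + 4) with hr
  have hr0 : 0 < r := by positivity
  have hrε : (4 * L + 4) * r = ε' := by rw [hr]; field_simp
  set τ := (4 * L + 2) * r with hτ
  have hτ0 : 0 < τ := by positivity
  have hee : inner ℝ e e = (1 : ℝ) := by rw [real_inner_self_eq_norm_sq, he]; norm_num
  have hproj : ∀ z : E n, ‖z - inner ℝ e z • e‖ ≤ 2 * ‖z‖ := by
    intro z
    have h1 := abs_real_inner_le_norm e z
    rw [he, one_mul] at h1
    calc ‖z - inner ℝ e z • e‖ ≤ ‖z‖ + ‖inner ℝ e z • e‖ := norm_sub_le _ _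
      _ = ‖z‖ + |inner ℝ e z| := by rw [norm_smul, he, mul_one, Real.norm_eq_abs]
      _ ≤ 2 * ‖z‖ := by linarith
  have hup : ∀ x ∈ D ∩ ball p r, ∀ σ : ℝ, 0 ≤ σ → σ ≤ τ → x + σ • e ∈ ball p ε' := by
    intro x hx σ h0 h1
    have hx2 : ‖x - p‖ < r := by simpa [dist_eq_norm] using hx.2
    rw [mem_ball, dist_eq_norm]
    calc ‖x + σ • e - p‖ = ‖(x - p) + σ • e‖ := by congr 1; abel
      _ ≤ ‖x - p‖ + σ := by
        refine (norm_add_le _ _).trans_eq ?_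
        rw [norm_smul, he, mul_one, Real.norm_of_nonneg h0]
      _ < ε' := by nlinarith
  have hgraph : ∀ z ∈ ball p ε', (z ∈ D ↔ g (z - inner ℝ e z • e) < inner ℝ e z) := fun z hz =>
    hgr z (ball_subset_ball (min_le_right _ _) hz)
  have hvert : ∀ x ∈ D ∩ ball p r, segment ℝ x (x + τ • e) ⊆ D ∩ ball p ε' := by
    intro x hx
    rw [segment_eq_image]
    rintro _ ⟨s, hs, rfl⟩
    have heq : (1 - s) • x + s • (x + τ • e) = x + (s * τ) • e := by module
    simp only [heq]
    have hb := hup x hx (s * τ) (mul_nonneg hs.1 hτ0.le) (mul_le_of_le_one_left hτ0.le hs.2)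
    have hx0 : x ∈ ball p ε' := by simpa using hup x hx 0 le_rfl hτ0.le
    refine ⟨(hgraph _ hb).2 ?_, hb⟩
    have h1 := (hgraph x hx0).1 hx.1
    have h2 : inner ℝ e (x + (s * τ) • e) = inner ℝ e x + s * τ := by
      rw [inner_add_right, inner_smul_right, hee, mul_one]
    have h3 : x + (s * τ) • e - (inner ℝ e x + s * τ) • e = x - inner ℝ e x • e := by module
    rw [h2, h3]
    have := mul_nonneg hs.1 hτ0.le
    linarith
  refine ⟨r, hr0, fun x hx y hy => ?_⟩
  have hhor : segment ℝ (x + τ • e) (y + τ • e) ⊆ D ∩ ball p ε' := by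
    intro z hz
    have hb := (convex_ball p ε').segment_subset (hup x hx τ hτ0.le le_rfl)
      (hup y hy τ hτ0.le le_rfl) hz
    refine ⟨(hgraph _ hb).2 ?_, hb⟩
    rw [segment_eq_image] at hz
    obtain ⟨s, hs, rfl⟩ := hz
    have hx0 : x ∈ ball p ε' := by simpa using hup x hx 0 le_rfl hτ0.le
    have h1 := (hgraph x hx0).1 hx.1
    have hxy : ‖y - x‖ ≤ 2 * r := by
      have h2 : dist x p < r := hx.2
      have h3 : dist y p < r := hy.2
      have h4 := dist_triangle_right y x p
      rw [dist_eq_norm] at h4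
      linarith
    have heq : (1 - s) • (x + τ • e) + s • (y + τ • e) = x + s • (y - x) + τ • e := by module
    have hin : inner ℝ e (x + s • (y - x) + τ • e) =
        inner ℝ e x + s * inner ℝ e (y - x) + τ := by
      rw [inner_add_right, inner_add_right, inner_smul_right, inner_smul_right, hee, mul_one]
    have hpr : x + s • (y - x) + τ • e - (inner ℝ e x + s * inner ℝ e (y - x) + τ) • e =
        (x - inner ℝ e x • e) + s • ((y - x) - inner ℝ e (y - x) • e) := by module
    simp only [heq]
    rw [hin, hpr]
    have h5 := hg.dist_le_mul ((x - inner ℝ e x • e) + s • ((y - x) - inner ℝ e (y - x) • e))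
      (x - inner ℝ e x • e)
    rw [dist_eq_norm, dist_eq_norm, add_sub_cancel_left, norm_smul, Real.norm_of_nonneg hs.1] at h5
    have h6 : s * ‖y - x - inner ℝ e (y - x) • e‖ ≤ 4 * r := by
      have := hproj (y - x)
      nlinarith [norm_nonneg (y - x - inner ℝ e (y - x) • e), hs.1, hs.2]
    have h7 := mul_le_mul_of_nonneg_left h6 hL
    have h8 : -(2 * r) ≤ s * inner ℝ e (y - x) := by
      have h9 := abs_real_inner_le_norm e (y - x)
      rw [he, one_mul] at h9
      have h10 := (abs_le.1 (h9.trans hxy)).1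
      nlinarith [hs.1, hs.2]
    have h11 := (le_abs_self _).trans (Real.norm_eq_abs _ ▸ h5)
    simp only [hτ]
    nlinarith
  have hy' : segment ℝ (y + τ • e) y ⊆ D ∩ ball p ε' := by
    rw [segment_symm]
    exact hvert y hy
  refine ⟨segment ℝ x (x + τ • e) ∪ (segment ℝ (x + τ • e) (y + τ • e) ∪ segment ℝ (y + τ • e) y),
    ?_, ?_, Or.inl (left_mem_segment ℝ _ _), Or.inr (Or.inr (right_mem_segment ℝ _ _))⟩
  · refine IsPreconnected.union (x + τ • e) (right_mem_segment ℝ _ _)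
      (Or.inl (left_mem_segment ℝ _ _)) (convex_segment _ _).isPreconnected ?_
    exact IsPreconnected.union (y + τ • e) (right_mem_segment ℝ _ _) (left_mem_segment ℝ _ _)
      (convex_segment _ _).isPreconnected (convex_segment _ _).isPreconnected
  · refine (union_subset (hvert x hx) (union_subset hhor hy')).trans ?_
    exact inter_subset_inter_right _ (ball_subset_ball (min_le_left _ _))

/-- Near each boundary point a Lipschitz domain has exterior points. -/
theorem IsBoundedLipschitzDomain.exists_exterior_ball (hD : IsBoundedLipschitzDomain D) {p : E n}
    (hp : p ∈ frontier D) {ε : ℝ} (hε : 0 < ε) :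
    ∃ q ∈ ball p ε, ∃ s > 0, Disjoint (ball q s) D := by
  obtain ⟨r₀, hr₀, e, he, L, g, hg, hgr⟩ := hD.locally_graph p hp
  have hee : inner ℝ e e = (1 : ℝ) := by rw [real_inner_self_eq_norm_sq, he]; norm_num
  have hpD : p ∉ D := fun h => hp.2 (hD.isOpen.interior_eq.symm ▸ h)
  have h0 : inner ℝ e p ≤ g (p - inner ℝ e p • e) :=
    not_lt.1 fun h => hpD ((hgr p (mem_ball_self hr₀)).2 h)
  -- A boundary point lies on or below the graph, so moving down by `s` lands strictly below it
  -- while staying in the chart.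
  set s := min ε r₀ / 2 with hs
  have hmin : 0 < min ε r₀ := lt_min hε hr₀
  have hs0 : 0 < s := half_pos hmin
  have hq : ∀ r, min ε r₀ ≤ r → p - s • e ∈ ball p r := by
    intro r hr
    rw [mem_ball, dist_eq_norm, sub_sub_cancel_left, norm_neg, norm_smul, he, mul_one,
      Real.norm_of_nonneg hs0.le]
    linarith
  have hopen : IsOpen (ball p r₀ ∩ {x : E n | inner ℝ e x < g (x - inner ℝ e x • e)}) := by
    have hc : Continuous fun x : E n => inner ℝ e x := continuous_const.inner continuous_id
    refine isOpen_ball.inter (isOpen_lt hc (hg.continuous.comp ?_))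
    fun_prop
  obtain ⟨t, ht, hsub⟩ := Metric.isOpen_iff.1 hopen (p - s • e) (by
    refine ⟨hq _ (min_le_right _ _), ?_⟩
    have h2 : inner ℝ e (p - s • e) = inner ℝ e p - s := by
      rw [inner_sub_right, inner_smul_right, hee, mul_one]
    have h3 : p - s • e - (inner ℝ e p - s) • e = p - inner ℝ e p • e := by module
    rw [mem_ofPred_eq, h2, h3]
    linarith)
  refine ⟨p - s • e, hq _ (min_le_left _ _), t, ht, ?_⟩
  refine disjoint_left.2 fun x hx hxD => ?_
  exact lt_asymm (hsub hx).2 ((hgr x (hsub hx).1).1 hxD)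

end LipschitzDomains

/-! ### Corners of a symmetric difference -/

section CornersOfDifferences

variable {n : ℕ} {D D' : Set (E n)}

/-- If `D Δ D'` has a corner at `x₀` whose open cone lies in `D`, then `D'` stays away from `x₀`. -/
theorem exists_ball_disjoint_of_corner (hD : IsBoundedLipschitzDomain D) (hD' : IsOpen D')
    {x₀ : E n} (hx₀ : x₀ ∉ D) {S : Set (E n)} (hS : IsOpen S) (hxS : x₀ ∈ closure S)
    {h : ℝ} (hh : 0 < h) (hSD : ∀ x ∈ ball x₀ h, x ∈ S → x ∈ D ∧ x ∉ D')
    (hout : ∀ x ∈ ball x₀ h, x ∉ S → (x ∈ D ↔ x ∈ D')) :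
    ∃ r > 0, Disjoint (ball x₀ r) D' := by
  have hfr : x₀ ∈ frontier D := by
    refine ⟨?_, fun h => hx₀ (interior_subset h)⟩
    refine mem_closure_iff.2 fun V hV hxV => ?_
    obtain ⟨y, ⟨hyV, hyb⟩, hyS⟩ := mem_closure_iff.1 hxS _ (hV.inter isOpen_ball)
      ⟨hxV, mem_ball_self hh⟩
    exact ⟨y, hyV, (hSD y hyb hyS).1⟩
  obtain ⟨r, hr, hjoin⟩ := hD.exists_joined hfr hh
  have hmin : 0 < min r h := lt_min hr hh
  refine ⟨min r h, hmin, disjoint_left.2 fun y hy hyD' => ?_⟩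
  have hyh := ball_subset_ball (min_le_right r h) hy
  have hyr := ball_subset_ball (min_le_left r h) hy
  have hyS : y ∉ S := fun hyS => (hSD y hyh hyS).2 hyD'
  obtain ⟨z, hz, hzS⟩ := mem_closure_iff.1 hxS _ isOpen_ball (mem_ball_self hmin)
  have hzh := ball_subset_ball (min_le_right r h) hz
  obtain ⟨T, hT, hTsub, hyT, hzT⟩ := hjoin y ⟨(hout y hyh hyS).2 hyD', hyr⟩ z
    ⟨(hSD z hzh hzS).1, ball_subset_ball (min_le_left r h) hz⟩
  -- A point `y` of `D'` near the apex lies outside the cone, where `D` and `D'` agree, so it can be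
  -- joined inside `D` to a point `z` of the cone. The connecting set is covered by the disjoint
  -- open sets `S` and `D'`, one containing `z` and the other `y`.
  rcases IsPreconnected.subset_or_subset (hS.inter isOpen_ball) (hD'.inter isOpen_ball)
    (disjoint_left.2 fun x hx hx' => (hSD x hx.2 hx.1).2 hx'.1)
    (fun x hx => by
      have hxD := hTsub hx
      by_cases hxS : x ∈ S
      · exact Or.inl ⟨hxS, hxD.2⟩
      · exact Or.inr ⟨(hout x hxD.2 hxS).1 hxD.1, hxD.2⟩) hT with h1 | h1
  · exact hyS (h1 hyT).1
  · exact (hSD z hzh hzS).2 (h1 hzT).1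

end CornersOfDifferences

/-! ### Equal Cauchy data and extension by zero -/

section CauchyData

open Filter Topology

variable {n : ℕ} {Ω : Set (E n)}

theorem IsTestFun.memLp_restrict {φ : E n → ℂ} {V : Set (E n)} (hφ : IsTestFun V φ)
    (Ω : Set (E n)) : MemLp φ 2 (volume.restrict Ω) :=
  (hφ.smooth.continuous.memLp_of_hasCompactSupport hφ.compact).restrict Ω

/-- A compactly supported smooth function as an element of `H¹(Ω)`. -/
theorem IsTestFun.mem_H1 {φ : E n → ℂ} {V : Set (E n)} (hφ : IsTestFun V φ) (Ω : Set (E n)) :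
    ((φ, fun i => _root_.pderiv i φ) : (E n → ℂ) × (Fin n → E n → ℂ)) ∈ H1 Ω := by
  refine ⟨hφ.memLp_restrict Ω, fun i => (hφ.pderiv i).memLp_restrict Ω, fun i χ hχ => ?_⟩
  rw [setIntegral_mul_test (hχ.pderiv i), setIntegral_mul_test hχ]
  exact integral_pderiv_mul hφ.smooth hχ.smooth hχ.compact i

theorem HasDistribLaplacian.mono {V V' : Set (E n)} {W F : E n → ℂ}
    (h : HasDistribLaplacian V W F) (hV : V' ⊆ V) : HasDistribLaplacian V' W F :=
  fun φ hφ => h φ (hφ.mono hV)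

theorem HasDistribLaplacian.congr_right {V : Set (E n)} {W F F' : E n → ℂ}
    (h : HasDistribLaplacian V W F) (hF : ∀ᵐ x, x ∈ V → F x = F' x) :
    HasDistribLaplacian V W F' := by
  intro φ hφ
  rw [h φ hφ]
  refine integral_congr_ae ?_
  filter_upwards [hF] with x hx
  by_cases hxV : x ∈ V
  · rw [hx hxV]
  · rw [hφ.zero_of_notMem hxV, mul_zero, mul_zero]

theorem HasDistribLaplacian.comp_add {V : Set (E n)} {W F : E n → ℂ}
    (h : HasDistribLaplacian V W F) (a : E n) :
    HasDistribLaplacian ((fun x => x + a) ⁻¹' V) (fun x => W (x + a)) (fun x => F (x + a)) := by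
  intro φ hφ
  have hφ' : IsTestFun V (fun x => φ (x - a)) := by
    have := hφ.comp_sub a
    rw [← preimage_comp] at this
    simpa [Function.comp_def] using this
  have h1 := h _ hφ'
  rw [← integral_add_right_eq_self _ a, ← integral_add_right_eq_self (fun x => F x * _) a] at h1
  simpa [lap_comp_sub_const] using h1

theorem memLp_integrableOn (hb : Bornology.IsBounded Ω) {w : E n → ℂ}
    (hw : MemLp w 2 (volume.restrict Ω)) : IntegrableOn w Ω := by
  have : IsFiniteMeasure (volume.restrict Ω) := ⟨by simpa using hb.measure_lt_top⟩
  exact hw.integrable (by norm_num)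

/-- A distribution determines its density. This identifies the Laplacian hidden in `HasNormalDeriv`
with the right-hand side of the equation. -/
theorem HasWeakLaplacian.ae_eq (hΩ : IsOpen Ω) (hb : Bornology.IsBounded Ω) {U : H1 Ω}
    {w w' : E n → ℂ} (h : HasWeakLaplacian U w) (h' : HasWeakLaplacian U w') :
    ∀ᵐ x, x ∈ Ω → w x = w' x := by
  have hi := memLp_integrableOn hb h.1
  have hi' := memLp_integrableOn hb h'.1
  have key := hΩ.ae_eq_zero_of_integral_contDiff_smul_eq_zero
    (f := fun x => w x - w' x) (hi.sub hi').locallyIntegrableOn (fun g hg hgc hgs => by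
      have hφ : IsTestFun Ω (fun x => ((g x : ℝ) : ℂ)) :=
        ⟨Complex.ofRealCLM.contDiff.comp hg, hgc.comp_left Complex.ofReal_zero,
          (closure_mono (Function.support_comp_subset Complex.ofReal_zero g)).trans hgs⟩
      have h1 := (h.2 _ hφ).symm.trans (h'.2 _ hφ)
      rw [neg_inj] at h1
      have h2 : ∀ x, g x • (w x - w' x) = (w x - w' x) * ((g x : ℝ) : ℂ) := fun x => by
        rw [Complex.real_smul, mul_comm]
      simp_rw [h2]
      rw [← setIntegral_mul_test hφ]
      simp_rw [sub_mul]
      have hm := hφ.memLp_restrict Ω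
      have hI := integral_sub (h.1.integrable_mul hm) (h'.1.integrable_mul hm)
      simp only [Pi.mul_apply] at hI
      rw [hI, h1, sub_self])
  filter_upwards [key] with x hx hxΩ
  exact sub_eq_zero.1 (hx hxΩ)

theorem enorm_integral_mul_le {μ : Measure (E n)} {f g : E n → ℂ} (hf : MemLp f 2 μ)
    (hg : MemLp g 2 μ) : ‖∫ x, f x * g x ∂μ‖ₑ ≤ eLpNorm f 2 μ * eLpNorm g 2 μ := by
  refine (enorm_integral_le_lintegral_enorm _).trans ?_
  have h := eLpNorm_smul_le_mul_eLpNorm (p := 2) (q := 2) (r := 1) hg.1 hf.1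
  rw [eLpNorm_one_eq_lintegral_enorm] at h
  exact h

/-- Functions in `H¹₀(Ω)` can be integrated by parts against functions not vanishing on `∂Ω`. -/
theorem integral_mul_pderiv_of_mem_H10 {U : H1 Ω} (hU : U ∈ H10 Ω) {φ : E n → ℂ}
    {V : Set (E n)} (hφ : IsTestFun V φ) (i : Fin n) :
    ∫ x in Ω, sobFn U x * pderiv i φ x = -∫ x in Ω, sobGrad U i x * φ x := by
  rw [← sub_eq_zero, sub_neg_eq_add, ← enorm_eq_zero]
  have h1 := hφ.memLp_restrict Ω
  have h2 := (hφ.pderiv i).memLp_restrict Ω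
  set M := eLpNorm (pderiv i φ) 2 (volume.restrict Ω) + eLpNorm φ 2 (volume.restrict Ω) with hM
  have hMtop : M ≠ ⊤ := (ENNReal.add_lt_top.2 ⟨h2.2, h1.2⟩).ne
  have hbound : ∀ ε : ENNReal, 0 < ε → ‖(∫ x in Ω, sobFn U x * pderiv i φ x) +
      ∫ x in Ω, sobGrad U i x * φ x‖ₑ ≤ ε * M := by
    intro ε hε
    -- For a compactly supported `χ` in `Ω` the formula is classical even if `φ` does not vanish on
    -- `∂Ω`; the error of the approximation is controlled by Cauchy–Schwarz.
    obtain ⟨χ, hχ, hχ1, hχ2⟩ := hU ε hε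
    have hs1 : MemLp (sobFn U - χ) 2 (volume.restrict Ω) := U.2.1.sub (hχ.memLp_restrict Ω)
    have hs2 : MemLp (sobGrad U i - pderiv i χ) 2 (volume.restrict Ω) :=
      (U.2.2.1 i).sub ((hχ.pderiv i).memLp_restrict Ω)
    have e1 : ∫ x in Ω, χ x * pderiv i φ x = -∫ x in Ω, pderiv i χ x * φ x := by
      have h3 := setIntegral_mul_test hχ (pderiv i φ)
      have h4 := setIntegral_mul_test (hχ.pderiv i) φ
      simp only [mul_comm _ (χ _), mul_comm _ (pderiv i χ _)] at h3 h4
      rw [h3, h4]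
      exact integral_pderiv_mul hχ.smooth hφ.smooth hφ.compact i
    have e2 := integral_sub (U.2.1.integrable_mul h2) ((hχ.memLp_restrict Ω).integrable_mul h2)
    have e3 := integral_sub ((U.2.2.1 i).integrable_mul h1)
      (((hχ.pderiv i).memLp_restrict Ω).integrable_mul h1)
    have e4 : (∫ x in Ω, sobFn U x * pderiv i φ x) + ∫ x in Ω, sobGrad U i x * φ x =
        (∫ x in Ω, (sobFn U - χ) x * pderiv i φ x) +
          ∫ x in Ω, (sobGrad U i - pderiv i χ) x * φ x := by
      simp only [Pi.mul_apply] at e2 e3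
      simp only [Pi.sub_apply, sub_mul]
      simp only [sobFn, sobGrad]
      rw [e2, e3, e1]
      ring
    rw [e4, hM, mul_add]
    refine (enorm_add_le _ _).trans (add_le_add ?_ ?_)
    · exact (enorm_integral_mul_le hs1 h2).trans (by gcongr)
    · exact (enorm_integral_mul_le hs2 h1).trans (by gcongr; exact hχ2 i)
  refine le_antisymm (ENNReal.le_of_forall_pos_le_add fun ε hε _ => ?_) bot_le
  rw [zero_add]
  have hpos : (0 : ENNReal) < ε / (M + 1) :=
    ENNReal.div_pos (by exact_mod_cast hε.ne') (ENNReal.add_lt_top.2 ⟨hMtop.lt_top, by simp⟩).ne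
  refine (hbound _ hpos).trans ?_
  calc ε / (M + 1) * M ≤ ε / (M + 1) * (M + 1) := by gcongr; exact le_self_add
    _ ≤ ε := by rw [mul_comm]; exact ENNReal.mul_div_le

/-- If two functions have the same Cauchy data on `∂Ω`, then their difference, extended by zero,
does not feel the boundary. -/
theorem hasDistribLaplacian_indicator_sub (hΩ : IsOpen Ω) (hb : Bornology.IsBounded Ω)
    {U₁ U₂ : H1 Ω} {w₁ w₂ : E n → ℂ} (h₁ : HasWeakLaplacian U₁ w₁) (h₂ : HasWeakLaplacian U₂ w₂)
    (htr : sobTrace Ω U₁ = sobTrace Ω U₂) {η : HHalfDual Ω} (hη₁ : HasNormalDeriv U₁ η)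
    (hη₂ : HasNormalDeriv U₂ η) :
    HasDistribLaplacian univ (Ω.indicator fun x => sobFn U₁ x - sobFn U₂ x)
      (Ω.indicator fun x => w₁ x - w₂ x) := by
  intro φ hφ
  have hU : U₁ - U₂ ∈ H10 Ω := (Submodule.Quotient.eq _).1 htr
  have hind : ∀ f g : E n → ℂ, ∫ x, Ω.indicator f x * g x = ∫ x in Ω, f x * g x := by
    intro f g
    rw [← integral_indicator hΩ.measurableSet]
    simp only [indicator_mul_left]
  rw [hind, hind]
  obtain ⟨w₁', hw₁', hv₁⟩ := hη₁
  obtain ⟨w₂', hw₂', hv₂⟩ := hη₂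
  -- The common normal derivative, tested with the restriction of `φ` to `Ω`, equates the two Green
  -- formulas. The equal traces are used separately, to move a derivative from `φ` to `U₁ - U₂`.
  have hv := (hv₁ ⟨_, hφ.mem_H1 Ω⟩).symm.trans (hv₂ ⟨_, hφ.mem_H1 Ω⟩)
  simp only [sobFn, sobGrad] at hv
  have hm := hφ.memLp_restrict Ω
  have hcongr : ∀ {U : H1 Ω} {w w' : E n → ℂ}, HasWeakLaplacian U w → HasWeakLaplacian U w' →
      ∫ x in Ω, w' x * φ x = ∫ x in Ω, w x * φ x := by
    intro U w w' hw hw'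
    refine integral_congr_ae ((ae_restrict_iff' hΩ.measurableSet).2 ?_)
    filter_upwards [hw'.ae_eq hΩ hb hw] with x hx hxΩ
    rw [hx hxΩ]
  rw [hcongr h₁ hw₁', hcongr h₂ hw₂'] at hv
  have hI := integral_sub (h₁.1.integrable_mul hm) (h₂.1.integrable_mul hm)
  simp only [Pi.mul_apply] at hI
  simp_rw [sub_mul (w₁ _)]
  rw [hI]
  have hgi : ∀ (U : H1 Ω) (i : Fin n),
      Integrable (fun x => U.1.2 i x * pderiv i φ x) (volume.restrict Ω) := fun U i =>
    (U.2.2.1 i).integrable_mul ((hφ.pderiv i).memLp_restrict Ω)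
  rw [integral_finsetSum _ fun i _ => hgi U₁ i, integral_finsetSum _ fun i _ => hgi U₂ i] at hv
  have hlap : ∫ x in Ω, (sobFn U₁ x - sobFn U₂ x) * lap φ x =
      ∑ i, ∫ x in Ω, sobFn (U₁ - U₂) x * pderiv i (pderiv i φ) x := by
    have hi : ∀ i ∈ Finset.univ, Integrable
        (fun x => sobFn (U₁ - U₂) x * pderiv i (pderiv i φ) x) (volume.restrict Ω) := fun i _ =>
      (U₁ - U₂).2.1.integrable_mul (((hφ.pderiv i).pderiv i).memLp_restrict Ω)
    rw [← integral_finsetSum _ hi]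
    simp only [lap, Finset.mul_sum]
    rfl
  have hterm : ∀ i, ∫ x in Ω, sobFn (U₁ - U₂) x * pderiv i (pderiv i φ) x =
      -((∫ x in Ω, U₁.1.2 i x * pderiv i φ x) - ∫ x in Ω, U₂.1.2 i x * pderiv i φ x) := by
    intro i
    rw [integral_mul_pderiv_of_mem_H10 hU (hφ.pderiv i), ← integral_sub (hgi U₁ i) (hgi U₂ i)]
    simp only [← sub_mul]
    rfl
  rw [hlap, Finset.sum_congr rfl fun i _ => hterm i, Finset.sum_neg_distrib,
    Finset.sum_sub_distrib]
  linear_combination -hv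

end CauchyData

/-! ### Vanishing on a component that touches the boundary -/

section VanishingOutside

open Filter Topology

variable {n : ℕ} {Ω : Set (E n)}

/-- A compactly supported solution of the Helmholtz equation off `A ⊆ Ω` that vanishes off `Ω`
vanishes on each component of `Ω \ A` that touches `∂Ω`. -/
theorem eq_zero_on_component (hn : n ≤ 3) (hΩ : IsBoundedLipschitzDomain Ω) {lam : ℂ}
    {A : Set (E n)} (hA : IsClosed A) (hAΩ : A ⊆ Ω) {W : E n → ℂ} (hW : LocallyIntegrable W)
    (hW0 : ∀ x ∉ Ω, W x = 0) (hlap : HasDistribLaplacian Aᶜ W fun x => -lam * W x)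
    {G : Set (E n)} (hGc : IsPreconnected G) (hGA : G ⊆ Aᶜ)
    (hGΩ : (frontier G ∩ frontier Ω).Nonempty) :
    ∀ x ∈ G, ∃ r > 0, ∀ᵐ y ∂volume.restrict (ball x r), W y = 0 := by
  obtain ⟨p, hpG, hpΩ⟩ := hGΩ
  have hpA : p ∈ Aᶜ := fun h => hpΩ.2 (hΩ.isOpen.interior_eq.symm ▸ hAΩ h)
  obtain ⟨r, hr, hball⟩ := Metric.isOpen_iff.1 hA.isOpen_compl p hpA
  -- The ball about `p` avoids `A` and contains a small ball outside `Ω`, where `W = 0`.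
  -- Continuation goes first through this ball across `∂Ω`, then through `G`.
  obtain ⟨q, hq, s, hs, hdisj⟩ := hΩ.exists_exterior_ball hpΩ hr
  have hball0 := helmholtz_unique_continuation hn lam hA.isOpen_compl hW hlap
    (convex_ball p r).isPreconnected hball hq ⟨s, hs, by
      refine (ae_restrict_iff' measurableSet_ball).2 (Eventually.of_forall fun x hx => ?_)
      exact hW0 x fun h => disjoint_left.1 hdisj hx h⟩
  obtain ⟨z, hzb, hzG⟩ := mem_closure_iff.1 (frontier_subset_closure hpG) _ isOpen_ball
    (mem_ball_self hr)
  exact helmholtz_unique_continuation hn lam hA.isOpen_compl hW hlap hGc hGA hzG (hball0 z hzb)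

end VanishingOutside

/-! ### The contradiction at a corner -/

section LocalUniqueness

open Filter Topology

variable {n : ℕ} {Ω : Set (E n)}

theorem integrable_indicator_sub (hΩ : IsOpen Ω) (hb : Bornology.IsBounded Ω)
    {f g : E n → ℂ} (hf : MemLp f 2 (volume.restrict Ω)) (hg : MemLp g 2 (volume.restrict Ω)) :
    Integrable (Ω.indicator fun x => f x - g x) :=
  (integrable_indicator_iff hΩ.measurableSet).2
    ((memLp_integrableOn hb hf).sub (memLp_integrableOn hb hg))

theorem IsAdmissibleInclusion.tendsto_comp {D : Set (E n)} {lam : ℂ} {f : E n → ℂ → ℂ}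
    (h : IsAdmissibleInclusion Ω D lam f) {x₀ : E n} (hx₀ : x₀ ∈ closure D) {v : E n → ℂ}
    (hv : ContinuousAt v x₀) :
    Tendsto (fun x => f x (v x)) (𝓝[closure D] x₀) (𝓝 (f x₀ (v x₀))) := by
  obtain ⟨γ, hγ, hh⟩ := h.holder
  -- By continuity the values of `v` near `x₀` stay in this disc, so a single Hölder constant
  -- suffices.
  obtain ⟨C, hC⟩ := hh (‖v x₀‖ + 1)
  have hbound : Tendsto (fun x => C * (‖x - x₀‖ + ‖v x - v x₀‖) ^ γ) (𝓝[closure D] x₀) (𝓝 0) := by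
    have h1 : ContinuousAt (fun x => C * (‖x - x₀‖ + ‖v x - v x₀‖) ^ γ) x₀ := by
      refine continuousAt_const.mul (ContinuousAt.rpow_const ?_ (Or.inr hγ.1.le))
      exact ((continuousAt_id.sub continuousAt_const).norm).add ((hv.sub continuousAt_const).norm)
    have h2 := h1.tendsto.mono_left (nhdsWithin_le_nhds (s := closure D))
    simpa [Real.zero_rpow hγ.1.ne'] using h2
  refine tendsto_iff_norm_sub_tendsto_zero.2 (squeeze_zero' (Eventually.of_forall fun x =>
    norm_nonneg _) ?_ hbound)
  have h3 : ∀ᶠ x in 𝓝 x₀, ‖v x‖ < ‖v x₀‖ + 1 := hv.norm.eventually_lt continuousAt_const (by simp)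
  filter_upwards [self_mem_nhdsWithin, nhdsWithin_le_nhds h3] with x hx hxv
  exact hC x hx x₀ hx₀ _ _ hxv.le (by linarith)

/-- If only the inclusion `D₁` reaches the apex `xc` and does so by a corner, then the
nondegeneracy condition fails there. -/
theorem not_cornerNondegenerate_of_cone (hn : n = 2 ∨ n = 3) (hΩ : IsBoundedLipschitzDomain Ω)
    {lam : ℂ} {D₁ D₂ : Set (E n)} {f₁ f₂ : E n → ℂ → ℂ}
    (hA₁ : IsAdmissibleInclusion Ω D₁ lam f₁) (hA₂ : IsAdmissibleInclusion Ω D₂ lam f₂)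
    {ψ : HHalf Ω} {η : HHalfDual Ω} {U₁ U₂ : H1 Ω}
    (hm₁ : IsBoundaryMeasurement D₁ lam f₁ U₁ ψ η) (hm₂ : IsBoundaryMeasurement D₂ lam f₂ U₂ ψ η)
    {G : Set (E n)}
    (hG : ∃ x ∈ Ω \ closure (D₁ ∪ D₂), G = connectedComponentIn (Ω \ closure (D₁ ∪ D₂)) x)
    (hGΩ : (frontier G ∩ frontier Ω).Nonempty) {xc : E n} (hxc : xc ∈ closure G)
    (hcorner : HasCornerAt D₁ xc) {C : Set (E n)} {a e : E n} {δ h : ℝ}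
    (hC : IsSolidCone C a e δ) (hh : 0 < h)
    (hD₁ : ∀ x ∈ ball xc h, (x ∈ D₁ ↔ x - xc ∈ interior C)) (hD₂ : ∀ x ∈ ball xc h, x ∉ D₂) :
    ¬ CornerNondegenerate D₁ lam f₁ U₁ := by
  intro hB
  have hn3 : n ≤ 3 := by rcases hn with rfl | rfl <;> norm_num
  have hΩo := hΩ.isOpen
  have hb := hΩ.isBounded
  set A := closure (D₁ ∪ D₂) with hAdef
  have hAΩ : A ⊆ Ω := by
    rw [hAdef, closure_union]
    exact union_subset hA₁.closure_subset hA₂.closure_subset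
  -- the difference of the two solutions, extended by zero
  set w₁ : E n → ℂ := fun x => -nonlinearity D₁ lam f₁ x (sobFn U₁ x) with hw₁
  set w₂ : E n → ℂ := fun x => -nonlinearity D₂ lam f₂ x (sobFn U₂ x) with hw₂
  set W := Ω.indicator fun x => sobFn U₁ x - sobFn U₂ x with hW
  set F := Ω.indicator fun x => w₁ x - w₂ x with hF
  have hlap : HasDistribLaplacian univ W F :=
    hasDistribLaplacian_indicator_sub hΩo hb hm₁.1.1 hm₂.1.1 (hm₁.1.2.trans hm₂.1.2.symm)
      hm₁.2 hm₂.2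
  have hWi : Integrable W := integrable_indicator_sub hΩo hb U₁.2.1 U₂.2.1
  have hFi : Integrable F := integrable_indicator_sub hΩo hb hm₁.1.1.1 hm₂.1.1.1
  have hFW : ∀ x, x ∉ D₁ → x ∉ D₂ → F x = -lam * W x := by
    intro x h1 h2
    by_cases hx : x ∈ Ω
    · simp only [hF, hW, hw₁, hw₂, indicator_of_mem hx, nonlinearity, if_neg h1, if_neg h2]
      ring
    · simp [hF, hW, indicator_of_notMem hx]
  have hlapA : HasDistribLaplacian Aᶜ W fun x => -lam * W x :=
    (hlap.mono (subset_univ _)).congr_right (Eventually.of_forall fun x hx =>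
      hFW x (fun h => hx (subset_closure (Or.inl h))) fun h => hx (subset_closure (Or.inr h)))
  obtain ⟨x₁, hx₁, hGeq⟩ := hG
  have hGsub : G ⊆ Ω \ A := hGeq ▸ connectedComponentIn_subset _ _
  have hGopen : IsOpen G := hGeq ▸ (hΩo.sdiff isClosed_closure).connectedComponentIn
  have hvan := eq_zero_on_component hn3 hΩ isClosed_closure hAΩ hWi.locallyIntegrable
    (fun x hx => indicator_of_notMem hx _) hlapA (hGeq ▸ isPreconnected_connectedComponentIn)
    (fun x hx => (hGsub hx).2) hGΩ
  have hGae : ∀ᵐ x, x ∈ G → W x = 0 := ae_of_locally hvan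
  -- a small ball around the apex
  have hxcD : xc ∈ closure D₁ := by
    refine mem_closure_iff.2 fun V hV hxV => ?_
    obtain ⟨r, hr, hrV⟩ := Metric.isOpen_iff.1 (hV.inter isOpen_ball) xc ⟨hxV, mem_ball_self hh⟩
    have h1 : xc + (r / 2) • e ∈ ball xc r := by
      rw [mem_ball, dist_eq_norm, add_sub_cancel_left, norm_smul, hC.norm_eq, mul_one,
        Real.norm_of_nonneg (by positivity)]
      linarith
    refine ⟨_, (hrV h1).1, (hD₁ _ (hrV h1).2).2 ?_⟩
    rw [add_sub_cancel_left]
    exact hC.smul_mem_interior (half_pos hr)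
  have hxcΩ : xc ∈ Ω := hA₁.closure_subset hxcD
  obtain ⟨r₀, hr₀, hr₀Ω⟩ := Metric.isOpen_iff.1 hΩo xc hxcΩ
  set r := min h r₀ with hr
  have hr0 : 0 < r := lt_min hh hr₀
  have hrh : ball xc r ⊆ ball xc h := ball_subset_ball (min_le_left _ _)
  have hrΩ : ball xc r ⊆ Ω := (ball_subset_ball (min_le_right _ _)).trans hr₀Ω
  set S : Set (E n) := ball xc r ∩ {x | x - xc ∉ C} with hS
  have hSopen : IsOpen S :=
    isOpen_ball.inter (hC.isClosed.isOpen_compl.preimage (continuous_id.sub continuous_const))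
  have hSD : ∀ x ∈ S, x ∉ D₁ ∪ D₂ := by
    rintro x ⟨hxb, hxC⟩ (hx | hx)
    · exact hxC (interior_subset ((hD₁ x (hrh hxb)).1 hx))
    · exact hD₂ x (hrh hxb) hx
  have hSA : S ⊆ Ω \ A := fun x hx => ⟨hrΩ hx.1, fun hxA => by
    obtain ⟨y, hyS, hyD⟩ := mem_closure_iff.1 hxA S hSopen hx
    exact hSD y hyS hyD⟩
  have hSpre : IsPreconnected S := by
    have h1 := (hC.isPreconnected_ball_diff hr0).image (fun y => y + xc) (by fun_prop)
    convert h1 using 1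
    ext x
    simp only [hS, mem_image, mem_inter_iff, Set.mem_sdiff, mem_ball, dist_eq_norm, sub_zero]
    constructor
    · intro hx
      exact ⟨x - xc, hx, sub_add_cancel _ _⟩
    · rintro ⟨y, hy, rfl⟩
      simpa using hy
  -- Were `G` disjoint from `S`, the open set `G` near the apex would lie in the closed cone, hence
  -- in its interior, hence in `D₁`. So `G` meets `S`, and the connected set `S` lies in that
  -- component.
  have hSG : S ⊆ G := by
    obtain ⟨z, hzS, hzG⟩ : (S ∩ G).Nonempty := by
      by_contra hempty
      obtain ⟨y, hyb, hyG⟩ := mem_closure_iff.1 hxc _ isOpen_ball (mem_ball_self hr0)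
      have hopen : IsOpen ((fun y => y + xc) ⁻¹' (ball xc r ∩ G)) :=
        (isOpen_ball.inter hGopen).preimage (by fun_prop)
      have hsub : (fun y => y + xc) ⁻¹' (ball xc r ∩ G) ⊆ C := by
        rintro y ⟨h1, h2⟩
        by_contra h3
        exact hempty ⟨y + xc, ⟨h1, by simpa using h3⟩, h2⟩
      have hin : y - xc ∈ interior C := interior_maximal hsub hopen (by simpa using ⟨hyb, hyG⟩)
      exact (hGsub hyG).2 (subset_closure (Or.inl ((hD₁ y (hrh hyb)).2 hin)))
    rw [hGeq, connectedComponentIn_eq (hGeq ▸ hzG : z ∈ connectedComponentIn (Ω \ A) x₁)]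
    exact hSpre.subset_connectedComponentIn hzS hSA
  -- continuous representatives
  obtain ⟨v₁, hv₁c, hv₁⟩ := hm₁.1.1.exists_continuousOn hn3 hΩo
  obtain ⟨v₂, hv₂c, hv₂⟩ := hm₂.1.1.exists_continuousOn hn3 hΩo
  have hv₁' := (ae_restrict_iff' hΩo.measurableSet).1 hv₁
  have hv₂' := (ae_restrict_iff' hΩo.measurableSet).1 hv₂
  have heqS : EqOn v₁ v₂ S := by
    refine Measure.eqOn_open_of_ae_eq (μ := volume) ?_ hSopen
      (hv₁c.mono (hSA.trans sdiff_subset)) (hv₂c.mono (hSA.trans sdiff_subset))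
    refine (ae_restrict_iff' hSopen.measurableSet).2 ?_
    filter_upwards [hv₁', hv₂', hGae] with x h1 h2 h3 hx
    have h4 := h3 (hSG hx)
    rw [hW, indicator_of_mem (hSA hx).1, sub_eq_zero] at h4
    rw [h1 (hSA hx).1, h2 (hSA hx).1, h4]
  have hv₁x : ContinuousAt v₁ xc := hv₁c.continuousAt (hΩo.mem_nhds hxcΩ)
  have hv₂x : ContinuousAt v₂ xc := hv₂c.continuousAt (hΩo.mem_nhds hxcΩ)
  have hxcS : xc ∈ closure S := by
    refine mem_closure_iff.2 fun V hV hxV => ?_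
    obtain ⟨s, hs, hsV⟩ := Metric.isOpen_iff.1 (hV.inter isOpen_ball) xc ⟨hxV, mem_ball_self hr0⟩
    have h1 : xc + -((s / 2) • e) ∈ ball xc s := by
      rw [mem_ball, dist_eq_norm, add_sub_cancel_left, norm_neg, norm_smul, hC.norm_eq, mul_one,
        Real.norm_of_nonneg (by positivity)]
      linarith
    refine ⟨_, (hsV h1).1, (hsV h1).2, ?_⟩
    rw [mem_ofPred_eq, add_sub_cancel_left]
    exact hC.neg_smul_notMem (half_pos hs)
  -- The apex is a limit of points of `S`, where `W = 0`; continuity of both representatives does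
  -- the rest.
  have hvx : v₁ xc = v₂ xc := by
    have : (𝓝[S] xc).NeBot := mem_closure_iff_nhdsWithin_neBot.1 hxcS
    refine tendsto_nhds_unique (hv₁x.tendsto.mono_left (nhdsWithin_le_nhds (s := S))) ?_
    refine (hv₂x.tendsto.mono_left nhdsWithin_le_nhds).congr' ?_
    filter_upwards [self_mem_nhdsWithin] with x hx using (heqS hx).symm
  refine hB v₁ hv₁c hv₁ xc hcorner ?_
  rw [hvx]
  -- the value of `F` at the apex
  have hfront : ∀ᵐ x : E n, x - xc ∉ frontier C := by
    have h0 : ∀ᵐ x : E n, x ∉ frontier C := by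
      rw [ae_iff]
      simpa using hC.convex.addHaar_frontier volume
    exact (measurePreserving_sub_right volume xc).quasiMeasurePreserving.ae h0
  have hFv : ∀ᵐ x, x ∈ ball xc r → x - xc ∈ C → F x = lam * v₂ x - f₁ x (v₁ x) := by
    filter_upwards [hv₁', hv₂', hfront] with x h1 h2 h3 hxb hxC
    have hxi : x - xc ∈ interior C := by
      by_contra h4
      exact h3 ⟨subset_closure hxC, h4⟩
    have hxD := (hD₁ x (hrh hxb)).2 hxi
    rw [hF, indicator_of_mem (hrΩ hxb)]
    simp only [hw₁, hw₂, nonlinearity, if_pos hxD, if_neg (hD₂ x (hrh hxb))]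
    rw [h1 (hrΩ hxb), h2 (hrΩ hxb)]
    ring
  have hlim : Tendsto (fun x => lam * v₂ x - f₁ x (v₁ x)) (𝓝[closure D₁] xc)
      (𝓝 (lam * v₂ xc - f₁ xc (v₂ xc))) := by
    rw [← hvx]
    refine Tendsto.sub ?_ (hA₁.tendsto_comp hxcD hv₁x)
    rw [hvx]
    exact (hv₂x.tendsto.mono_left nhdsWithin_le_nhds).const_mul lam
  have hsmall : ∀ ε > 0, ∃ ρ > 0, ∀ᵐ x, x ∈ ball (0 : E n) ρ → x ∈ C →
      ‖F (x + xc) - (lam * v₂ xc - f₁ xc (v₂ xc))‖ ≤ ε := by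
    intro ε hε
    obtain ⟨ρ, hρ, hρε⟩ := Metric.mem_nhdsWithin_iff.1 (hlim (closedBall_mem_nhds _ hε))
    refine ⟨min ρ r, lt_min hρ hr0, ?_⟩
    have h1 := (measurePreserving_add_right volume xc).quasiMeasurePreserving.ae (hFv.and hfront)
    filter_upwards [h1] with x hx hxb hxC
    rw [mem_ball_zero_iff] at hxb
    have hxr : x + xc ∈ ball xc r := by simpa using hxb.trans_le (min_le_right _ _)
    rw [add_sub_cancel_right] at hx
    have hxi : x ∈ interior C := by
      by_contra h4
      exact hx.2 ⟨subset_closure hxC, h4⟩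
    rw [hx.1 hxr hxC, ← dist_eq_norm]
    refine hρε ⟨by simpa using hxb.trans_le (min_le_left _ _), subset_closure ?_⟩
    exact (hD₁ _ (hrh hxr)).2 (by simpa using hxi)
  have hout : ∀ᵐ x, x ∈ ball (0 : E n) r → x ∉ C → W (x + xc) = 0 ∧ F (x + xc) = 0 := by
    have h1 := (measurePreserving_add_right volume xc).quasiMeasurePreserving.ae hGae
    filter_upwards [h1] with x hx hxb hxC
    have hxS : x + xc ∈ S := ⟨by simpa using hxb, by simpa using hxC⟩
    have h0 := hx (hSG hxS)
    refine ⟨h0, ?_⟩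
    rw [hFW _ (fun h => hSD _ hxS (Or.inl h)) (fun h => hSD _ hxS (Or.inr h)), h0, mul_zero]
  have hlap0 : HasDistribLaplacian (ball 0 r) (fun x => W (x + xc)) fun x => F (x + xc) :=
    (hlap.comp_add xc).mono (subset_univ _)
  obtain ⟨m, hm, rfl⟩ : ∃ m, 1 ≤ m ∧ n = m + 1 := ⟨n - 1, by lia, by lia⟩
  exact hC.eq_zero_of_hasDistribLaplacian hm hr0 (hWi.comp_add_right xc).integrableOn
    (hFi.comp_add_right xc).integrableOn hlap0 (hout.mono fun x hx h1 h2 => (hx h1 h2).1)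
    (hout.mono fun x hx h1 h2 => (hx h1 h2).2) hsmall

end LocalUniqueness

/-! ### Reduction to a corner of a single inclusion -/

theorem theorem2p2 {n : ℕ} (hn : n = 2 ∨ n = 3) (Ω : Set (E n))
    (hΩ : IsBoundedLipschitzDomain Ω) (lam : ℂ)
    (D₁ D₂ : Set (E n)) (f₁ f₂ : E n → ℂ → ℂ)
    (hA₁ : IsAdmissibleInclusion Ω D₁ lam f₁)
    (hA₂ : IsAdmissibleInclusion Ω D₂ lam f₂)
    (ψ : HHalf Ω) (η : HHalfDual Ω) (U₁ U₂ : H1 Ω)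
    (hm₁ : IsBoundaryMeasurement D₁ lam f₁ U₁ ψ η)
    (hm₂ : IsBoundaryMeasurement D₂ lam f₂ U₂ ψ η)
    (hB₁ : CornerNondegenerate D₁ lam f₁ U₁)
    (hB₂ : CornerNondegenerate D₂ lam f₂ U₂)
    (G : Set (E n))
    (hG : ∃ x ∈ Ω \ closure (D₁ ∪ D₂), G = connectedComponentIn (Ω \ closure (D₁ ∪ D₂)) x)
    (hGΩ : (frontier G ∩ frontier Ω).Nonempty) :
    ¬ ∃ xc ∈ frontier G, HasCornerAt (symmDiff D₁ D₂) xc := by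
  rintro ⟨xc, hxcG, K, hK, h, hh, hKh⟩
  obtain ⟨C, a, e, δ, hC, hCK⟩ := exists_isSolidCone_of_corner hK
  have hxc : xc ∈ closure G := frontier_subset_closure hxcG
  have hGsub : G ⊆ Ω \ closure (D₁ ∪ D₂) := by
    obtain ⟨x, -, rfl⟩ := hG
    exact connectedComponentIn_subset _ _
  have hxcD : xc ∉ D₁ ∪ D₂ := fun hx => by
    obtain ⟨y, hy, hyG⟩ := mem_closure_iff.1 hxc _
      (hA₁.lipschitz.isOpen.union hA₂.lipschitz.isOpen) hx
    exact (hGsub hyG).2 (subset_closure hy)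
  set S : Set (E n) := {x | x - xc ∈ interior C} with hS
  have hSo : IsOpen S := isOpen_interior.preimage (continuous_id.sub continuous_const)
  have hmem : ∀ x ∈ ball xc h, (x ∈ symmDiff D₁ D₂ ↔ x ∈ S) := by
    intro x hx
    have h1 : x ∈ symmDiff D₁ D₂ ∩ ball xc h ↔ x ∈ interior K ∩ ball xc h := by rw [hKh]
    simp only [mem_inter_iff, hx, and_true] at h1
    rw [h1, hCK]
    rfl
  have hSc : Convex ℝ S := by
    have := hC.convex.interior.translate_preimage_left (-xc)
    have hpre : S = (fun x => x + -xc) ⁻¹' interior C := by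
      ext x
      simp [hS, sub_eq_add_neg]
    rw [hpre]
    exact this
  have hxS : xc ∈ closure S := by
    refine mem_closure_iff.2 fun V hV hxV => ?_
    obtain ⟨r, hr, hrV⟩ := Metric.isOpen_iff.1 hV xc hxV
    refine ⟨xc + (r / 2) • e, hrV ?_, ?_⟩
    · rw [mem_ball, dist_eq_norm, add_sub_cancel_left, norm_smul, hC.norm_eq, mul_one,
        Real.norm_of_nonneg (by positivity)]
      linarith
    · change xc + (r / 2) • e - xc ∈ interior C
      rw [add_sub_cancel_left]
      exact hC.smul_mem_interior (half_pos hr)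
  have hpre : IsPreconnected (S ∩ ball xc h) := (hSc.inter (convex_ball xc h)).isPreconnected
  -- In the truncated open cone exactly one of `D₁`, `D₂` contains each point, so two disjoint open
  -- sets cover a connected set and one of them is all of it.
  have hcase := IsPreconnected.subset_or_subset
    ((hA₁.lipschitz.isOpen.inter hSo).inter isOpen_ball)
    ((hA₂.lipschitz.isOpen.inter hSo).inter isOpen_ball)
    (disjoint_left.2 fun x hx hx' => by
      rcases (hmem x hx.2).2 hx.1.2 with h1 | h1
      · exact h1.2 hx'.1.1
      · exact h1.2 hx.1.1)
    (fun x hx => by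
      rcases (hmem x hx.2).2 hx.1 with h1 | h1
      · exact Or.inl ⟨⟨h1.1, hx.1⟩, hx.2⟩
      · exact Or.inr ⟨⟨h1.1, hx.1⟩, hx.2⟩) hpre
  have hout : ∀ x ∈ ball xc h, x ∉ S → (x ∈ D₁ ↔ x ∈ D₂) := by
    intro x hx hxS
    have := mt (hmem x hx).1 hxS
    rw [mem_symmDiff] at this
    tauto
  -- Once `D'` is away from the apex, outside the cone `D` agrees with the empty set, so the corner
  -- of the symmetric difference is a corner of `D` with the same cone.
  have hlocal : ∀ {D D' : Set (E n)} {r : ℝ}, 0 < r → Disjoint (ball xc r) D' →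
      (∀ x ∈ ball xc h, x ∈ S → x ∈ D) →
      (∀ x ∈ ball xc h, x ∉ S → (x ∈ D ↔ x ∈ D')) →
      HasCornerAt D xc ∧ ∃ ρ > 0, (∀ x ∈ ball xc ρ, (x ∈ D ↔ x - xc ∈ interior C)) ∧
        ∀ x ∈ ball xc ρ, x ∉ D' := by
    intro D D' r hr hdisj hSD hSout
    have hρ : 0 < min r h := lt_min hr hh
    have h1 : ∀ x ∈ ball xc (min r h), x ∉ D' := fun x hx =>
      disjoint_left.1 hdisj (ball_subset_ball (min_le_left _ _) hx)
    have h2 : ∀ x ∈ ball xc (min r h), (x ∈ D ↔ x - xc ∈ interior C) := by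
      intro x hx
      have hxh := ball_subset_ball (min_le_right _ _) hx
      refine ⟨fun hxD => ?_, fun hxS => hSD x hxh hxS⟩
      by_contra hxS
      exact h1 x hx ((hSout x hxh hxS).1 hxD)
    refine ⟨⟨K, hK, min r h, hρ, ?_⟩, min r h, hρ, h2, h1⟩
    ext x
    refine and_congr_left fun hx => ?_
    rw [h2 x hx, hCK]
  rcases hcase with hsub | hsub
  · have hSD : ∀ x ∈ ball xc h, x ∈ S → x ∈ D₁ := fun x hx hxS => (hsub ⟨hxS, hx⟩).1.1
    obtain ⟨r, hr, hdisj⟩ := exists_ball_disjoint_of_corner hA₁.lipschitz hA₂.lipschitz.isOpen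
      (fun hx => hxcD (Or.inl hx)) hSo hxS hh (fun x hx hxS => ⟨hSD x hx hxS, fun hx2 => by
        rcases (hmem x hx).2 hxS with h1 | h1
        · exact h1.2 hx2
        · exact h1.2 (hSD x hx hxS)⟩) hout
    obtain ⟨hcor, ρ, hρ, h1, h2⟩ := hlocal hr hdisj hSD hout
    exact not_cornerNondegenerate_of_cone hn hΩ hA₁ hA₂ hm₁ hm₂ hG hGΩ hxc hcor hC hρ h1 h2 hB₁
  · have hSD : ∀ x ∈ ball xc h, x ∈ S → x ∈ D₂ := fun x hx hxS => (hsub ⟨hxS, hx⟩).1.1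
    have hout' : ∀ x ∈ ball xc h, x ∉ S → (x ∈ D₂ ↔ x ∈ D₁) := fun x hx hxS =>
      (hout x hx hxS).symm
    obtain ⟨r, hr, hdisj⟩ := exists_ball_disjoint_of_corner hA₂.lipschitz hA₁.lipschitz.isOpen
      (fun hx => hxcD (Or.inr hx)) hSo hxS hh (fun x hx hxS => ⟨hSD x hx hxS, fun hx1 => by
        rcases (hmem x hx).2 hxS with h1 | h1
        · exact h1.2 (hSD x hx hxS)
        · exact h1.2 hx1⟩) hout'
    obtain ⟨hcor, ρ, hρ, h1, h2⟩ := hlocal hr hdisj hSD hout'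
    rw [union_comm] at hG
    exact not_cornerNondegenerate_of_cone hn hΩ hA₂ hA₁ hm₂ hm₁ hG hGΩ hxc hcor hC hρ h1 h2 hB₂
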